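/- Let $(X,\mathsf d)$ be a complete separable metric space and $\mathfrak m\ge 0$ a Borel measure on $X$ that is finite on bounded sets. **Sobolev space.** Let $\mathrm{LIP}_{bs}(X)$ be the set of real-valued Lipschitz functions on $X$ with bounded support, and for such $u$ let $\mathrm{lip}(u)(x)=\limsup_{y\to x}|u(y)-u(x)|/\mathsf d(y,x)$ be its slope ($0$ if $x$ is isolated). For $f\in L^2(\mathfrak m)$ the Cheeger energy is $$\mathrm E_{\mathrm{Ch}}(f)=\inf\Big\{\liminf_{n}\tfrac12\int \mathrm{lip}^2(u_n)\,d\mathfrak m \;:\; (u_n)_n\subseteq\mathrm{LIP}_{bs}(X),\ u_n\to f \text{ in } L^2(\mathfrak m)\Big\},$$ and $W^{1,2}(X)$ consists of those $f\in L^2(\mathfrak m)$ for which there are $u_n\in\mathrm{LIP}_{bs}(X)$ with $u_n\to f$ in $L^2(\mathfrak m)$ and $\liminf_n\int\mathrm{lip}^2(u_n)\,d\mathfrak m<\infty$; its norm is $\|f\|_{W^{1,2}}=(\|f\|_{L^2(\mathfrak m)}^2+2\mathrm E_{\mathrm{Ch}}(f))^{1/2}$. For $f\in W^{1,2}(X)$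 the minimal relaxed slope $|Df|\in L^2(\mathfrak m)$ is the ($\mathfrak m$-a.e. unique) strong $L^2(\mathfrak m)$-limit of slopes $\mathrm{lip}(u_n)$ of some sequence $(u_n)_n\subseteq \mathrm{LIP}_{bs}(X)$ with $u_n\to f$ in $L^2(\mathfrak m)$ that satisfies $\mathrm E_{\mathrm{Ch}}(f)=\frac12\int|Df|^2\,d\mathfrak m$. The space $(X,\mathsf d,\mathfrak m)$ is infinitesimally Hilbertian if $W^{1,2}(X)$ is a Hilbert space, i.e. its norm satisfies the parallelogram rule; in this case, for $f,g\in W^{1,2}(X)$, the pointwise scalar product of the gradients is $$\langle\nabla g,\nabla f\rangle=\tfrac12\big(|D(g+f)|^2-|Dg|^2-|Df|^2\big)\in L^1(\mathfrak m).$$ **Test plans.** Let $C([0,1],X)$ carry the supremum distance, and let $\mathrm e_t(\gamma)=\gamma_t$. A curve $\gamma\in C([0,1],X)$ is absolutely continuous if there is $h\in L^1(0,1)$ with $\mathsf d(\gamma_t,\gamma_s)\le\int_s^t h(r)\,dr$ for all $s<t$; its metric speed is $|\dot\gamma_t|=\lim_{s\to t}\mathsf d(\gamma_s,\gamma_t)/|s-t|$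 ($0$ where the limit does not exist), and $\gamma\in AC^2$ if moreover $|\dot\gamma|\in L^2(0,1)$. For $t\in(0,1]$ put $\mathrm E_{2,t}(\gamma)=t\big(\frac1t\int_0^t|\dot\gamma_s|^2ds\big)^{1/2}$ if $\gamma\in AC^2$ and $\mathrm E_{2,t}(\gamma)=+\infty$ otherwise. A $2$-test plan is a Borel probability measure $\pi$ on $C([0,1],X)$ such that $(\mathrm e_t)_\#\pi\le C\mathfrak m$ for all $t\in[0,1]$ and some constant $C>0$, and $\int \mathrm E_{2,1}^2\,d\pi<\infty$. It $2$-represents the gradient of $f\in W^{1,2}(X)$ if, as $t\searrow0$, $$\frac{f\circ\mathrm e_t-f\circ\mathrm e_0}{\mathrm E_{2,t}}\to|Df|\circ\mathrm e_0\quad\text{and}\quad\frac{\mathrm E_{2,t}}{t}\to|Df|\circ\mathrm e_0\qquad\text{strongly in }L^2(\pi)$$ (with the convention $0/0=0$). **Statement.** Let $(X,\mathsf d,\mathfrak m)$ be infinitesimally Hilbertian, let $f\in W^{1,2}(X)$, and let $\pi$ be a $2$-test plan that $2$-represents the gradient of $f$. Then for every $g\in W^{1,2}(X)$ $$\frac{g\circ\mathrm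 e_t-g\circ\mathrm e_0}{t}\rightharpoonup\langle\nabla g,\nabla f\rangle\circ\mathrm e_0\qquad\text{weakly in }L^1(\pi)\text{ as }t\searrow0;$$ that is, all these functions belong to $L^1(\pi)$ and for every $h\in L^\infty(\pi)$ $$\lim_{t\searrow0}\int h\,\frac{g\circ\mathrm e_t-g\circ\mathrm e_0}{t}\,d\pi=\int h\,\langle\nabla g,\nabla f\rangle\circ\mathrm e_0\,d\pi .$$ -/

import Mathlib

open MeasureTheory Filter Topology Set
open scoped ENNReal NNReal unitInterval

noncomputable section

namespace MetricSobolev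

section Sobolev

variable {X : Type*} [MetricSpace X] [MeasurableSpace X]

/-- The measure `m` is finite on bounded sets. -/
def BoundedlyFinite (m : Measure X) : Prop :=
  ∀ s : Set X, Bornology.IsBounded s → m s < ∞

/-- Lipschitz functions with bounded support. -/
def IsLipBs (u : X → ℝ) : Prop :=
  (∃ K : ℝ≥0, LipschitzWith K u) ∧ Bornology.IsBounded (Function.support u)

/-- The slope `lip u x = limsup_{y → x} |u y - u x| / d(y, x)`. At an isolated point the punctured
neighbourhood filter is `⊥`, so the upper limit, taken in `[0, ∞]`, is `0`. -/
def lip (u : X → ℝ) (x : X) : ℝ≥0∞ :=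
  limsup (fun y => edist (u y) (u x) / edist y x) (𝓝[≠] x)

/-- `u` is a sequence of Lipschitz functions with bounded support converging to `f` in `L²(m)`. -/
def ApproximatesL2 (m : Measure X) (f : X → ℝ) (u : ℕ → X → ℝ) : Prop :=
  (∀ n, IsLipBs (u n)) ∧ Tendsto (fun n => eLpNorm (fun x => u n x - f x) 2 m) atTop (𝓝 0)

/-- `f` is (a representative of) an element of the Sobolev space `W^{1,2}`. -/
def MemW12 (m : Measure X) (f : X → ℝ) : Prop :=
  MemLp f 2 m ∧ ∃ u : ℕ → X → ℝ, ApproximatesL2 m f u ∧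
    liminf (fun n => ∫⁻ x, lip (u n) x ^ 2 ∂m) atTop < ∞

/-- The Cheeger `2`-energy. -/
def cheegerEnergy (m : Measure X) (f : X → ℝ) : ℝ≥0∞ :=
  ⨅ (u : ℕ → X → ℝ) (_ : ApproximatesL2 m f u),
    liminf (fun n => 2⁻¹ * ∫⁻ x, lip (u n) x ^ 2 ∂m) atTop

/-- The norm of `W^{1,2}`, i.e. `(‖f‖²_{L²} + 2 E_Ch(f))^{1/2}`. -/
def w12Norm (m : Measure X) (f : X → ℝ) : ℝ :=
  Real.sqrt ((eLpNorm f 2 m).toReal ^ 2 + 2 * (cheegerEnergy m f).toReal)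

/-- The norm of `W^{1,2}` is a Hilbert norm (it satisfies the parallelogram rule). -/
def InfinitesimallyHilbertian (m : Measure X) : Prop :=
  ∀ f g : X → ℝ, MemW12 m f → MemW12 m g →
    w12Norm m (f + g) ^ 2 + w12Norm m (f - g) ^ 2 = 2 * w12Norm m f ^ 2 + 2 * w12Norm m g ^ 2

/-- `G` is the minimal `2`-relaxed slope of `f`: it is a strong `L²(m)`-limit of slopes of Lipschitz
functions with bounded support that converge to `f` in `L²(m)`, and it realises the
Cheeger energy of `f`. For `f ∈ W^{1,2}` such a `G` exists and is unique up to `m`-a.e. equality. -/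
def IsMinimalRelaxedSlope (m : Measure X) (f G : X → ℝ) : Prop :=
  MemLp G 2 m ∧
  (∃ u : ℕ → X → ℝ, ApproximatesL2 m f u ∧
    Tendsto (fun n => eLpNorm (fun x => (lip (u n) x).toReal - G x) 2 m) atTop (𝓝 0)) ∧
  cheegerEnergy m f = 2⁻¹ * ∫⁻ x, ‖G x‖ₑ ^ 2 ∂m

open Classical in
/-- (A representative of) the minimal `2`-relaxed slope `|Df|`. -/
def relaxedSlope (m : Measure X) (f : X → ℝ) : X → ℝ :=
  if h : ∃ G : X → ℝ, IsMinimalRelaxedSlope m f G then h.choose else 0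

/-- The pointwise scalar product `⟨∇g, ∇f⟩`, by polarisation of the pointwise norm
`|∇f| = |Df|`. -/
def gradInner (m : Measure X) (g f : X → ℝ) (x : X) : ℝ :=
  (relaxedSlope m (g + f) x ^ 2 - relaxedSlope m g x ^ 2 - relaxedSlope m f x ^ 2) / 2

end Sobolev

section Curves

variable {X : Type*} [MetricSpace X]

/-- Absolutely continuous curves. -/
def IsAC (γ : C(I, X)) : Prop :=
  ∃ g : I → ℝ, Integrable g ∧ ∀ s t : I, s < t → dist (γ t) (γ s) ≤ ∫ r in Icc s t, g r

open Classical in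
/-- The metric speed `lim_{s → t} d(γ s, γ t) / |s - t|`, declared to be `0` where the limit does
not exist. -/
def metricSpeed (γ : C(I, X)) (t : I) : ℝ :=
  if h : ∃ v : ℝ, Tendsto (fun s : I => dist (γ s) (γ t) / dist s t) (𝓝[≠] t) (𝓝 v)
  then h.choose else 0

/-- `2`-absolutely continuous curves. -/
def IsAC2 (γ : C(I, X)) : Prop :=
  IsAC γ ∧ MemLp (metricSpeed γ) 2 volume

open Classical in
/-- The `2`-energy functional `E_{2,t}`. -/
def energy (t : I) (γ : C(I, X)) : ℝ≥0∞ :=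
  if IsAC2 γ then
    ENNReal.ofReal t * (⨍⁻ s in Icc 0 t, ENNReal.ofReal (metricSpeed γ s) ^ 2 ∂volume) ^ (1 / 2 : ℝ)
  else ∞

end Curves

section Plans

variable {X : Type*} [MetricSpace X] [MeasurableSpace X] [MeasurableSpace C(I, X)]

/-- `2`-test plans. -/
structure IsTestPlan (m : Measure X) (π : Measure C(I, X)) : Prop where
  isProbabilityMeasure : IsProbabilityMeasure π
  compression : ∃ C : ℝ≥0, ∀ t : I, π.map (fun γ => γ t) ≤ C • m
  kineticEnergy : ∫⁻ γ, energy 1 γ ^ 2 ∂π < ∞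

/-- The plan `π` `2`-represents the gradient of `f`. In the first condition `0 / 0 = 0`: if
`E_{2,t}(γ) = 0` then `γ` is constant on `[0, t]`. -/
structure RepresentsGradient (m : Measure X) (π : Measure C(I, X)) (f : X → ℝ) : Prop where
  quotient : Tendsto (fun t : I => eLpNorm (fun γ : C(I, X) =>
    (f (γ t) - f (γ 0)) / (energy t γ).toReal - relaxedSlope m f (γ 0)) 2 π) (𝓝[>] 0) (𝓝 0)
  speed : Tendsto (fun t : I => eLpNorm (fun γ : C(I, X) =>
    (energy t γ).toReal / (t : ℝ) - relaxedSlope m f (γ 0)) 2 π) (𝓝[>] 0) (𝓝 0)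

end Plans

/-- Weak convergence in `L¹(μ)` of the family `F` to `G` along the filter `l`. -/
def WeakTendstoL1 {Ω ι : Type*} [MeasurableSpace Ω] (μ : Measure Ω) (F : ι → Ω → ℝ) (l : Filter ι)
    (G : Ω → ℝ) : Prop :=
  (∀ i, Integrable (F i) μ) ∧ Integrable G μ ∧
    ∀ h : Ω → ℝ, MemLp h ∞ μ →
      Tendsto (fun i => ∫ ω, h ω * F i ω ∂μ) l (𝓝 (∫ ω, h ω * G ω ∂μ))

end MetricSobolev

end

set_option linter.unusedSectionVars false
set_option linter.unusedVariables false

/-! The theorem is a first-variation argument. For `v` in W^{1,2} and a bounded weight `h ≥ 0`, the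
chain rule along curves and Young's inequality give ∫ h (v(γ_t) - v(γ_0))/t dπ ≤ ½ t⁻¹ ∫∫_0^t h
|Dv|²(γ_s) ds dπ + ½ ∫ h (E_{2,t}/t)² dπ (`integral_mul_quotient_le`). It holds for Lipschitz `v`
with slopes in place of |Dv| (`abs_sub_le_of_isAC2`) and passes to the limit along a sequence
realising |Dv|, because `π` has bounded compression. As t ↓ 0 the right side tends to ½ ∫ h (|Dv|² +
|Df|²)(γ_0) dπ. For `v = f` the left side tends to ∫ h |Df|²(γ_0) dπ, so equality holds in the
limit: this is what representing the gradient means.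

Taking `v = f + c g` with `c > 0`, subtracting the limit for `f` and dividing by `c` bounds the
limsup of ∫ h (g(γ_t) - g(γ_0))/t dπ by ∫ h (|D(f + c g)|² - |Df|²)/(2c) (γ_0) dπ. If |D·|² is
pointwise quadratic, this integrand is ⟨∇g, ∇f⟩ + (c/2)|Dg|², and `c → 0` gives the upper bound.
Replacing `g` by `-g` gives the lower bound, and adding a constant to `h` removes the sign
condition.

The hypothesis gives the parallelogram rule only after integration, so the main analytic step is to
make it pointwise (`relaxedSlope_parallelogram`). Multiplying `f` and `g` by a Lipschitz cutoff `h`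
localises the rule, up to a Leibniz error controlled by the size of the functions. That size is made
arbitrarily small by composing with a triangular wave of slopes ±1: by locality the slopes of `f`
and `g` are unchanged and those of `f + g` and `f - g` are at most exchanged. As the amplitude tends
to 0 the error vanishes, leaving the identity integrated against `h²` for every `h`. -/

namespace MetricSobolev

/-! ### Calculus of the slope of Lipschitz functions. -/

section Slope

variable {X : Type*} [MetricSpace X]

/-- The real-valued slope. -/
noncomputable abbrev rlip (u : X → ℝ) (x : X) : ℝ := (lip u x).toReal

theorem rlip_nonneg (u : X → ℝ) (x : X) : 0 ≤ rlip u x := ENNReal.toReal_nonneg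

theorem lip_le_ofReal {u : X → ℝ} {x : X} {c : ℝ}
    (h : ∀ᶠ y in 𝓝[≠] x, |u y - u x| ≤ c * dist y x) : lip u x ≤ ENNReal.ofReal c := by
  refine limsup_le_of_le (by isBoundedDefault) ?_
  filter_upwards [h, self_mem_nhdsWithin] with y hy hne
  have hpos : 0 < dist y x := dist_pos.2 hne
  rw [edist_dist, edist_dist, Real.dist_eq, ← ENNReal.ofReal_div_of_pos hpos]
  exact ENNReal.ofReal_le_ofReal ((div_le_iff₀ hpos).2 hy)

theorem rlip_le_of_forall_eventually {u : X → ℝ} {x : X} {c : ℝ} (hc : 0 ≤ c)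
    (h : ∀ ε > 0, ∀ᶠ y in 𝓝[≠] x, |u y - u x| ≤ (c + ε) * dist y x) : rlip u x ≤ c := by
  refine le_of_forall_pos_le_add fun ε hε => ?_
  have := ENNReal.toReal_mono ENNReal.ofReal_ne_top (lip_le_ofReal (h ε hε))
  rwa [ENNReal.toReal_ofReal (by positivity)] at this

theorem lip_le_of_lipschitzWith {u : X → ℝ} {K : ℝ≥0} (hu : LipschitzWith K u) (x : X) :
    lip u x ≤ K := by
  have := lip_le_ofReal (u := u) (x := x) (c := K)
    (Eventually.of_forall fun y => by simpa [Real.dist_eq] using hu.dist_le_mul y x)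
  simpa using this

theorem lip_ne_top {u : X → ℝ} {K : ℝ≥0} (hu : LipschitzWith K u) (x : X) : lip u x ≠ ∞ :=
  ((lip_le_of_lipschitzWith hu x).trans_lt ENNReal.coe_lt_top).ne

theorem rlip_le_of_lipschitzWith {u : X → ℝ} {K : ℝ≥0} (hu : LipschitzWith K u) (x : X) :
    rlip u x ≤ K := by
  have := ENNReal.toReal_mono ENNReal.coe_ne_top (lip_le_of_lipschitzWith hu x)
  simpa using this

theorem eventually_abs_sub_le_rlip {u : X → ℝ} {K : ℝ≥0} (hu : LipschitzWith K u) (x : X)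
    {ε : ℝ} (hε : 0 < ε) : ∀ᶠ y in 𝓝 x, |u y - u x| ≤ (rlip u x + ε) * dist y x := by
  have h1 : lip u x < ENNReal.ofReal (rlip u x + ε) := by
    rw [ENNReal.lt_ofReal_iff_toReal_lt (lip_ne_top hu x)]
    linarith
  have h2 := eventually_lt_of_limsup_lt h1 (by isBoundedDefault)
  rw [eventually_nhdsWithin_iff] at h2
  filter_upwards [h2] with y hy
  rcases eq_or_ne y x with rfl | hne
  · simp
  have hpos : 0 < dist y x := dist_pos.2 hne
  have h3 := hy hne
  rw [edist_dist, edist_dist, Real.dist_eq, ← ENNReal.ofReal_div_of_pos hpos] at h3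
  have h4 := (ENNReal.ofReal_lt_ofReal_iff_of_nonneg (by positivity)).1 h3
  exact ((div_lt_iff₀ hpos).1 h4).le

/-- If the increments of `F` at `x` are controlled by weighted increments of `u`, `v`, `w`, then so
is its slope. -/
theorem rlip_le_of_abs_sub_le {F u v w : X → ℝ} {K₁ K₂ K₃ : ℝ≥0} (hu : LipschitzWith K₁ u)
    (hv : LipschitzWith K₂ v) (hw : LipschitzWith K₃ w) {x : X} {a b : X → ℝ} {c : ℝ}
    (ha : ContinuousAt a x) (hb : ContinuousAt b x) (ha0 : ∀ y, 0 ≤ a y) (hb0 : ∀ y, 0 ≤ b y)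
    (hc0 : 0 ≤ c)
    (h : ∀ y, |F y - F x| ≤ a y * |u y - u x| + b y * |v y - v x| + c * |w y - w x|) :
    rlip F x ≤ a x * rlip u x + b x * rlip v x + c * rlip w x := by
  have hu0 := rlip_nonneg u x
  have hv0 := rlip_nonneg v x
  have hw0 := rlip_nonneg w x
  have hax := ha0 x
  have hbx := hb0 x
  refine rlip_le_of_forall_eventually (by positivity) fun ε hε => ?_
  set δ : ℝ := ε / (2 * (a x + b x + c + 1)) with hδ
  have hδ0 : 0 < δ := by positivity
  have hδε : (a x + b x + c) * δ < ε := by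
    have : (a x + b x + c + 1) * δ = ε / 2 := by rw [hδ]; field_simp
    nlinarith
  have hcont : ContinuousAt (fun y => a y * (rlip u x + δ) + b y * (rlip v x + δ)
      + c * (rlip w x + δ)) x := by fun_prop
  have hlt : a x * (rlip u x + δ) + b x * (rlip v x + δ) + c * (rlip w x + δ)
      < a x * rlip u x + b x * rlip v x + c * rlip w x + ε := by nlinarith
  filter_upwards [mem_nhdsWithin_of_mem_nhds (hcont.eventually_lt continuousAt_const hlt),
    mem_nhdsWithin_of_mem_nhds (eventually_abs_sub_le_rlip hu x hδ0),
    mem_nhdsWithin_of_mem_nhds (eventually_abs_sub_le_rlip hv x hδ0),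
    mem_nhdsWithin_of_mem_nhds (eventually_abs_sub_le_rlip hw x hδ0)] with y h1 h2 h3 h4
  calc |F y - F x| ≤ a y * |u y - u x| + b y * |v y - v x| + c * |w y - w x| := h y
    _ ≤ a y * ((rlip u x + δ) * dist y x) + b y * ((rlip v x + δ) * dist y x)
        + c * ((rlip w x + δ) * dist y x) := by
      gcongr
      · exact ha0 y
      · exact hb0 y
    _ = (a y * (rlip u x + δ) + b y * (rlip v x + δ) + c * (rlip w x + δ)) * dist y x := by ring
    _ ≤ _ := by gcongr

theorem rlip_add_le {u v : X → ℝ} {K L : ℝ≥0} (hu : LipschitzWith K u) (hv : LipschitzWith L v)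
    (x : X) : rlip (u + v) x ≤ rlip u x + rlip v x := by
  have := rlip_le_of_abs_sub_le (F := u + v) hu hv hu (x := x) (a := fun _ => 1) (b := fun _ => 1)
    (c := 0) continuousAt_const continuousAt_const (by simp) (by simp) le_rfl (fun y => by
      have := abs_add_le (u y - u x) (v y - v x)
      simp only [Pi.add_apply]
      rw [show u y + v y - (u x + v x) = u y - u x + (v y - v x) by ring]
      linarith)
  simpa using this

theorem rlip_const_mul_le {u : X → ℝ} {K : ℝ≥0} (hu : LipschitzWith K u) (c : ℝ)
    (x : X) : rlip (fun y => c * u y) x ≤ |c| * rlip u x := by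
  have := rlip_le_of_abs_sub_le (F := fun y => c * u y) hu hu hu (x := x) (a := fun _ => |c|)
    (b := fun _ => 0) (c := 0) continuousAt_const continuousAt_const (by simp) (by simp) le_rfl
    (fun y => by simp [← mul_sub, abs_mul])
  simpa using this

/-- Slope of a convex combination with variable weight. -/
theorem rlip_glue_le {u v ψ : X → ℝ} {K L M : ℝ≥0} (hu : LipschitzWith K u)
    (hv : LipschitzWith L v) (hψ : LipschitzWith M ψ) (h0 : ∀ y, 0 ≤ ψ y) (h1 : ∀ y, ψ y ≤ 1)
    (x : X) : rlip (fun y => (1 - ψ y) * u y + ψ y * v y) x ≤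
      (1 - ψ x) * rlip u x + ψ x * rlip v x + |u x - v x| * M := by
  have hψc := hψ.continuous
  have := rlip_le_of_abs_sub_le (F := fun y => (1 - ψ y) * u y + ψ y * v y) hu hv hψ (x := x)
    (a := fun y => 1 - ψ y) (b := ψ) (c := |u x - v x|) (by fun_prop) hψc.continuousAt
    (fun y => by linarith [h1 y]) h0 (abs_nonneg _) (fun y => by
      -- The weights are taken at `y` and the gap `u - v` at `x`, so the coefficient of the
      -- increment of `ψ` is a constant.
      have e : (1 - ψ y) * u y + ψ y * v y - ((1 - ψ x) * u x + ψ x * v x)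
        = (1 - ψ y) * (u y - u x) + ψ y * (v y - v x) + -((u x - v x) * (ψ y - ψ x)) := by ring
      have ha := abs_add_three ((1 - ψ y) * (u y - u x)) (ψ y * (v y - v x))
        (-((u x - v x) * (ψ y - ψ x)))
      rw [abs_neg, abs_mul, abs_mul, abs_mul, abs_of_nonneg (h0 y),
        abs_of_nonneg (sub_nonneg.2 (h1 y))] at ha
      rw [e]
      exact ha)
  refine this.trans ?_
  gcongr
  exact rlip_le_of_lipschitzWith hψ x

theorem rlip_comp_le {u : X → ℝ} {K : ℝ≥0} (hu : LipschitzWith K u) {φ φ' : ℝ → ℝ}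
    (hφ : ∀ z, HasDerivAt φ (φ' z) z) (x : X) :
    rlip (fun y => φ (u y)) x ≤ |φ' (u x)| * rlip u x := by
  have hr := rlip_nonneg u x
  refine rlip_le_of_forall_eventually (by positivity) fun ε hε => ?_
  set δ : ℝ := ε / (2 * (rlip u x + 1)) with hδ
  have hδ0 : 0 < δ := by positivity
  have h1 : δ * (rlip u x + 1) = ε / 2 := by rw [hδ]; field_simp
  -- With `η ≤ 1`, the excess |φ'| η + δ (rlip u x + η) is at most ε/2 + ε/2.
  set η : ℝ := min 1 (ε / (2 * (|φ' (u x)| + 1))) with hη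
  have hη0 : 0 < η := by positivity
  have h2 : (|φ' (u x)|) * η ≤ ε / 2 := by
    have : (|φ' (u x)| + 1) * (ε / (2 * (|φ' (u x)| + 1))) = ε / 2 := by field_simp
    have := min_le_right 1 (ε / (2 * (|φ' (u x)| + 1)))
    have := abs_nonneg (φ' (u x))
    calc (|φ' (u x)|) * η ≤ (|φ' (u x)| + 1) * (ε / (2 * (|φ' (u x)| + 1))) := by gcongr; linarith
      _ = _ := by assumption
  have hd := (hasDerivAt_iff_isLittleO.1 (hφ (u x))).def hδ0
  have hd' := hu.continuous.continuousAt.eventually hd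
  filter_upwards [mem_nhdsWithin_of_mem_nhds hd',
    mem_nhdsWithin_of_mem_nhds (eventually_abs_sub_le_rlip hu x hη0)] with y h3 h4
  simp only [Real.norm_eq_abs, smul_eq_mul] at h3
  have h5 : |φ (u y) - φ (u x)| ≤ (|φ' (u x)| + δ) * |u y - u x| := by
    have := abs_add_le (φ (u y) - φ (u x) - (u y - u x) * φ' (u x)) ((u y - u x) * φ' (u x))
    rw [sub_add_cancel, abs_mul] at this
    linarith
  have hη1 : η ≤ 1 := min_le_left _ _
  calc _ ≤ (|φ' (u x)| + δ) * |u y - u x| := h5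
    _ ≤ (|φ' (u x)| + δ) * ((rlip u x + η) * dist y x) := by gcongr
    _ = ((|φ' (u x)| + δ) * (rlip u x + η)) * dist y x := by ring
    _ ≤ _ := by
      gcongr
      nlinarith

theorem rlip_comp_lipschitz_le {u : X → ℝ} {K : ℝ≥0} (hu : LipschitzWith K u) {φ : ℝ → ℝ}
    (hφ : LipschitzWith 1 φ) (x : X) : rlip (fun y => φ (u y)) x ≤ rlip u x := by
  have := rlip_le_of_abs_sub_le (F := fun y => φ (u y)) hu hu hu (x := x) (a := fun _ => 1)
    (b := fun _ => 0) (c := 0) continuousAt_const continuousAt_const (by simp) (by simp) le_rfl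
    (fun y => by simpa [Real.dist_eq] using hφ.dist_le_mul (u y) (u x))
  simpa using this

/-- The limsup is a countable infimum, over radii 1/(n+1), of suprema over punctured balls. Each
supremum is lower semicontinuous in `p`, since a fixed `y` stays in the punctured ball when `p`
moves slightly. This serves both the slope of functions and the speed of curves, the latter jointly
in curve and time. -/
theorem measurable_limsup_nhdsNE {P Y : Type*} [TopologicalSpace P] [MeasurableSpace P]
    [OpensMeasurableSpace P] [MetricSpace Y] {a : P → Y} (ha : Continuous a)
    {k : P → Y → ℝ≥0∞} (hk : ∀ p y, y ≠ a p → ContinuousAt (fun p => k p y) p) :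
    Measurable fun p => limsup (k p) (𝓝[≠] (a p)) := by
  have hbasis : ∀ p, limsup (k p) (𝓝[≠] (a p)) =
      ⨅ n : ℕ, ⨆ y ∈ Metric.ball (a p) (1 / ((n : ℝ) + 1)) ∩ {a p}ᶜ, k p y := by
    intro p
    rw [(nhdsWithin_hasBasis Metric.nhds_basis_ball_inv_nat_succ {a p}ᶜ).limsup_eq_iInf_iSup]
    simp
  simp_rw [hbasis]
  refine Measurable.iInf fun n => LowerSemicontinuous.measurable fun p c hc => ?_
  simp only [lt_iSup_iff] at hc
  obtain ⟨y, hy, hcy⟩ := hc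
  have h1 : ∀ᶠ q in 𝓝 p, y ∈ Metric.ball (a q) (1 / ((n : ℝ) + 1)) := by
    have : ContinuousAt (fun q => dist y (a q)) p := by fun_prop
    exact this.eventually_lt continuousAt_const hy.1
  have h2 : ∀ᶠ q in 𝓝 p, a q ≠ y := ha.continuousAt.eventually_ne (fun h => hy.2 h.symm)
  filter_upwards [h1, h2, (hk p y hy.2).eventually_const_lt hcy] with q hq1 hq2 hq3
  simp only [lt_iSup_iff]
  exact ⟨y, ⟨hq1, fun h => hq2 h.symm⟩, hq3⟩

theorem measurable_lip [MeasurableSpace X] [OpensMeasurableSpace X] {u : X → ℝ}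
    (hu : Continuous u) : Measurable (lip u) := by
  refine measurable_limsup_nhdsNE (a := id) continuous_id fun p y hne => ?_
  have h1 : ContinuousAt (fun p => edist (u y) (u p)) p := by fun_prop
  have h2 : ContinuousAt (fun p => edist y p) p := by fun_prop
  exact ENNReal.Tendsto.div h1 (Or.inr (by simpa using hne)) h2 (Or.inr (edist_ne_top _ _))

theorem measurable_rlip [MeasurableSpace X] [OpensMeasurableSpace X] {u : X → ℝ}
    (hu : Continuous u) : Measurable (rlip u) := (measurable_lip hu).ennreal_toReal

end Slope

end MetricSobolev

namespace MetricSobolev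

/-! ### Strong convergence in L². -/

section L2

variable {α ι : Type*} [MeasurableSpace α] {μ : Measure α}

/-- Strong convergence in `L²(μ)` along a filter. -/
def TendstoL2 (μ : Measure α) (u : ι → α → ℝ) (l : Filter ι) (f : α → ℝ) : Prop :=
  Tendsto (fun i => eLpNorm (fun x => u i x - f x) 2 μ) l (𝓝 0)

theorem lintegral_enorm_sq_eq {f : α → ℝ} (hf : MemLp f 2 μ) :
    ∫⁻ x, ‖f x‖ₑ ^ 2 ∂μ = ENNReal.ofReal (∫ x, f x ^ 2 ∂μ) := by
  rw [ofReal_integral_eq_lintegral_ofReal hf.integrable_sq (ae_of_all _ fun x => sq_nonneg _)]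
  refine lintegral_congr fun x => ?_
  rw [← sq_abs, ENNReal.ofReal_pow (abs_nonneg _), Real.enorm_eq_ofReal_abs]

theorem eLpNorm_two_sq (f : α → ℝ) : eLpNorm f 2 μ ^ 2 = ∫⁻ x, ‖f x‖ₑ ^ 2 ∂μ := by
  have := eLpNorm_nnreal_pow_eq_lintegral (μ := μ) (f := f) (p := 2) (by norm_num)
  simpa using this

theorem eLpNorm_two_toReal_sq {f : α → ℝ} (hf : MemLp f 2 μ) :
    (eLpNorm f 2 μ).toReal ^ 2 = ∫ x, f x ^ 2 ∂μ := by
  rw [← ENNReal.toReal_pow, eLpNorm_two_sq, lintegral_enorm_sq_eq hf,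
    ENNReal.toReal_ofReal (integral_nonneg fun x => sq_nonneg _)]

theorem tendstoL2_iff_lintegral {u : ι → α → ℝ} {l : Filter ι} {f : α → ℝ} :
    TendstoL2 μ u l f ↔ Tendsto (fun i => ∫⁻ x, ‖u i x - f x‖ₑ ^ 2 ∂μ) l (𝓝 0) := by
  simp_rw [← eLpNorm_two_sq]
  constructor
  · intro h
    simpa using ENNReal.Tendsto.pow (n := 2) h
  · intro h
    have h2 := (ENNReal.continuous_rpow_const (y := (1 / 2 : ℝ))).tendsto 0 |>.comp h
    refine (h2.congr fun i => ?_).trans (by simp)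
    simp only [Function.comp]
    rw [← ENNReal.rpow_natCast, ← ENNReal.rpow_mul]
    norm_num

theorem tendstoL2_iff_integral {u : ι → α → ℝ} {l : Filter ι} {f : α → ℝ}
    (hu : ∀ i, MemLp (u i) 2 μ) (hf : MemLp f 2 μ) :
    TendstoL2 μ u l f ↔ Tendsto (fun i => ∫ x, (u i x - f x) ^ 2 ∂μ) l (𝓝 0) := by
  rw [tendstoL2_iff_lintegral]
  have : ∀ i, ∫⁻ x, ‖u i x - f x‖ₑ ^ 2 ∂μ = ENNReal.ofReal (∫ x, (u i x - f x) ^ 2 ∂μ) :=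
    fun i => lintegral_enorm_sq_eq ((hu i).sub hf)
  simp_rw [this]
  constructor
  · intro h
    have := (ENNReal.tendsto_toReal ENNReal.zero_ne_top).comp h
    refine (this.congr fun i => ?_)
    simp [ENNReal.toReal_ofReal (integral_nonneg fun x => sq_nonneg (u i x - f x))]
  · intro h
    simpa using ENNReal.tendsto_ofReal h

theorem TendstoL2.add {u v : ι → α → ℝ} {l : Filter ι} {f g : α → ℝ}
    (h1 : TendstoL2 μ u l f) (h2 : TendstoL2 μ v l g)
    (hu : ∀ i, MemLp (u i) 2 μ) (hf : MemLp f 2 μ) (hv : ∀ i, MemLp (v i) 2 μ)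
    (hg : MemLp g 2 μ) : TendstoL2 μ (fun i x => u i x + v i x) l (fun x => f x + g x) := by
  refine tendsto_of_tendsto_of_tendsto_of_le_of_le tendsto_const_nhds
    (by simpa using Tendsto.add h1 h2) (fun i => zero_le) fun i => ?_
  have := eLpNorm_add_le (μ := μ) ((hu i).sub hf).1 ((hv i).sub hg).1
    (p := 2) (by norm_num)
  refine le_trans (le_of_eq ?_) this
  congr 1
  ext x
  simp only [Pi.add_apply, Pi.sub_apply]
  ring

theorem TendstoL2.mono {u v : ι → α → ℝ} {l : Filter ι} {f g : α → ℝ}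
    (h1 : TendstoL2 μ u l f) (h : ∀ i, ∀ᵐ x ∂μ, |v i x - g x| ≤ |u i x - f x|) :
    TendstoL2 μ v l g :=
  tendsto_of_tendsto_of_tendsto_of_le_of_le tendsto_const_nhds h1 (fun i => zero_le) fun i =>
    eLpNorm_mono_ae (by simpa using h i)

theorem TendstoL2.const_mul {u : ι → α → ℝ} {l : Filter ι} {f : α → ℝ}
    (h1 : TendstoL2 μ u l f) (c : ℝ) :
    TendstoL2 μ (fun i x => c * u i x) l (fun x => c * f x) := by
  have h2 := ENNReal.Tendsto.const_mul (a := ‖c‖ₑ) h1 (Or.inr enorm_ne_top)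
  rw [mul_zero] at h2
  refine h2.congr fun i => ?_
  rw [← eLpNorm_const_smul]
  congr 1
  ext x
  simp [mul_sub]

theorem TendstoL2.sub {u v : ι → α → ℝ} {l : Filter ι} {f g : α → ℝ}
    (h1 : TendstoL2 μ u l f) (h2 : TendstoL2 μ v l g)
    (hu : ∀ i, MemLp (u i) 2 μ) (hf : MemLp f 2 μ) (hv : ∀ i, MemLp (v i) 2 μ)
    (hg : MemLp g 2 μ) : TendstoL2 μ (fun i x => u i x - v i x) l (fun x => f x - g x) := by
  have := h1.add (h2.const_mul (-1)) hu hf (fun i => (hv i).const_mul (-1)) (hg.const_mul (-1))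
  simpa [← sub_eq_add_neg] using this

theorem TendstoL2.comp {κ : Type*} {u : ι → α → ℝ} {l : Filter ι} {f : α → ℝ}
    (h : TendstoL2 μ u l f) {k : Filter κ} {s : κ → ι} (hs : Tendsto s k l) :
    TendstoL2 μ (fun i => u (s i)) k f :=
  Filter.Tendsto.comp (g := fun i => eLpNorm (fun x => u i x - f x) 2 μ) h hs

theorem tendstoL2_const (f : α → ℝ) (l : Filter ι) : TendstoL2 μ (fun _ => f) l f := by
  simpa [TendstoL2] using tendsto_const_nhds

theorem tendstoL2_of_dominated {u : ℕ → α → ℝ} {f b : α → ℝ}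
    (hu : ∀ i, MemLp (u i) 2 μ) (hf : MemLp f 2 μ) (hb : MemLp b 2 μ)
    (hub : ∀ i, ∀ᵐ x ∂μ, |u i x| ≤ b x) (hlim : ∀ᵐ x ∂μ, Tendsto (fun i => u i x) atTop (𝓝 (f x))) :
    TendstoL2 μ u atTop f := by
  rw [tendstoL2_iff_integral hu hf]
  have hi : Integrable (fun x => 2 * b x ^ 2 + 2 * f x ^ 2) μ :=
    (hb.integrable_sq.const_mul 2).add (hf.integrable_sq.const_mul 2)
  have := tendsto_integral_of_dominated_convergence (μ := μ)
    (F := fun i x => (u i x - f x) ^ 2) (f := fun _ => 0) (fun x => 2 * b x ^ 2 + 2 * f x ^ 2)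
    (fun i => (((hu i).1.sub hf.1).pow 2)) hi
    (fun i => by
      filter_upwards [hub i] with x hx
      rw [Real.norm_of_nonneg (sq_nonneg _)]
      have : u i x ^ 2 ≤ b x ^ 2 := sq_le_sq' (by linarith [abs_le.1 hx]) (abs_le.1 hx).2
      nlinarith [sq_nonneg (u i x + f x)])
    (by
      filter_upwards [hlim] with x hx
      simpa using (hx.sub_const (f x)).pow 2)
  simpa using this

theorem TendstoL2.exists_subseq_ae {u : ℕ → α → ℝ} {f : α → ℝ}
    (h : TendstoL2 μ u atTop f) (hu : ∀ i, MemLp (u i) 2 μ) (hf : MemLp f 2 μ) :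
    ∃ s : ℕ → ℕ, StrictMono s ∧ ∀ᵐ x ∂μ, Tendsto (fun i => u (s i) x) atTop (𝓝 (f x)) :=
  (tendstoInMeasure_of_tendsto_eLpNorm (p := 2) (by norm_num) (fun i => (hu i).1) hf.1
    h).exists_seq_tendsto_ae

theorem TendstoL2.ae_le {u v : ℕ → α → ℝ} {f g : α → ℝ}
    (h1 : TendstoL2 μ u atTop f) (h2 : TendstoL2 μ v atTop g)
    (hu : ∀ i, MemLp (u i) 2 μ) (hf : MemLp f 2 μ) (hv : ∀ i, MemLp (v i) 2 μ)
    (hg : MemLp g 2 μ) (hle : ∀ i, ∀ᵐ x ∂μ, u i x ≤ v i x) : ∀ᵐ x ∂μ, f x ≤ g x := by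
  obtain ⟨s, hs, hsx⟩ := h1.exists_subseq_ae hu hf
  obtain ⟨r, hr, hrx⟩ := (h2.comp hs.tendsto_atTop).exists_subseq_ae (fun i => hv _) hg
  filter_upwards [hsx, hrx, ae_all_iff.2 hle] with x h3 h4 h5
  exact le_of_tendsto_of_tendsto' (h3.comp hr.tendsto_atTop) h4 fun i => h5 _

theorem TendstoL2.integral_sq {u : ι → α → ℝ} {l : Filter ι} {f : α → ℝ}
    (h : TendstoL2 μ u l f) (hu : ∀ i, MemLp (u i) 2 μ) (hf : MemLp f 2 μ) :
    Tendsto (fun i => ∫ x, u i x ^ 2 ∂μ) l (𝓝 (∫ x, f x ^ 2 ∂μ)) := by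
  have h1 := (Lp.tendsto_Lp_iff_tendsto_eLpNorm'' u hu f hf).2 h
  have h2 := h1.norm.pow 2
  simp only [Lp.norm_toLp, eLpNorm_two_toReal_sq hf, eLpNorm_two_toReal_sq (hu _)] at h2
  exact h2

theorem integral_mul_le_sqrt {f g : α → ℝ} (hf : MemLp f 2 μ) (hg : MemLp g 2 μ) :
    ∫ x, |f x * g x| ∂μ ≤ √(∫ x, f x ^ 2 ∂μ) * √(∫ x, g x ^ 2 ∂μ) := by
  have := integral_mul_le_Lp_mul_Lq_of_nonneg (μ := μ) (p := 2) (q := 2)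
    (by constructor <;> norm_num) (f := fun x => |f x|) (g := fun x => |g x|)
    (ae_of_all _ fun x => abs_nonneg _) (ae_of_all _ fun x => abs_nonneg _)
    (by simpa using! hf.abs) (by simpa using! hg.abs)
  simpa [abs_mul, Real.sqrt_eq_rpow] using this

/-- Convergence in measure of bounded factors preserves strong `L²`-convergence. -/
theorem TendstoL2.bdd_mul {u : ℕ → α → ℝ} {f : α → ℝ} {a : ℕ → α → ℝ} {b : α → ℝ}
    (h : TendstoL2 μ u atTop f) (hu : ∀ i, MemLp (u i) 2 μ) (hf : MemLp f 2 μ)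
    (ha : ∀ i, AEStronglyMeasurable (a i) μ) (hb : AEStronglyMeasurable b μ)
    (ha1 : ∀ i x, |a i x| ≤ 1) (hb1 : ∀ x, |b x| ≤ 1)
    (hab : ∀ᵐ x ∂μ, Tendsto (fun i => a i x) atTop (𝓝 (b x))) :
    TendstoL2 μ (fun i x => a i x * u i x) atTop (fun x => b x * f x) := by
  have hmem : ∀ (c : α → ℝ) (v : α → ℝ), AEStronglyMeasurable c μ → (∀ x, |c x| ≤ 1) →
      MemLp v 2 μ → MemLp (fun x => c x * v x) 2 μ := fun c v hc hc1 hv =>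
    hv.of_le (hc.mul hv.1) (ae_of_all _ fun x => by
      rw [norm_mul]
      exact mul_le_of_le_one_left (norm_nonneg _) (hc1 x))
  -- Split a_i u_i = a_i (u_i - f) + a_i f: the first term uses |a_i| ≤ 1, the second dominated
  -- convergence.
  have h1 : TendstoL2 μ (fun i x => a i x * (u i x - f x)) atTop (fun _ => 0) := by
    refine TendstoL2.mono h fun i => ae_of_all _ fun x => ?_
    rw [sub_zero, abs_mul]
    exact mul_le_of_le_one_left (abs_nonneg _) (ha1 i x)
  have h2 : TendstoL2 μ (fun i x => a i x * f x) atTop (fun x => b x * f x) := by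
    refine tendstoL2_of_dominated (b := fun x => |f x|) (fun i => hmem _ _ (ha i) (ha1 i) hf)
      (hmem _ _ hb hb1 hf) hf.abs (fun i => ae_of_all _ fun x => ?_) ?_
    · rw [abs_mul]
      exact mul_le_of_le_one_left (abs_nonneg _) (ha1 i x)
    · filter_upwards [hab] with x hx using hx.mul_const _
  have h3 := h1.add h2 (fun i => hmem _ _ (ha i) (ha1 i) ((hu i).sub hf)) (by simp)
    (fun i => hmem _ _ (ha i) (ha1 i) hf) (hmem _ _ hb hb1 hf)
  refine h3.mono fun i => ae_of_all _ fun x => le_of_eq ?_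
  congr 1
  ring

end L2

/-! ### Testing the sign of an integrable function with Lipschitz functions. -/

section Positivity

variable {X : Type*} [MetricSpace X] [MeasurableSpace X] [BorelSpace X] {m : Measure X}

/-- An integrable function which is nonnegative against powers of Lipschitz functions with values in
`[0, 1]` is nonnegative almost everywhere. -/
theorem ae_nonneg_of_forall_lipschitz {w : X → ℝ} (hw : Integrable w m) {k : ℕ} (hk : k ≠ 0)
    (h : ∀ (h : X → ℝ) (K : ℝ≥0), LipschitzWith K h → (∀ x, 0 ≤ h x) → (∀ x, h x ≤ 1) →
      0 ≤ ∫ x, h x ^ k * w x ∂m) : 0 ≤ᵐ[m] w := by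
  -- Thickened indicators of `F` are Lipschitz and converge to the indicator of `F`, which a nonzero
  -- power leaves unchanged.
  have hclosed : ∀ F : Set X, IsClosed F → 0 ≤ ∫ x in F, w x ∂m := by
    intro F hF
    have hpos : ∀ n : ℕ, (0 : ℝ) < 1 / ((n : ℝ) + 1) := fun n => by positivity
    have hlim := thickenedIndicator_tendsto_indicator_closure hpos
      tendsto_one_div_add_atTop_nhds_zero_nat F
    rw [tendsto_pi_nhds] at hlim
    have hconv : Tendsto (fun n : ℕ => ∫ x, ((thickenedIndicator (hpos n) F x : ℝ≥0) : ℝ) ^ k * w x ∂m)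
        atTop (𝓝 (∫ x, F.indicator w x ∂m)) := by
      refine tendsto_integral_of_dominated_convergence (fun x => |w x|) (fun n => ?_) hw.abs
        (fun n => ae_of_all _ fun x => ?_) (ae_of_all _ fun x => ?_)
      · refine AEStronglyMeasurable.mul ?_ hw.1
        have : Continuous fun x => ((thickenedIndicator (hpos n) F x : ℝ≥0) : ℝ) ^ k := by
          fun_prop
        exact this.measurable.aestronglyMeasurable
      · rw [norm_mul, Real.norm_eq_abs, Real.norm_eq_abs]
        refine mul_le_of_le_one_left (abs_nonneg _) ?_
        rw [abs_of_nonneg (by positivity)]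
        exact pow_le_one₀ (by positivity) (by exact_mod_cast thickenedIndicator_le_one _ _ _)
      · have h1 := ((NNReal.continuous_coe.tendsto _).comp (hlim x)).pow k |>.mul_const (w x)
        convert! h1 using 2
        rw [hF.closure_eq]
        by_cases hx : x ∈ F <;> simp [hx, hk]
    rw [integral_indicator hF.measurableSet] at hconv
    refine ge_of_tendsto' hconv fun n => ?_
    refine h _ _ (NNReal.isometry_coe.lipschitz.comp (lipschitzWith_thickenedIndicator (hpos n) F)) (fun x => by positivity)
      (fun x => by exact_mod_cast thickenedIndicator_le_one _ _ _)
  refine ae_nonneg_of_forall_setIntegral_nonneg hw fun s hs _ => ?_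
  -- Approximation of measurable sets by closed sets is made for the finite measure |w| m, since `m`
  -- itself may be infinite.
  set ν := m.withDensity fun x => ‖w x‖ₑ with hν
  have : IsFiniteMeasure ν := isFiniteMeasure_withDensity (hasFiniteIntegral_iff_enorm.1 hw.2).ne
  refine le_of_forall_pos_lt_add fun ε hε => ?_
  obtain ⟨F, hFs, hF, hFε⟩ := hs.exists_isClosed_sdiff_lt (μ := ν) (measure_ne_top _ _)
    (ENNReal.ofReal_pos.2 hε).ne'
  have h1 : ∫ x in s, w x ∂m = ∫ x in F, w x ∂m + ∫ x in s \ F, w x ∂m := by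
    rw [← setIntegral_union disjoint_sdiff_self_right (hs.diff hF.measurableSet)
      hw.integrableOn hw.integrableOn, union_sdiff_cancel hFs]
  have h2 : |∫ x in s \ F, w x ∂m| < ε := by
    have h3 : ‖∫ x in s \ F, w x ∂m‖ₑ ≤ ν (s \ F) := by
      rw [hν, withDensity_apply _ (hs.diff hF.measurableSet)]
      exact enorm_integral_le_lintegral_enorm _
    have h4 := h3.trans_lt hFε
    rwa [Real.enorm_eq_ofReal_abs, ENNReal.ofReal_lt_ofReal_iff hε] at h4
  have := hclosed F hF
  have := (abs_lt.1 h2).1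
  linarith

end Positivity

end MetricSobolev

namespace MetricSobolev

/-! ### Lipschitz functions with bounded support. -/

section LipBs

variable {X : Type*} [MetricSpace X]

theorem IsLipBs.exists_bound {u : X → ℝ} (hu : IsLipBs u) : ∃ C, 0 ≤ C ∧ ∀ x, |u x| ≤ C := by
  obtain ⟨⟨K, hK⟩, hb⟩ := hu
  rcases isEmpty_or_nonempty X with hX | ⟨⟨z⟩⟩
  · exact ⟨0, le_rfl, fun x => hX.elim x⟩
  obtain ⟨R, hR⟩ := hb.subset_closedBall z
  refine ⟨|u z| + K * |R|, by positivity, fun x => ?_⟩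
  by_cases hx : u x = 0
  · rw [hx, abs_zero]; positivity
  have h1 : dist x z ≤ R := hR hx
  have h2 := hK.dist_le_mul x z
  rw [Real.dist_eq] at h2
  have h3 : |u x| ≤ |u z| + |u x - u z| := by
    have := abs_add_le (u z) (u x - u z)
    rwa [add_sub_cancel] at this
  have h4 : (K : ℝ) * dist x z ≤ K * |R| := by gcongr; exact h1.trans (le_abs_self _)
  linarith

theorem IsLipBs.zero : IsLipBs (fun _ : X => (0 : ℝ)) :=
  ⟨⟨0, LipschitzWith.const 0⟩, by simp⟩

theorem IsLipBs.add {u v : X → ℝ} (hu : IsLipBs u) (hv : IsLipBs v) :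
    IsLipBs (u + v) := by
  obtain ⟨⟨K, hK⟩, hb⟩ := hu
  obtain ⟨⟨L, hL⟩, hb'⟩ := hv
  exact ⟨⟨K + L, hK.add hL⟩, (hb.union hb').subset (Function.support_add u v)⟩

theorem IsLipBs.comp {u : X → ℝ} (hu : IsLipBs u) {φ : ℝ → ℝ} {M : ℝ≥0}
    (hφ : LipschitzWith M φ) (h0 : φ 0 = 0) : IsLipBs (fun x => φ (u x)) := by
  obtain ⟨⟨K, hK⟩, hb⟩ := hu
  exact ⟨⟨M * K, hφ.comp hK⟩, hb.subset (Function.support_comp_subset h0 u)⟩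

theorem IsLipBs.const_mul {u : X → ℝ} (hu : IsLipBs u) (c : ℝ) :
    IsLipBs (fun x => c * u x) :=
  hu.comp (φ := fun z => c * z) (LipschitzWith.of_dist_le' (K := |c|) fun x y => by
    simp [Real.dist_eq, ← mul_sub, abs_mul]) (mul_zero c)

/-- The increment of `ψ` is multiplied by `u - v`, so the Lipschitz constant uses that `u` and `v`
are bounded. The weight `ψ` need not have bounded support. -/
theorem IsLipBs.glue {u v ψ : X → ℝ} {M : ℝ≥0} (hu : IsLipBs u) (hv : IsLipBs v)
    (hψ : LipschitzWith M ψ) (h0 : ∀ y, 0 ≤ ψ y) (h1 : ∀ y, ψ y ≤ 1) :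
    IsLipBs (fun y => (1 - ψ y) * u y + ψ y * v y) := by
  obtain ⟨A, hA0, hA⟩ := hu.exists_bound
  obtain ⟨B, hB0, hB⟩ := hv.exists_bound
  obtain ⟨⟨K, hK⟩, hb⟩ := hu
  obtain ⟨⟨L, hL⟩, hb'⟩ := hv
  refine ⟨⟨_, LipschitzWith.of_dist_le' (K := K + L + (A + B) * M) fun y x => ?_⟩,
    (hb.union hb').subset fun x hx => ?_⟩
  · have hy0 := h0 y
    have hy1 := h1 y
    have e : (1 - ψ y) * u y + ψ y * v y - ((1 - ψ x) * u x + ψ x * v x)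
      = (1 - ψ y) * (u y - u x) + ψ y * (v y - v x) + -((u x - v x) * (ψ y - ψ x)) := by ring
    have ha := abs_add_three ((1 - ψ y) * (u y - u x)) (ψ y * (v y - v x))
      (-((u x - v x) * (ψ y - ψ x)))
    rw [abs_neg, abs_mul, abs_mul, abs_mul, abs_of_nonneg hy0,
      abs_of_nonneg (sub_nonneg.2 hy1)] at ha
    have d1 := hK.dist_le_mul y x
    have d2 := hL.dist_le_mul y x
    have d3 := hψ.dist_le_mul y x
    rw [Real.dist_eq] at d1 d2 d3 ⊢
    rw [e]
    have huv : |u x - v x| ≤ A + B := (abs_sub _ _).trans (add_le_add (hA x) (hB x))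
    calc _ ≤ _ := ha
      _ ≤ 1 * (K * dist y x) + 1 * (L * dist y x) + (A + B) * (M * dist y x) := by
        gcongr
        linarith
      _ = _ := by ring
  · simp only [mem_union, Function.mem_support] at hx ⊢
    by_contra hc
    push Not at hc
    simp [hc.1, hc.2] at hx

variable [MeasurableSpace X] [BorelSpace X] {m : Measure X}

theorem IsLipBs.memLp {u : X → ℝ} (hm : BoundedlyFinite m) (hu : IsLipBs u) : MemLp u 2 m := by
  obtain ⟨A, hA0, hA⟩ := hu.exists_bound
  obtain ⟨⟨K, hK⟩, hb⟩ := hu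
  have hfin : m (tsupport u) ≠ ∞ := (hm _ hb.closure).ne
  have h1 : MemLp ((tsupport u).indicator fun _ => A) 2 m :=
    memLp_indicator_const 2 (isClosed_tsupport u).measurableSet A (Or.inr hfin)
  refine h1.mono' hK.continuous.measurable.aestronglyMeasurable (ae_of_all _ fun x => ?_)
  by_cases hx : x ∈ tsupport u
  · simpa [hx] using hA x
  · simp [hx, image_eq_zero_of_notMem_tsupport hx]

/-- The slope is at most the Lipschitz constant on the closed support, which has finite measure, and
vanishes on the open complement. -/
theorem IsLipBs.memLp_rlip {u : X → ℝ} (hm : BoundedlyFinite m) (hu : IsLipBs u) :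
    MemLp (rlip u) 2 m := by
  obtain ⟨⟨K, hK⟩, hb⟩ := hu
  have hfin : m (tsupport u) ≠ ∞ := (hm _ hb.closure).ne
  have h1 : MemLp ((tsupport u).indicator fun _ => (K : ℝ)) 2 m :=
    memLp_indicator_const 2 (isClosed_tsupport u).measurableSet _ (Or.inr hfin)
  refine h1.mono' (measurable_rlip hK.continuous).aestronglyMeasurable (ae_of_all _ fun x => ?_)
  rw [Real.norm_of_nonneg (rlip_nonneg u x)]
  by_cases hx : x ∈ tsupport u
  · simpa [hx] using rlip_le_of_lipschitzWith hK x
  · simp only [hx, not_false_eq_true, indicator_of_notMem]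
    refine rlip_le_of_forall_eventually le_rfl fun ε hε => ?_
    have : ∀ᶠ y in 𝓝 x, y ∉ tsupport u := (isClosed_tsupport u).isOpen_compl.mem_nhds hx
    filter_upwards [mem_nhdsWithin_of_mem_nhds this] with y hy
    rw [image_eq_zero_of_notMem_tsupport hx, image_eq_zero_of_notMem_tsupport hy]
    simp only [sub_self, abs_zero]
    positivity

theorem lintegral_lip_sq_eq {u : X → ℝ} (hm : BoundedlyFinite m) (hu : IsLipBs u) :
    ∫⁻ x, lip u x ^ 2 ∂m = ENNReal.ofReal (∫ x, rlip u x ^ 2 ∂m) := by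
  rw [← lintegral_enorm_sq_eq (hu.memLp_rlip hm)]
  obtain ⟨⟨K, hK⟩, hb⟩ := hu
  refine lintegral_congr fun x => ?_
  rw [Real.enorm_eq_ofReal (rlip_nonneg u x), ENNReal.ofReal_toReal (lip_ne_top hK x)]

end LipBs

/-! ### Relaxation of the slope: existence and minimality of the minimal relaxed slope. -/

section Relaxation

variable {X : Type*} [MetricSpace X] [MeasurableSpace X] [BorelSpace X] {m : Measure X}

/-- The Dirichlet energy `∫ |Df|²`, as a real number. -/
noncomputable def dirichlet (m : Measure X) (f : X → ℝ) : ℝ := 2 * (cheegerEnergy m f).toReal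

theorem cheegerEnergy_ne_top {f : X → ℝ} (hf : MemW12 m f) : cheegerEnergy m f ≠ ∞ := by
  obtain ⟨-, u, hu, hlim⟩ := hf
  refine (lt_of_le_of_lt (iInf₂_le u hu) (lt_of_le_of_lt ?_ hlim)).ne
  refine liminf_le_liminf (Eventually.of_forall fun n => ?_)
  exact mul_le_of_le_one_left' (by simp)

theorem dirichlet_le_of_tendsto (hm : BoundedlyFinite m) {f : X → ℝ} {u : ℕ → X → ℝ}
    (hu : ApproximatesL2 m f u) {b : ℕ → ℝ} {B : ℝ} (hb : Tendsto b atTop (𝓝 B))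
    (hub : ∀ n, ∫ x, rlip (u n) x ^ 2 ∂m ≤ b n) :
    cheegerEnergy m f ≤ ENNReal.ofReal (B / 2) ∧ dirichlet m f ≤ B := by
  have hB : 0 ≤ B := ge_of_tendsto' hb fun n =>
    (integral_nonneg fun x => sq_nonneg (rlip (u n) x)).trans (hub n)
  have h1 : cheegerEnergy m f ≤ ENNReal.ofReal (B / 2) := by
    refine (iInf₂_le u hu).trans ?_
    have h2 : Tendsto (fun n => ENNReal.ofReal (b n / 2)) atTop (𝓝 (ENNReal.ofReal (B / 2))) :=
      ENNReal.tendsto_ofReal (hb.div_const 2)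
    rw [← h2.liminf_eq]
    refine liminf_le_liminf (Eventually.of_forall fun n => ?_)
    rw [lintegral_lip_sq_eq hm (hu.1 n), div_eq_inv_mul, ENNReal.ofReal_mul (by norm_num),
      ENNReal.ofReal_inv_of_pos (by norm_num)]
    gcongr
    · simp
    · exact hub n
  refine ⟨h1, ?_⟩
  have h3 := ENNReal.toReal_mono ENNReal.ofReal_ne_top h1
  rw [ENNReal.toReal_ofReal (by positivity)] at h3
  unfold dirichlet
  linarith

/-- Diagonal choice: a competitor with liminf below E_Ch(f) + 1/(k+1) has infinitely many terms
below that level, and eventually its terms are 1/(k+1)-close to `f`. One such term is kept for each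
`k`. -/
theorem exists_minimizing_seq (hm : BoundedlyFinite m) {f : X → ℝ} (hf : MemW12 m f) :
    ∃ u : ℕ → X → ℝ, ApproximatesL2 m f u ∧
      Tendsto (fun n => ∫ x, rlip (u n) x ^ 2 ∂m) atTop (𝓝 (dirichlet m f)) := by
  have hE := cheegerEnergy_ne_top hf
  have key : ∀ k : ℕ, ∃ v : X → ℝ, IsLipBs v ∧
      eLpNorm (fun x => v x - f x) 2 m < ((k : ℝ≥0∞) + 1)⁻¹ ∧
      2⁻¹ * ∫⁻ x, lip v x ^ 2 ∂m < cheegerEnergy m f + ((k : ℝ≥0∞) + 1)⁻¹ := by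
    intro k
    have hk : (0 : ℝ≥0∞) < ((k : ℝ≥0∞) + 1)⁻¹ := by simp
    have h1 : cheegerEnergy m f < cheegerEnergy m f + ((k : ℝ≥0∞) + 1)⁻¹ :=
      ENNReal.lt_add_right hE hk.ne'
    rw [cheegerEnergy] at h1
    simp only [iInf_lt_iff] at h1
    obtain ⟨u, hu, hlt⟩ := h1
    have h2 := frequently_lt_of_liminf_lt (by isBoundedDefault) hlt
    obtain ⟨n, hn1, hn2⟩ := (h2.and_eventually (hu.2.eventually_lt_const hk)).exists
    exact ⟨u n, hu.1 n, hn2, hn1⟩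
  choose v hv1 hv2 hv3 using key
  have hz : Tendsto (fun k : ℕ => ((k : ℝ≥0∞) + 1)⁻¹) atTop (𝓝 0) := by
    have := (tendsto_add_atTop_iff_nat 1).2 ENNReal.tendsto_inv_nat_nhds_zero
    simpa using this
  have hv : ApproximatesL2 m f v := ⟨hv1, tendsto_of_tendsto_of_tendsto_of_le_of_le
    tendsto_const_nhds hz (fun _ => zero_le) fun k => (hv2 k).le⟩
  refine ⟨v, hv, ?_⟩
  have h4 : Tendsto (fun k => 2⁻¹ * ∫⁻ x, lip (v k) x ^ 2 ∂m) atTop (𝓝 (cheegerEnergy m f)) := by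
    refine tendsto_of_le_liminf_of_limsup_le (iInf₂_le v hv) ?_
    have h5 : Tendsto (fun k : ℕ => cheegerEnergy m f + ((k : ℝ≥0∞) + 1)⁻¹) atTop
        (𝓝 (cheegerEnergy m f)) := by simpa using tendsto_const_nhds.add hz
    rw [← h5.limsup_eq]
    exact limsup_le_limsup (Eventually.of_forall fun k => (hv3 k).le)
  have h6 := ((ENNReal.tendsto_toReal hE).comp h4).const_mul 2
  refine h6.congr fun k => ?_
  simp only [Function.comp, lintegral_lip_sq_eq hm (hv1 k), ENNReal.toReal_mul,
    ENNReal.toReal_ofReal (integral_nonneg fun x => sq_nonneg (rlip (v k) x))]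
  simp

theorem ApproximatesL2.comp {f : X → ℝ} {u : ℕ → X → ℝ} (hu : ApproximatesL2 m f u) {s : ℕ → ℕ}
    (hs : Tendsto s atTop atTop) : ApproximatesL2 m f (fun n => u (s n)) :=
  ⟨fun n => hu.1 _, Tendsto.comp (g := fun n => eLpNorm (fun x => u n x - f x) 2 m) hu.2 hs⟩

theorem ApproximatesL2.average (hm : BoundedlyFinite m) {f : X → ℝ} (hf : MemLp f 2 m)
    {u v : ℕ → X → ℝ} (hu : ApproximatesL2 m f u) (hv : ApproximatesL2 m f v) :
    ApproximatesL2 m f (fun n => fun x => 2⁻¹ * (u n + v n) x) := by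
  refine ⟨fun n => ((hu.1 n).add (hv.1 n)).const_mul _, ?_⟩
  have h := TendstoL2.const_mul (TendstoL2.add (l := atTop) hu.2 hv.2 (fun n => (hu.1 n).memLp hm) hf
    (fun n => (hv.1 n).memLp hm) hf) 2⁻¹
  refine TendstoL2.mono h fun n => ae_of_all _ fun x => le_of_eq ?_
  congr 1
  simp only [Pi.add_apply]
  ring

theorem rlip_average_le {u v : X → ℝ} (hu : IsLipBs u) (hv : IsLipBs v) (x : X) :
    rlip (fun x => 2⁻¹ * (u + v) x) x ≤ 2⁻¹ * (rlip u x + rlip v x) := by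
  obtain ⟨⟨K, hK⟩, -⟩ := hu
  obtain ⟨⟨L, hL⟩, -⟩ := hv
  have h1 := rlip_const_mul_le (hK.add hL) 2⁻¹ x
  have h2 := rlip_add_le hK hL x
  rw [abs_of_pos (by norm_num)] at h1
  change rlip (fun x => 2⁻¹ * (u x + v x)) x ≤ _
  change _ ≤ 2⁻¹ * rlip (u + v) x at h1
  linarith

/-- Convexity of the slope combined with the parallelogram identity of L². The negative term is the
uniform convexity that makes the slopes of a minimising sequence Cauchy. -/
theorem integral_sub_sq_rlip_le (hm : BoundedlyFinite m) {u v : X → ℝ} (hu : IsLipBs u)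
    (hv : IsLipBs v) : ∫ x, rlip (fun x => 2⁻¹ * (u + v) x) x ^ 2 ∂m ≤
      2⁻¹ * ∫ x, rlip u x ^ 2 ∂m + 2⁻¹ * ∫ x, rlip v x ^ 2 ∂m
        - 4⁻¹ * ∫ x, (rlip u x - rlip v x) ^ 2 ∂m := by
  have i1 := (hu.memLp_rlip hm).integrable_sq
  have i2 := (hv.memLp_rlip hm).integrable_sq
  have i3 := ((hu.memLp_rlip hm).sub (hv.memLp_rlip hm)).integrable_sq
  simp only [Pi.sub_apply] at i3
  have i4 : Integrable (fun x => 2⁻¹ * rlip u x ^ 2 + 2⁻¹ * rlip v x ^ 2) m :=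
    (i1.const_mul _).add (i2.const_mul _)
  rw [← integral_const_mul, ← integral_const_mul, ← integral_const_mul,
    ← integral_add (i1.const_mul _) (i2.const_mul _), ← integral_sub i4 (i3.const_mul _)]
  refine integral_mono (((hu.add hv).const_mul _).memLp_rlip hm).integrable_sq
    (i4.sub (i3.const_mul _)) fun x => ?_
  have h1 := rlip_average_le hu hv x
  have h2 := rlip_nonneg (fun x => 2⁻¹ * (u + v) x) x
  simp only
  nlinarith

theorem exists_isMinimalRelaxedSlope (hm : BoundedlyFinite m) {f : X → ℝ} (hf : MemW12 m f) :
    ∃ G, IsMinimalRelaxedSlope m f G := by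
  obtain ⟨u, hu, hlim⟩ := exists_minimizing_seq hm hf
  have hmem : ∀ n, MemLp (rlip (u n)) 2 m := fun n => (hu.1 n).memLp_rlip hm
  have hnorm : ∀ n k, ‖(hmem n).toLp _ - (hmem k).toLp _‖ ^ 2
      = ∫ x, (rlip (u n) x - rlip (u k) x) ^ 2 ∂m := by
    intro n k
    rw [← MemLp.toLp_sub, Lp.norm_toLp, eLpNorm_two_toReal_sq ((hmem n).sub (hmem k))]
    rfl
  have hcauchy : CauchySeq fun n => (hmem n).toLp _ := by
    rw [Metric.cauchySeq_iff]
    by_contra hc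
    -- Otherwise there are pairs of arbitrarily late indices with slopes at distance at least ε.
    -- Their averages still converge to `f`, with energy eventually below the infimum by about ε²/4.
    push Not at hc
    obtain ⟨ε, hε, hc⟩ := hc
    choose a ha b hb hab using hc
    have ha' : Tendsto a atTop atTop := tendsto_atTop_mono ha tendsto_id
    have hb' : Tendsto b atTop atTop := tendsto_atTop_mono hb tendsto_id
    have hw := (hu.comp ha').average hm hf.1 (hu.comp hb')
    have hB : Tendsto (fun N => 2⁻¹ * ∫ x, rlip (u (a N)) x ^ 2 ∂m
        + 2⁻¹ * ∫ x, rlip (u (b N)) x ^ 2 ∂m - 4⁻¹ * ε ^ 2) atTop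
        (𝓝 (2⁻¹ * dirichlet m f + 2⁻¹ * dirichlet m f - 4⁻¹ * ε ^ 2)) :=
      (((hlim.comp ha').const_mul _).add ((hlim.comp hb').const_mul _)).sub_const _
    have hcontra := (dirichlet_le_of_tendsto hm hw hB fun N => by
      refine (integral_sub_sq_rlip_le hm (hu.1 _) (hu.1 _)).trans ?_
      have h1 := hab N
      rw [dist_eq_norm] at h1
      have h2 := hnorm (a N) (b N)
      have : ε ^ 2 ≤ ∫ x, (rlip (u (a N)) x - rlip (u (b N)) x) ^ 2 ∂m := by
        rw [← h2]
        gcongr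
      linarith).2
    have : 0 < ε ^ 2 := by positivity
    linarith
  obtain ⟨G, hG⟩ := cauchySeq_tendsto_of_complete hcauchy
  have hGm := Lp.memLp G
  have hL2 : TendstoL2 m (fun n => rlip (u n)) atTop G := by
    have h1 := (Lp.tendsto_Lp_iff_tendsto_eLpNorm'' (fun n => rlip (u n)) hmem G hGm).1
      (by rwa [Lp.toLp_coeFn])
    exact h1
  refine ⟨G, hGm, ⟨u, hu, hL2⟩, ?_⟩
  have h3 := tendsto_nhds_unique hlim (hL2.integral_sq hmem hGm)
  rw [lintegral_enorm_sq_eq hGm, ← h3, dirichlet, ENNReal.ofReal_mul (by norm_num),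
    ENNReal.ofReal_toReal (cheegerEnergy_ne_top hf), ← mul_assoc]
  simp [ENNReal.inv_mul_cancel]

theorem isMinimalRelaxedSlope_relaxedSlope (hm : BoundedlyFinite m) {f : X → ℝ}
    (hf : MemW12 m f) : IsMinimalRelaxedSlope m f (relaxedSlope m f) := by
  have h := exists_isMinimalRelaxedSlope hm hf
  rw [relaxedSlope, dif_pos h]
  exact h.choose_spec

theorem IsMinimalRelaxedSlope.dirichlet_eq {f G : X → ℝ} (h : IsMinimalRelaxedSlope m f G) :
    dirichlet m f = ∫ x, G x ^ 2 ∂m := by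
  rw [dirichlet, h.2.2, lintegral_enorm_sq_eq h.1, ENNReal.toReal_mul,
    ENNReal.toReal_ofReal (integral_nonneg fun x => sq_nonneg _)]
  simp

/-- `G` bounds, in the limit, the slopes of some sequence of Lipschitz functions with bounded
support converging to `f` in `L²`. -/
def IsRelaxedSlope (m : Measure X) (f G : X → ℝ) : Prop :=
  MemLp f 2 m ∧ MemLp G 2 m ∧ ∃ u g : ℕ → X → ℝ, ApproximatesL2 m f u ∧
    (∀ n, MemLp (g n) 2 m) ∧ (∀ n, ∀ᵐ x ∂m, rlip (u n) x ≤ g n x) ∧ TendstoL2 m g atTop G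

theorem IsMinimalRelaxedSlope.isRelaxedSlope (hm : BoundedlyFinite m) {f G : X → ℝ}
    (hf : MemLp f 2 m) (h : IsMinimalRelaxedSlope m f G) : IsRelaxedSlope m f G := by
  obtain ⟨h1, ⟨u, hu, hlim⟩, -⟩ := h
  exact ⟨hf, h1, u, fun n => rlip (u n), hu, fun n => (hu.1 n).memLp_rlip hm,
    fun n => ae_of_all _ fun x => le_rfl, hlim⟩

theorem integral_rlip_sq_le (hm : BoundedlyFinite m) {u g : X → ℝ} (hu : IsLipBs u)
    (hg : MemLp g 2 m) (h : ∀ᵐ x ∂m, rlip u x ≤ g x) :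
    ∫ x, rlip u x ^ 2 ∂m ≤ ∫ x, g x ^ 2 ∂m := by
  refine integral_mono_ae (hu.memLp_rlip hm).integrable_sq hg.integrable_sq ?_
  filter_upwards [h] with x hx
  have := rlip_nonneg u x
  exact pow_le_pow_left₀ this hx 2

theorem IsRelaxedSlope.dirichlet_le (hm : BoundedlyFinite m) {f G : X → ℝ}
    (h : IsRelaxedSlope m f G) : dirichlet m f ≤ ∫ x, G x ^ 2 ∂m := by
  obtain ⟨-, hG, u, g, hu, hg, hle, hlim⟩ := h
  exact (dirichlet_le_of_tendsto hm hu (hlim.integral_sq hg hG) fun n =>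
    integral_rlip_sq_le hm (hu.1 n) (hg n) (hle n)).2

theorem IsRelaxedSlope.memW12 (hm : BoundedlyFinite m) {f G : X → ℝ}
    (h : IsRelaxedSlope m f G) : MemW12 m f := by
  obtain ⟨hf, hG, u, g, hu, hg, hle, hlim⟩ := h
  refine ⟨hf, u, hu, ?_⟩
  have h1 := ENNReal.tendsto_ofReal (hlim.integral_sq hg hG)
  refine lt_of_le_of_lt ?_ (ENNReal.ofReal_lt_top (r := ∫ x, G x ^ 2 ∂m))
  rw [← h1.liminf_eq]
  refine liminf_le_liminf (Eventually.of_forall fun n => ?_)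
  rw [lintegral_lip_sq_eq hm (hu.1 n)]
  exact ENNReal.ofReal_le_ofReal (integral_rlip_sq_le hm (hu.1 n) (hg n) (hle n))

theorem IsRelaxedSlope.ae_nonneg {f G : X → ℝ} (h : IsRelaxedSlope m f G) :
    ∀ᵐ x ∂m, 0 ≤ G x := by
  obtain ⟨-, hG, u, g, hu, hg, hle, hlim⟩ := h
  refine TendstoL2.ae_le (tendstoL2_const (fun _ => 0) atTop) hlim (fun _ => by simp) (by simp) hg hG
    fun i => ?_
  filter_upwards [hle i] with x hx using (rlip_nonneg _ x).trans hx

/-- Relaxed slopes can be glued with a Lipschitz weight. -/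
theorem IsRelaxedSlope.glue (hm : BoundedlyFinite m) {f f' G H ψ : X → ℝ} {M : ℝ≥0}
    (hG : IsRelaxedSlope m f G) (hH : IsRelaxedSlope m f' H) (hψ : LipschitzWith M ψ)
    (h0 : ∀ y, 0 ≤ ψ y) (h1 : ∀ y, ψ y ≤ 1) :
    IsRelaxedSlope m (fun x => (1 - ψ x) * f x + ψ x * f' x)
      (fun x => (1 - ψ x) * G x + ψ x * H x + |f x - f' x| * M) := by
  obtain ⟨hf, hGm, u, g, hu, hg, hle, hlim⟩ := hG
  obtain ⟨hf', hHm, v, k, hv, hk, hle', hlim'⟩ := hH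
  have hψm : AEStronglyMeasurable ψ m := hψ.continuous.measurable.aestronglyMeasurable
  have hψm' : AEStronglyMeasurable (fun x => 1 - ψ x) m :=
    (continuous_const.sub hψ.continuous).measurable.aestronglyMeasurable
  have hb : ∀ x, |ψ x| ≤ 1 := fun x => abs_le.2 ⟨by linarith [h0 x], h1 x⟩
  have hb' : ∀ x, |1 - ψ x| ≤ 1 := fun x => abs_le.2 ⟨by linarith [h1 x], by linarith [h0 x]⟩
  have hmem : ∀ (c : X → ℝ) (v : X → ℝ), AEStronglyMeasurable c m → (∀ x, |c x| ≤ 1) →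
      MemLp v 2 m → MemLp (fun x => c x * v x) 2 m := fun c v hc hc1 hv =>
    hv.of_le (hc.mul hv.1) (ae_of_all _ fun x => by
      rw [norm_mul]
      exact mul_le_of_le_one_left (norm_nonneg _) (hc1 x))
  have hcomb : ∀ a b : X → ℝ, MemLp a 2 m → MemLp b 2 m →
      MemLp (fun x => (1 - ψ x) * a x + ψ x * b x) 2 m := fun a b ha hb2 =>
    (hmem _ _ hψm' hb' ha).add (hmem _ _ hψm hb hb2)
  have hconv : ∀ (a b : ℕ → X → ℝ) (A B : X → ℝ), TendstoL2 m a atTop A → TendstoL2 m b atTop B →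
      (∀ n, MemLp (a n) 2 m) → MemLp A 2 m → (∀ n, MemLp (b n) 2 m) → MemLp B 2 m →
      TendstoL2 m (fun n x => (1 - ψ x) * a n x + ψ x * b n x) atTop
        (fun x => (1 - ψ x) * A x + ψ x * B x) := by
    intro a b A B hA hB ha hA' hb2 hB'
    exact (hA.bdd_mul ha hA' (fun _ => hψm') hψm' (fun _ => hb') hb'
      (ae_of_all _ fun x => tendsto_const_nhds)).add
      (hB.bdd_mul hb2 hB' (fun _ => hψm) hψm (fun _ => hb) hb
      (ae_of_all _ fun x => tendsto_const_nhds)) (fun n => hmem _ _ hψm' hb' (ha n))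
      (hmem _ _ hψm' hb' hA') (fun n => hmem _ _ hψm hb (hb2 n)) (hmem _ _ hψm hb hB')
  have hum : ∀ n, MemLp (u n) 2 m := fun n => (hu.1 n).memLp hm
  have hvm : ∀ n, MemLp (v n) 2 m := fun n => (hv.1 n).memLp hm
  have hdm : ∀ a b : X → ℝ, MemLp a 2 m → MemLp b 2 m → MemLp (fun x => |a x - b x| * M) 2 m :=
    fun a b ha hb2 => (ha.sub hb2).abs.mul_const (M : ℝ)
  refine ⟨hcomb _ _ hf hf', (hcomb _ _ hGm hHm).add (hdm _ _ hf hf'),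
    fun n x => (1 - ψ x) * u n x + ψ x * v n x,
    fun n x => ((1 - ψ x) * g n x + ψ x * k n x) + |u n x - v n x| * M,
    ⟨fun n => (hu.1 n).glue (hv.1 n) hψ h0 h1, hconv u v f f' hu.2 hv.2 hum hf hvm hf'⟩,
    fun n => (hcomb _ _ (hg n) (hk n)).add (hdm _ _ (hum n) (hvm n)), fun n => ?_, ?_⟩
  · obtain ⟨⟨K, hK⟩, -⟩ := hu.1 n
    obtain ⟨⟨L, hL⟩, -⟩ := hv.1 n
    filter_upwards [hle n, hle' n] with x hx hx'
    refine (rlip_glue_le hK hL hψ h0 h1 x).trans ?_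
    have := sub_nonneg.2 (h1 x)
    have := h0 x
    gcongr
  · refine (hconv g k G H hlim hlim' hg hGm hk hHm).add ?_ (fun n => hcomb _ _ (hg n) (hk n))
      (hcomb _ _ hGm hHm) (fun n => hdm _ _ (hum n) (hvm n)) (hdm _ _ hf hf')
    have h3 := (TendstoL2.sub (l := atTop) hu.2 hv.2 hum hf hvm hf').const_mul M
    refine h3.mono fun n => ae_of_all _ fun x => ?_
    rw [← sub_mul, ← mul_sub, abs_mul, abs_mul, mul_comm]
    exact mul_le_mul_of_nonneg_left (abs_abs_sub_abs_le (u n x - v n x) (f x - f' x))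
      (abs_nonneg _)

/-- The minimal relaxed slope is below every relaxed slope. -/
theorem IsMinimalRelaxedSlope.ae_le (hm : BoundedlyFinite m) {f G H : X → ℝ}
    (hG : IsMinimalRelaxedSlope m f G) (hH : IsRelaxedSlope m f H) : ∀ᵐ x ∂m, G x ≤ H x := by
  have hGr := hG.isRelaxedSlope hm hH.1
  have iG := hG.1.integrable_sq
  have iD := (hH.2.1.sub hG.1).integrable_sq
  have iGD : Integrable (fun x => G x * (H x - G x)) m := hG.1.integrable_mul (hH.2.1.sub hG.1)
  -- First variation: gluing `f` with itself with weight ε h shows that G + ε h (H - G) is a relaxed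
  -- slope of `f`. Its energy is not below that of `G`, so the term linear in ε is nonnegative.
  have hpos : 0 ≤ᵐ[m] fun x => G x * (H x - G x) := by
    refine ae_nonneg_of_forall_lipschitz iGD one_ne_zero fun h K hK h0 h1 => ?_
    have ih1 : Integrable (fun x => h x * (G x * (H x - G x))) m :=
      iGD.bdd_mul (c := 1) hK.continuous.measurable.aestronglyMeasurable
        (ae_of_all _ fun x => abs_le.2 ⟨by linarith [h0 x], h1 x⟩)
    have key : ∀ ε : ℝ, 0 < ε → ε ≤ 1 →
        0 ≤ 2 * (∫ x, h x * (G x * (H x - G x)) ∂m) + ε * ∫ x, (H x - G x) ^ 2 ∂m := by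
      intro ε hε hε1
      have hr := (hGr.glue hm hH (ψ := fun x => ε * h x)
        (M := (Real.toNNReal |ε| * K)) (by
          refine LipschitzWith.comp (f := fun z : ℝ => ε * z)
            (LipschitzWith.of_dist_le' fun x y => ?_) hK
          simp [Real.dist_eq, ← mul_sub, abs_mul])
        (fun x => mul_nonneg hε.le (h0 x)) (fun x => by nlinarith [h0 x, h1 x]))
      have e1 : (fun x => (1 - ε * h x) * f x + ε * h x * f x) = f := by ext x; ring
      rw [e1] at hr
      have h2 := hr.dirichlet_le hm
      rw [hG.dirichlet_eq] at h2
      have h3 : ∫ x, ((1 - ε * h x) * G x + ε * h x * H x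
          + |f x - f x| * (Real.toNNReal |ε| * K : ℝ≥0)) ^ 2 ∂m
          ≤ ∫ x, (G x ^ 2 + (2 * ε * (h x * (G x * (H x - G x))) + ε ^ 2 * (H x - G x) ^ 2)) ∂m := by
        refine integral_mono hr.2.1.integrable_sq
          (iG.add ((ih1.const_mul _).add (iD.const_mul _))) fun x => ?_
        simp only [sub_self, abs_zero, zero_mul, add_zero]
        have := h0 x
        have := h1 x
        have hh : h x ^ 2 ≤ 1 := by nlinarith
        have : ε ^ 2 * (H x - G x) ^ 2 * h x ^ 2 ≤ ε ^ 2 * (H x - G x) ^ 2 :=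
          mul_le_of_le_one_right (by positivity) hh
        nlinarith
      simp only [Pi.sub_apply] at iD
      have i5 : Integrable (fun x => 2 * ε * (h x * (G x * (H x - G x)))
        + ε ^ 2 * (H x - G x) ^ 2) m := (ih1.const_mul _).add (iD.const_mul _)
      rw [integral_add iG i5,
        integral_add (ih1.const_mul _) (iD.const_mul _), integral_const_mul,
        integral_const_mul] at h3
      have h4 : 0 ≤ ε * (2 * (∫ x, h x * (G x * (H x - G x)) ∂m)
        + ε * ∫ x, (H x - G x) ^ 2 ∂m) := by linarith
      exact nonneg_of_mul_nonneg_right h4 hε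
    simp only [pow_one]
    have hlim : Tendsto (fun n : ℕ => 2 * (∫ x, h x * (G x * (H x - G x)) ∂m)
        + (1 / ((n : ℝ) + 1)) * ∫ x, (H x - G x) ^ 2 ∂m) atTop
        (𝓝 (2 * (∫ x, h x * (G x * (H x - G x)) ∂m) + 0 * ∫ x, (H x - G x) ^ 2 ∂m)) :=
      tendsto_const_nhds.add (tendsto_one_div_add_atTop_nhds_zero_nat.mul_const _)
    have := ge_of_tendsto' hlim fun n => key _ (by positivity)
      ((div_le_one (by positivity)).2 (by linarith [Nat.cast_nonneg (α := ℝ) n]))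
    linarith
  filter_upwards [hpos, hGr.ae_nonneg, hH.ae_nonneg] with x hx hGx hHx
  simp only [Pi.zero_apply] at hx
  by_contra hc
  push Not at hc
  -- Where G = 0 the claim is H ≥ 0; where G > 0 it follows by dividing by G.
  rcases hGx.eq_or_lt with h | h
  · linarith
  · nlinarith

/-- Relaxed slopes are closed under strong `L²` limits. -/
theorem isRelaxedSlope_of_tendsto {f G : X → ℝ} {φ Γ : ℕ → X → ℝ} (hf : MemLp f 2 m)
    (hG : MemLp G 2 m) (h : ∀ k, IsRelaxedSlope m (φ k) (Γ k)) (h1 : TendstoL2 m φ atTop f)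
    (h2 : TendstoL2 m Γ atTop G) (hm : BoundedlyFinite m) : IsRelaxedSlope m f G := by
  -- Diagonal argument: one term approximating the pair (φ_k, Γ_k) within 1/(k+1).
  have key : ∀ k : ℕ, ∃ v g : X → ℝ, IsLipBs v ∧ MemLp g 2 m ∧ (∀ᵐ x ∂m, rlip v x ≤ g x) ∧
      eLpNorm (fun x => v x - φ k x) 2 m < ((k : ℝ≥0∞) + 1)⁻¹ ∧
      eLpNorm (fun x => g x - Γ k x) 2 m < ((k : ℝ≥0∞) + 1)⁻¹ := by
    intro k
    have hk : (0 : ℝ≥0∞) < ((k : ℝ≥0∞) + 1)⁻¹ := by simp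
    obtain ⟨-, -, u, g, hu, hg, hle, hlim⟩ := h k
    have hlim' : Tendsto _ _ _ := hlim
    obtain ⟨n, hn1, hn2⟩ := ((hu.2.eventually_lt_const hk).and
      (hlim'.eventually_lt_const hk)).exists
    exact ⟨u n, g n, hu.1 n, hg n, hle n, hn1, hn2⟩
  choose v g hv hg hle hv2 hg2 using key
  have hz : Tendsto (fun k : ℕ => ((k : ℝ≥0∞) + 1)⁻¹) atTop (𝓝 0) := by
    have := (tendsto_add_atTop_iff_nat 1).2 ENNReal.tendsto_inv_nat_nhds_zero
    simpa using this
  have aux : ∀ (a b : ℕ → X → ℝ) (c : X → ℝ), (∀ k, MemLp (a k) 2 m) → (∀ k, MemLp (b k) 2 m) →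
      MemLp c 2 m → (∀ k, eLpNorm (fun x => a k x - b k x) 2 m < ((k : ℝ≥0∞) + 1)⁻¹) →
      TendstoL2 m b atTop c → TendstoL2 m a atTop c := by
    intro a b c ha hb hc hab hbc
    have h3 : TendstoL2 m (fun k x => a k x - b k x) atTop (fun _ => 0) := by
      simp only [TendstoL2, sub_zero]
      exact tendsto_of_tendsto_of_tendsto_of_le_of_le
        tendsto_const_nhds hz (fun _ => zero_le) fun k => (hab k).le
    have h4 := h3.add hbc (fun k => (ha k).sub (hb k)) (by simp) hb hc
    simpa using h4
  exact ⟨hf, hG, v, g, ⟨hv, aux v φ f (fun k => (hv k).memLp hm) (fun k => (h k).1) hf hv2 h1⟩, hg,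
    hle, aux g Γ G hg (fun k => (h k).2.1) hG hg2 h2⟩

end Relaxation

end MetricSobolev

namespace MetricSobolev

/-! ### Calculus rules and locality of the minimal relaxed slope. -/

section Calculus

variable {X : Type*} [MetricSpace X] [MeasurableSpace X] [BorelSpace X] {m : Measure X}

theorem isRelaxedSlope_relaxedSlope (hm : BoundedlyFinite m) {f : X → ℝ} (hf : MemW12 m f) :
    IsRelaxedSlope m f (relaxedSlope m f) :=
  (isMinimalRelaxedSlope_relaxedSlope hm hf).isRelaxedSlope hm hf.1

theorem memLp_relaxedSlope (hm : BoundedlyFinite m) {f : X → ℝ} (hf : MemW12 m f) :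
    MemLp (relaxedSlope m f) 2 m :=
  (isMinimalRelaxedSlope_relaxedSlope hm hf).1

theorem relaxedSlope_nonneg (hm : BoundedlyFinite m) {f : X → ℝ} (hf : MemW12 m f) :
    ∀ᵐ x ∂m, 0 ≤ relaxedSlope m f x :=
  (isRelaxedSlope_relaxedSlope hm hf).ae_nonneg

theorem IsRelaxedSlope.relaxedSlope_le (hm : BoundedlyFinite m) {f G : X → ℝ}
    (h : IsRelaxedSlope m f G) : ∀ᵐ x ∂m, relaxedSlope m f x ≤ G x :=
  (isMinimalRelaxedSlope_relaxedSlope hm (h.memW12 hm)).ae_le hm h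

theorem dirichlet_eq_integral (hm : BoundedlyFinite m) {f : X → ℝ} (hf : MemW12 m f) :
    dirichlet m f = ∫ x, relaxedSlope m f x ^ 2 ∂m :=
  (isMinimalRelaxedSlope_relaxedSlope hm hf).dirichlet_eq

theorem IsRelaxedSlope.add (hm : BoundedlyFinite m) {f f' G H : X → ℝ}
    (hG : IsRelaxedSlope m f G) (hH : IsRelaxedSlope m f' H) :
    IsRelaxedSlope m (f + f') (G + H) := by
  obtain ⟨hf, hGm, u, g, hu, hg, hle, hlim⟩ := hG
  obtain ⟨hf', hHm, v, k, hv, hk, hle', hlim'⟩ := hH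
  refine ⟨hf.add hf', hGm.add hHm, fun n => u n + v n, fun n => g n + k n,
    ⟨fun n => (hu.1 n).add (hv.1 n), TendstoL2.add (l := atTop) hu.2 hv.2
      (fun n => (hu.1 n).memLp hm) hf (fun n => (hv.1 n).memLp hm) hf'⟩,
    fun n => (hg n).add (hk n), fun n => ?_, hlim.add hlim' hg hGm hk hHm⟩
  obtain ⟨⟨K, hK⟩, -⟩ := hu.1 n
  obtain ⟨⟨L, hL⟩, -⟩ := hv.1 n
  filter_upwards [hle n, hle' n] with x hx hx'
  exact (rlip_add_le hK hL x).trans (add_le_add hx hx')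

theorem IsRelaxedSlope.const_mul {f G : X → ℝ} (hG : IsRelaxedSlope m f G) (c : ℝ) :
    IsRelaxedSlope m (fun x => c * f x) (fun x => |c| * G x) := by
  obtain ⟨hf, hGm, u, g, hu, hg, hle, hlim⟩ := hG
  refine ⟨hf.const_mul c, hGm.const_mul _, fun n x => c * u n x, fun n x => |c| * g n x,
    ⟨fun n => (hu.1 n).const_mul c, TendstoL2.const_mul (l := atTop) hu.2 c⟩,
    fun n => (hg n).const_mul _, fun n => ?_, hlim.const_mul _⟩
  obtain ⟨⟨K, hK⟩, -⟩ := hu.1 n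
  filter_upwards [hle n] with x hx
  exact (rlip_const_mul_le hK c x).trans (by gcongr)

theorem isRelaxedSlope_zero : IsRelaxedSlope m (fun _ => 0) (fun _ => 0) := by
  refine ⟨by simp, by simp, fun _ _ => 0, fun _ _ => 0, ⟨fun _ => IsLipBs.zero,
    tendstoL2_const (fun _ => 0) atTop⟩, fun _ => by simp, fun _ => ae_of_all _ fun x => ?_,
    tendstoL2_const (fun _ => 0) atTop⟩
  simpa using rlip_le_of_lipschitzWith (LipschitzWith.const (0 : ℝ)) x

/-- Leibniz rule, obtained by gluing the zero function to `f` with weight `h`. -/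
theorem IsRelaxedSlope.mul_lipschitz (hm : BoundedlyFinite m) {f G h : X → ℝ} {M : ℝ≥0}
    (hG : IsRelaxedSlope m f G) (hh : LipschitzWith M h) (h0 : ∀ y, 0 ≤ h y) (h1 : ∀ y, h y ≤ 1) :
    IsRelaxedSlope m (fun x => h x * f x) (fun x => h x * G x + |f x| * M) := by
  simpa using isRelaxedSlope_zero.glue hm hG hh h0 h1

theorem IsRelaxedSlope.comp_lipschitz {f G : X → ℝ} (hG : IsRelaxedSlope m f G) {T : ℝ → ℝ}
    (hT : LipschitzWith 1 T) (hT0 : T 0 = 0) : IsRelaxedSlope m (fun x => T (f x)) G := by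
  obtain ⟨hf, hGm, u, g, hu, hg, hle, hlim⟩ := hG
  have hTle : ∀ a b, |T a - T b| ≤ |a - b| := fun a b => by
    simpa [Real.dist_eq] using hT.dist_le_mul a b
  refine ⟨hf.of_le (hT.continuous.comp_aestronglyMeasurable hf.1) (ae_of_all _ fun x => by
    simpa [hT0] using hTle (f x) 0), hGm, fun n x => T (u n x), g,
    ⟨fun n => (hu.1 n).comp hT hT0, TendstoL2.mono (l := atTop) hu.2 fun n => ae_of_all _ fun x =>
      hTle _ _⟩, hg, fun n => ?_, hlim⟩
  obtain ⟨⟨K, hK⟩, -⟩ := hu.1 n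
  filter_upwards [hle n] with x hx
  exact (rlip_comp_lipschitz_le hK hT x).trans hx

/-- The chain rule for slopes passes to the limit along a subsequence converging a.e.: there
|φ'(u_n)| converges a.e. and is bounded by 1, while the bounds on the slopes converge in L². -/
theorem IsRelaxedSlope.comp_deriv (hm : BoundedlyFinite m) {f G : X → ℝ}
    (hG : IsRelaxedSlope m f G) {φ φ' : ℝ → ℝ} (hφ : ∀ z, HasDerivAt φ (φ' z) z)
    (hc : Continuous φ') (h1 : ∀ z, |φ' z| ≤ 1) (h0 : φ 0 = 0) :
    IsRelaxedSlope m (fun x => φ (f x)) (fun x => |φ' (f x)| * G x) := by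
  have hT : LipschitzWith 1 φ := lipschitzWith_of_nnnorm_deriv_le (fun z => (hφ z).differentiableAt)
    fun z => by
      rw [(hφ z).deriv, ← NNReal.coe_le_coe, coe_nnnorm]
      simpa using h1 z
  obtain ⟨hf, hGm, u, g, hu, hg, hle, hlim⟩ := hG
  obtain ⟨s, hs, hsx⟩ := TendstoL2.exists_subseq_ae hu.2 (fun n => (hu.1 n).memLp hm) hf
  have hTle : ∀ a b, |φ a - φ b| ≤ |a - b| := fun a b => by
    simpa [Real.dist_eq] using hT.dist_le_mul a b
  have hca : Continuous fun z => |φ' z| := hc.abs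
  have hmeas : ∀ v : X → ℝ, MemLp v 2 m → AEStronglyMeasurable (fun x => |φ' (v x)|) m :=
    fun v hv => hca.comp_aestronglyMeasurable hv.1
  have h1' : ∀ z, |(|φ' z|)| ≤ 1 := fun z => by rw [abs_abs]; exact h1 z
  have hmem : ∀ v w : X → ℝ, MemLp v 2 m → MemLp w 2 m → MemLp (fun x => |φ' (v x)| * w x) 2 m :=
    fun v w hv hw => hw.of_le ((hmeas v hv).mul hw.1) (ae_of_all _ fun x => by
      rw [norm_mul]
      exact mul_le_of_le_one_left (norm_nonneg _) (h1' _))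
  have hum : ∀ n, MemLp (u n) 2 m := fun n => (hu.1 n).memLp hm
  refine ⟨hf.of_le (hT.continuous.comp_aestronglyMeasurable hf.1) (ae_of_all _ fun x => by
    simpa [h0] using hTle (f x) 0), hmem _ _ hf hGm, fun n x => φ (u (s n) x),
    fun n x => |φ' (u (s n) x)| * g (s n) x,
    ⟨fun n => (hu.1 _).comp hT h0, TendstoL2.mono (l := atTop)
      (TendstoL2.comp (l := atTop) hu.2 hs.tendsto_atTop) fun n => ae_of_all _ fun x =>
      hTle _ _⟩, fun n => hmem _ _ (hum _) (hg _), fun n => ?_, ?_⟩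
  · obtain ⟨⟨K, hK⟩, -⟩ := hu.1 (s n)
    filter_upwards [hle (s n)] with x hx
    exact (rlip_comp_le hK hφ x).trans (by gcongr)
  · refine (hlim.comp hs.tendsto_atTop).bdd_mul (fun n => hg _) hGm (fun n => hmeas _ (hum _))
      (hmeas _ hf) (fun n x => h1' _) (fun x => h1' _) ?_
    filter_upwards [hsx] with x hx
    exact (hca.tendsto _).comp hx

theorem memW12_add (hm : BoundedlyFinite m) {f g : X → ℝ} (hf : MemW12 m f) (hg : MemW12 m g) :
    MemW12 m (f + g) :=
  ((isRelaxedSlope_relaxedSlope hm hf).add hm (isRelaxedSlope_relaxedSlope hm hg)).memW12 hm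

theorem memW12_const_mul (hm : BoundedlyFinite m) {f : X → ℝ} (hf : MemW12 m f) (c : ℝ) :
    MemW12 m (fun x => c * f x) :=
  ((isRelaxedSlope_relaxedSlope hm hf).const_mul c).memW12 hm

theorem memW12_neg (hm : BoundedlyFinite m) {f : X → ℝ} (hf : MemW12 m f) : MemW12 m (-f) := by
  have := memW12_const_mul hm hf (-1)
  simp only [neg_mul, one_mul] at this
  exact this

theorem memW12_sub (hm : BoundedlyFinite m) {f g : X → ℝ} (hf : MemW12 m f) (hg : MemW12 m g) :
    MemW12 m (f - g) := by
  rw [sub_eq_add_neg]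
  exact memW12_add hm hf (memW12_neg hm hg)

theorem relaxedSlope_add_le (hm : BoundedlyFinite m) {f g : X → ℝ} (hf : MemW12 m f)
    (hg : MemW12 m g) :
    ∀ᵐ x ∂m, relaxedSlope m (f + g) x ≤ relaxedSlope m f x + relaxedSlope m g x :=
  ((isRelaxedSlope_relaxedSlope hm hf).add hm
    (isRelaxedSlope_relaxedSlope hm hg)).relaxedSlope_le hm

/-- The nontrivial inequality is the easy one applied to `c * f` and the factor `c⁻¹`. -/
theorem relaxedSlope_const_mul (hm : BoundedlyFinite m) {f : X → ℝ} (hf : MemW12 m f) {c : ℝ}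
    (hc : c ≠ 0) : ∀ᵐ x ∂m, relaxedSlope m (fun x => c * f x) x = |c| * relaxedSlope m f x := by
  have h1 := ((isRelaxedSlope_relaxedSlope hm hf).const_mul c).relaxedSlope_le hm
  have h2 := ((isRelaxedSlope_relaxedSlope hm
    (memW12_const_mul hm hf c)).const_mul c⁻¹).relaxedSlope_le hm
  have e : (fun x => c⁻¹ * (c * f x)) = f := by ext x; field_simp
  rw [e] at h2
  filter_upwards [h1, h2] with x hx1 hx2
  refine le_antisymm hx1 ?_
  rw [abs_inv, inv_mul_eq_div, le_div_iff₀ (abs_pos.2 hc)] at hx2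
  linarith

theorem relaxedSlope_neg (hm : BoundedlyFinite m) {f : X → ℝ} (hf : MemW12 m f) :
    ∀ᵐ x ∂m, relaxedSlope m (-f) x = relaxedSlope m f x := by
  have := relaxedSlope_const_mul hm hf (c := -1) (by norm_num)
  simp only [neg_mul, one_mul, abs_neg, abs_one] at this
  exact this

/-- The minimal relaxed slope vanishes on level sets. -/
theorem relaxedSlope_eq_zero_of_eq (hm : BoundedlyFinite m) {f : X → ℝ} (hf : MemW12 m f) (c : ℝ) :
    ∀ᵐ x ∂m, f x = c → relaxedSlope m f x = 0 := by
  set G := relaxedSlope m f with hGdef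
  have hG := isRelaxedSlope_relaxedSlope hm hf
  -- These functions fix 0 and tend uniformly to the identity, while their derivatives lie in [0,
  -- 1], vanish at `c` and tend to 1 elsewhere. In the limit, `G` cut off to {f ≠ c} is a relaxed
  -- slope of `f`.
  set φ : ℕ → ℝ → ℝ := fun k z => z - (Real.arctan (((k : ℝ) + 1) * (z - c))
    - Real.arctan (((k : ℝ) + 1) * (0 - c))) / ((k : ℝ) + 1) with hφdef
  set φ' : ℕ → ℝ → ℝ := fun k z => 1 - 1 / (1 + (((k : ℝ) + 1) * (z - c)) ^ 2) with hφ'def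
  have hφ : ∀ k z, HasDerivAt (φ k) (φ' k z) z := by
    intro k z
    have h1 : HasDerivAt (fun z => ((k : ℝ) + 1) * (z - c)) (((k : ℝ) + 1) * 1) z :=
      ((hasDerivAt_id z).sub_const c).const_mul _
    have h2 := (((h1.arctan).sub_const (Real.arctan (((k : ℝ) + 1) * (0 - c)))).div_const
      ((k : ℝ) + 1))
    have h3 := (hasDerivAt_id z).sub h2
    convert! h3 using 1
    simp only [hφ'def]
    have : (k : ℝ) + 1 ≠ 0 := by positivity
    field_simp
  have hfrac : ∀ t : ℝ, 0 < 1 / (1 + t ^ 2) ∧ 1 / (1 + t ^ 2) ≤ 1 := fun t =>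
    ⟨by positivity, (div_le_one (by positivity)).2 (by nlinarith [sq_nonneg t])⟩
  have hφ1 : ∀ k z, |φ' k z| ≤ 1 := fun k z => by
    have := hfrac (((k : ℝ) + 1) * (z - c))
    simp only [hφ'def]
    rw [abs_le]
    constructor <;> linarith
  have hφc : ∀ k, Continuous (φ' k) := fun k => by
    refine continuous_const.sub (continuous_const.div (by fun_prop) fun z => by positivity)
  have hr := fun k => hG.comp_deriv hm (hφ k) (hφc k) (hφ1 k) (by simp [hφdef])
  have hlimit : IsRelaxedSlope m f (fun x => (if f x = c then 0 else 1) * G x) := by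
    have hmz : Measurable fun z : ℝ => if z = c then (0 : ℝ) else 1 :=
      Measurable.ite (measurableSet_singleton c) measurable_const measurable_const
    have hmeas : AEStronglyMeasurable (fun x => if f x = c then (0 : ℝ) else 1) m :=
      (hmz.comp_aemeasurable hf.1.1.aemeasurable).aestronglyMeasurable
    have hb : ∀ x, |if f x = c then (0 : ℝ) else 1| ≤ 1 := fun x => by split_ifs <;> simp
    refine isRelaxedSlope_of_tendsto hf.1 (hG.2.1.of_le (hmeas.mul hG.2.1.1)
      (ae_of_all _ fun x => ?_)) hr ?_ ?_ hm
    · rw [norm_mul]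
      exact mul_le_of_le_one_left (norm_nonneg _) (hb x)
    · refine tendstoL2_of_dominated (b := fun x => |f x|) (fun k => (hr k).1) hf.1 hf.1.abs
        (fun k => ae_of_all _ fun x => ?_) (ae_of_all _ fun x => ?_)
      · have hT : LipschitzWith 1 (φ k) :=
          lipschitzWith_of_nnnorm_deriv_le (fun z => (hφ k z).differentiableAt) fun z => by
            rw [(hφ k z).deriv, ← NNReal.coe_le_coe, coe_nnnorm]
            simpa using hφ1 k z
        have := hT.dist_le_mul (f x) 0
        rw [Real.dist_eq, Real.dist_eq] at this
        simpa [hφdef] using this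
      · have hz : Tendsto (fun k : ℕ => Real.pi * (1 / ((k : ℝ) + 1))) atTop (𝓝 0) := by
          simpa using tendsto_one_div_add_atTop_nhds_zero_nat.const_mul Real.pi
        refine tendsto_iff_dist_tendsto_zero.2 (squeeze_zero (fun _ => dist_nonneg) (fun k => ?_) hz)
        rw [Real.dist_eq]
        simp only [hφdef, sub_sub_cancel_left, abs_neg, abs_div]
        rw [mul_one_div, abs_of_pos (show (0 : ℝ) < (k : ℝ) + 1 by positivity)]
        gcongr
        have b1 := Real.arctan_lt_pi_div_two (((k : ℝ) + 1) * (f x - c))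
        have b2 := Real.neg_pi_div_two_lt_arctan (((k : ℝ) + 1) * (f x - c))
        have b3 := Real.arctan_lt_pi_div_two (((k : ℝ) + 1) * (0 - c))
        have b4 := Real.neg_pi_div_two_lt_arctan (((k : ℝ) + 1) * (0 - c))
        rw [abs_le]
        constructor <;> linarith
    · refine (tendstoL2_const G atTop).bdd_mul (fun _ => hG.2.1) hG.2.1
        (fun k => (hφc k).abs.comp_aestronglyMeasurable hf.1.1) hmeas
        (fun k x => by rw [abs_abs]; exact hφ1 k _) hb (ae_of_all _ fun x => ?_)
      by_cases hx : f x = c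
      · simp [hφ'def, hx]
      · simp only [hx, if_false]
        have hne : f x - c ≠ 0 := sub_ne_zero.2 hx
        have h1 : Tendsto (fun k : ℕ => 1 + (((k : ℝ) + 1) * (f x - c)) ^ 2) atTop atTop := by
          refine tendsto_atTop_add_const_left _ _ ?_
          have : Tendsto (fun k : ℕ => ((k : ℝ) + 1) ^ 2 * (f x - c) ^ 2) atTop atTop := by
            refine Tendsto.atTop_mul_const (by positivity) ?_
            exact (tendsto_pow_atTop two_ne_zero).comp
              (tendsto_atTop_add_const_right _ _ tendsto_natCast_atTop_atTop)
          simpa only [mul_pow] using this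
        have h2 : Tendsto (fun k : ℕ => φ' k (f x)) atTop (𝓝 1) := by
          have := (tendsto_const_nhds (x := (1 : ℝ))).sub (h1.inv_tendsto_atTop)
          simpa [hφ'def] using this
        simpa using h2.abs
  filter_upwards [hlimit.relaxedSlope_le hm, hG.ae_nonneg] with x hx h0 hc
  simp only [hc, if_true, zero_mul] at hx
  exact le_antisymm hx h0

/-- Locality of the minimal relaxed slope. -/
theorem relaxedSlope_eq_of_sub_eq (hm : BoundedlyFinite m) {f g : X → ℝ} (hf : MemW12 m f)
    (hg : MemW12 m g) (c : ℝ) :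
    ∀ᵐ x ∂m, ∀ j : ℤ, f x - g x = j * c → relaxedSlope m f x = relaxedSlope m g x := by
  -- Countably many level sets of `f - g` are treated at once, as needed for the linear pieces of
  -- the triangular wave. For each one, subadditivity in both directions compares `f` with `g`, the
  -- slope of `f - g` being zero there.
  rw [ae_all_iff]
  intro j
  have hd := memW12_sub hm hf hg
  have h1 := relaxedSlope_add_le hm hg hd
  have h2 := relaxedSlope_add_le hm hf (memW12_neg hm hd)
  rw [add_sub_cancel] at h1
  rw [show f + -(f - g) = g by ring] at h2
  filter_upwards [h1, h2, relaxedSlope_neg hm hd, relaxedSlope_eq_zero_of_eq hm hd (j * c)]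
    with x h1 h2 h3 h4 hx
  have h5 := h4 hx
  rw [h5] at h3 h1
  rw [h3] at h2
  linarith

end Calculus

end MetricSobolev

namespace MetricSobolev

/-! ### The triangular wave. -/

section Sawtooth

/-- The triangular wave with slopes `±1`: the distance from `aℤ`. -/
noncomputable def sawtooth (a z : ℝ) : ℝ := Metric.infDist z (range fun k : ℤ => (k : ℝ) * a)

theorem lipschitzWith_sawtooth (a : ℝ) : LipschitzWith 1 (sawtooth a) :=
  Metric.lipschitz_infDist_pt _

theorem sawtooth_eq {a : ℝ} (ha : 0 < a) (z : ℝ) :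
    sawtooth a z = |z - round (z / a) * a| := by
  refine le_antisymm ?_ ?_
  · rw [← Real.dist_eq]
    exact Metric.infDist_le_dist_of_mem ⟨_, rfl⟩
  · rw [sawtooth, Metric.le_infDist (range_nonempty _)]
    rintro _ ⟨k, rfl⟩
    have h := round_le (z / a) k
    have e : ∀ j : ℤ, |z - j * a| = |z / a - j| * a := fun j => by
      nth_rw 3 [← abs_of_pos ha]
      rw [← abs_mul, sub_mul, div_mul_cancel₀ _ ha.ne']
    rw [Real.dist_eq, e, e]
    gcongr

theorem sawtooth_zero (a : ℝ) : sawtooth a 0 = 0 :=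
  Metric.infDist_zero_of_mem ⟨0, by simp⟩

theorem sawtooth_nonneg (a z : ℝ) : 0 ≤ sawtooth a z := Metric.infDist_nonneg

theorem sawtooth_le_abs (a z : ℝ) : sawtooth a z ≤ |z| := by
  have := (lipschitzWith_sawtooth a).dist_le_mul z 0
  rw [sawtooth_zero, Real.dist_eq, Real.dist_eq] at this
  simpa [abs_of_nonneg (sawtooth_nonneg a z)] using this

theorem sawtooth_le {a : ℝ} (ha : 0 < a) (z : ℝ) : sawtooth a z ≤ a := by
  have h := abs_sub_round (z / a)
  rw [sawtooth_eq ha]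
  have e : z - round (z / a) * a = (z / a - round (z / a)) * a := by field_simp
  rw [e, abs_mul, abs_of_pos ha]
  nlinarith

/-- On each linear piece the wave is ±z plus a multiple of `a`, which is the form that
`relaxedSlope_eq_of_sub_eq` accepts. -/
theorem sawtooth_cases {a : ℝ} (ha : 0 < a) (z : ℝ) :
    ∃ k : ℤ, sawtooth a z - z = k * a ∨ sawtooth a z + z = k * a := by
  rw [sawtooth_eq ha]
  rcases abs_cases (z - round (z / a) * a) with ⟨h, -⟩ | ⟨h, -⟩
  · exact ⟨-round (z / a), Or.inl (by rw [h]; push_cast; ring)⟩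
  · exact ⟨round (z / a), Or.inr (by rw [h]; ring)⟩

end Sawtooth

/-! ### From the integrated to the pointwise parallelogram identity. -/

section Parallelogram

variable {X : Type*} [MetricSpace X] [MeasurableSpace X] [BorelSpace X] {m : Measure X}

/-- The L² part of the norm satisfies the parallelogram rule on its own and can be subtracted. -/
theorem dirichlet_parallelogram (hm : BoundedlyFinite m) (hH : InfinitesimallyHilbertian m)
    {f g : X → ℝ} (hf : MemW12 m f) (hg : MemW12 m g) :
    dirichlet m (f + g) + dirichlet m (f - g) = 2 * dirichlet m f + 2 * dirichlet m g := by
  have key : ∀ u : X → ℝ, MemW12 m u → w12Norm m u ^ 2 = ∫ x, u x ^ 2 ∂m + dirichlet m u := by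
    intro u hu
    rw [w12Norm, Real.sq_sqrt (by positivity), eLpNorm_two_toReal_sq hu.1, dirichlet]
  have h := hH f g hf hg
  rw [key _ (memW12_add hm hf hg), key _ (memW12_sub hm hf hg), key _ hf, key _ hg] at h
  have i1 := (hf.1.add hg.1).integrable_sq
  have i2 := (hf.1.sub hg.1).integrable_sq
  have i3 := hf.1.integrable_sq
  have i4 := hg.1.integrable_sq
  have h2 : ∫ x, (f + g) x ^ 2 ∂m + ∫ x, (f - g) x ^ 2 ∂m
      = 2 * ∫ x, f x ^ 2 ∂m + 2 * ∫ x, g x ^ 2 ∂m := by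
    rw [← integral_add i1 i2, ← integral_const_mul, ← integral_const_mul,
      ← integral_add (i3.const_mul 2) (i4.const_mul 2)]
    refine integral_congr_ae (ae_of_all _ fun x => ?_)
    simp only [Pi.add_apply, Pi.sub_apply]
    ring
  linarith

/-- Almost optimality of the Leibniz rule for functions with small values. -/
theorem abs_relaxedSlope_mul_sq_sub_le (hm : BoundedlyFinite m) {v h : X → ℝ} (hv : MemW12 m v)
    {K : ℝ≥0} (hh : LipschitzWith K h) (h0 : ∀ y, 0 ≤ h y) (h1 : ∀ y, h y ≤ 1) :
    MemW12 m (fun x => h x * v x) ∧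
    ∀ᵐ x ∂m, |relaxedSlope m (fun x => h x * v x) x ^ 2 - h x ^ 2 * relaxedSlope m v x ^ 2|
      ≤ 2 * K * (relaxedSlope m v x * |v x|) + 3 * K ^ 2 * |v x| ^ 2 := by
  have hD := isRelaxedSlope_relaxedSlope hm hv
  have r1 := hD.mul_lipschitz hm hh h0 h1
  have hh' : LipschitzWith K fun x => 1 - h x := by
    simpa using (LipschitzWith.const (1 : ℝ)).sub hh
  have r2 := hD.mul_lipschitz hm hh' (fun y => by linarith [h1 y]) (fun y => by linarith [h0 y])
  have W1 := r1.memW12 hm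
  -- The lower bound for |D(hv)| comes from v = hv + (1-h)v: the Leibniz rule for (1-h)v leaves
  -- h|Dv| ≤ |D(hv)| + K|v|.
  have r3 := relaxedSlope_add_le hm W1 (r2.memW12 hm)
  have e : (fun x => h x * v x) + (fun x => (1 - h x) * v x) = v := by
    ext x
    simp only [Pi.add_apply]
    ring
  rw [e] at r3
  refine ⟨W1, ?_⟩
  filter_upwards [r1.relaxedSlope_le hm, r2.relaxedSlope_le hm, r3, relaxedSlope_nonneg hm W1,
    relaxedSlope_nonneg hm hv] with x h2 h3 h4 h5 h6
  set d := relaxedSlope m (fun x => h x * v x) x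
  set D := relaxedSlope m v x
  have hK : (0 : ℝ) ≤ K := K.2
  have hv0 := abs_nonneg (v x)
  have h7 : h x * D ≤ d + |v x| * K := by linarith
  have h0x := h0 x
  have h1x := h1 x
  have hvK : 0 ≤ |v x| * K := by positivity
  have hhD : 0 ≤ h x * D := by positivity
  have hhD' : h x * D ≤ D := mul_le_of_le_one_left h6 h1x
  have hprod : h x * D * (|v x| * K) ≤ D * (|v x| * K) := by gcongr
  -- With d = |D(hv)|, s = h|Dv| and r = K|v|, the numbers d and s differ by at most r. Hence d² -
  -- s² ≤ 2sr + r² and s² - d² ≤ 2dr + r² ≤ 2sr + 3r², which explains the constant 3.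
  rw [← mul_pow, abs_le]
  constructor
  · nlinarith [mul_le_mul h7 h7 hhD (by positivity), mul_le_mul_of_nonneg_right h2 hvK]
  · nlinarith [mul_le_mul h2 h2 h5 (by positivity)]

/-- Replacing `f`, `g` by sawtooth functions of them preserves the slopes of sums and
differences, up to order. -/
theorem relaxedSlope_sawtooth (hm : BoundedlyFinite m) {f g : X → ℝ} (hf : MemW12 m f)
    (hg : MemW12 m g) {a : ℝ} (ha : 0 < a) :
    ∀ᵐ x ∂m,
      relaxedSlope m ((fun x => sawtooth a (f x)) + fun x => sawtooth a (g x)) x ^ 2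
      + relaxedSlope m ((fun x => sawtooth a (f x)) - fun x => sawtooth a (g x)) x ^ 2
      = relaxedSlope m (f + g) x ^ 2 + relaxedSlope m (f - g) x ^ 2 := by
  have hS : ∀ u : X → ℝ, MemW12 m u → MemW12 m fun x => sawtooth a (u x) := fun u hu =>
    ((isRelaxedSlope_relaxedSlope hm hu).comp_lipschitz (lipschitzWith_sawtooth a)
      (sawtooth_zero a)).memW12 hm
  have hp := memW12_add hm (hS f hf) (hS g hg)
  have hq := memW12_sub hm (hS f hf) (hS g hg)
  have hfg := memW12_add hm hf hg
  have hfg' := memW12_sub hm hf hg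
  filter_upwards [relaxedSlope_eq_of_sub_eq hm hp hfg a, relaxedSlope_eq_of_sub_eq hm hp hfg' a,
    relaxedSlope_eq_of_sub_eq hm hp (memW12_neg hm hfg) a,
    relaxedSlope_eq_of_sub_eq hm hp (memW12_neg hm hfg') a,
    relaxedSlope_eq_of_sub_eq hm hq hfg a, relaxedSlope_eq_of_sub_eq hm hq hfg' a,
    relaxedSlope_eq_of_sub_eq hm hq (memW12_neg hm hfg) a,
    relaxedSlope_eq_of_sub_eq hm hq (memW12_neg hm hfg') a,
    relaxedSlope_neg hm hfg, relaxedSlope_neg hm hfg'] with x p1 p2 p3 p4 q1 q2 q3 q4 n1 n2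
  simp only [Pi.add_apply, Pi.sub_apply, Pi.neg_apply] at p1 p2 p3 p4 q1 q2 q3 q4
  -- According to the signs of the two pieces, the sum and the difference of the waves are, up to
  -- multiples of `a`, ±(f + g) and ±(f - g), possibly exchanged.
  obtain ⟨k, hk | hk⟩ := sawtooth_cases ha (f x) <;> obtain ⟨l, hl | hl⟩ := sawtooth_cases ha (g x)
  · rw [p1 (k + l) (by push_cast; linarith), q2 (k - l) (by push_cast; linarith)]
  · rw [p2 (k + l) (by push_cast; linarith), q1 (k - l) (by push_cast; linarith)]
    ring
  · rw [p4 (k + l) (by push_cast; linarith), q3 (k - l) (by push_cast; linarith), n1, n2]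
    ring
  · rw [p3 (k + l) (by push_cast; linarith), q4 (k - l) (by push_cast; linarith), n1, n2]

theorem relaxedSlope_sawtooth_eq (hm : BoundedlyFinite m) {f : X → ℝ} (hf : MemW12 m f)
    {a : ℝ} (ha : 0 < a) :
    ∀ᵐ x ∂m, relaxedSlope m (fun x => sawtooth a (f x)) x = relaxedSlope m f x := by
  have hS : MemW12 m fun x => sawtooth a (f x) :=
    ((isRelaxedSlope_relaxedSlope hm hf).comp_lipschitz (lipschitzWith_sawtooth a)
      (sawtooth_zero a)).memW12 hm
  filter_upwards [relaxedSlope_eq_of_sub_eq hm hS hf a,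
    relaxedSlope_eq_of_sub_eq hm hS (memW12_neg hm hf) a, relaxedSlope_neg hm hf] with x p1 p2 n1
  simp only [Pi.neg_apply] at p2
  obtain ⟨k, hk | hk⟩ := sawtooth_cases ha (f x)
  · exact p1 k hk
  · rw [p2 k (by linarith), n1]

/-- The integrated identity is applied to `h p` and `h q`, where `p`, `q` are triangular waves of
`f`, `g` of small amplitude. Pulling `h` out of the energies costs an error that vanishes with the
amplitude, while the slopes entering the integral do not change. -/
theorem integral_sq_mul_parallelogram (hm : BoundedlyFinite m) (hH : InfinitesimallyHilbertian m)
    {f g h : X → ℝ} (hf : MemW12 m f) (hg : MemW12 m g)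
    {K : ℝ≥0} (hh : LipschitzWith K h) (h0 : ∀ y, 0 ≤ h y) (h1 : ∀ y, h y ≤ 1) :
    ∫ x, h x ^ 2 * (relaxedSlope m (f + g) x ^ 2 + relaxedSlope m (f - g) x ^ 2
      - 2 * relaxedSlope m f x ^ 2 - 2 * relaxedSlope m g x ^ 2) ∂m = 0 := by
  set W : X → ℝ := fun x => relaxedSlope m (f + g) x ^ 2 + relaxedSlope m (f - g) x ^ 2
      - 2 * relaxedSlope m f x ^ 2 - 2 * relaxedSlope m g x ^ 2 with hW
  -- A common bound for the slopes of `p`, `q`, `p + q` and `p - q`, independent of the amplitude.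
  set Λ : X → ℝ := fun x => relaxedSlope m f x + relaxedSlope m g x with hΛ
  have hΛm : MemLp Λ 2 m := (memLp_relaxedSlope hm hf).add (memLp_relaxedSlope hm hg)
  -- A common bound for |p|, |q| and |p ± q| at amplitude 1/(n+1). The minimum with |f| + |g| puts
  -- it in L² and dominates the sequence even when `m` is infinite.
  set θ : ℕ → X → ℝ := fun n x => min (2 * (1 / ((n : ℝ) + 1))) (|f x| + |g x|) with hθ
  have hβm : MemLp (fun x => |f x| + |g x|) 2 m := hf.1.abs.add hg.1.abs
  have hθ0 : ∀ n x, 0 ≤ θ n x := fun n x => by positivity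
  have hθle : ∀ n x, θ n x ≤ |f x| + |g x| := fun n x => min_le_right _ _
  have hθm : ∀ n, MemLp (θ n) 2 m := fun n => hβm.of_le
    ((aestronglyMeasurable_const (b := 2 * (1 / ((n : ℝ) + 1)))).inf hβm.1)
    (ae_of_all _ fun x => by
      rw [Real.norm_of_nonneg (hθ0 n x), Real.norm_of_nonneg (by positivity)]
      exact hθle n x)
  have hθlim : TendstoL2 m θ atTop (fun _ => 0) := by
    refine tendstoL2_of_dominated hθm (by simp) hβm (fun n => ae_of_all _ fun x => ?_)
      (ae_of_all _ fun x => ?_)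
    · rw [abs_of_nonneg (hθ0 n x)]
      exact hθle n x
    · have hz : Tendsto (fun n : ℕ => 2 * (1 / ((n : ℝ) + 1))) atTop (𝓝 0) := by
        simpa using tendsto_one_div_add_atTop_nhds_zero_nat.const_mul (2 : ℝ)
      exact squeeze_zero (fun n => hθ0 n x) (fun n => min_le_left _ _) hz
  set R : ℕ → X → ℝ := fun n x => 2 * K * (Λ x * θ n x) + 3 * K ^ 2 * θ n x ^ 2 with hR
  have hRi : ∀ n, Integrable (R n) m := fun n =>
    ((hΛm.integrable_mul (hθm n)).const_mul _).add ((hθm n).integrable_sq.const_mul _)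
  have hRlim : Tendsto (fun n => ∫ x, R n x ∂m) atTop (𝓝 0) := by
    have hsq : Tendsto (fun n => ∫ x, θ n x ^ 2 ∂m) atTop (𝓝 0) := by
      simpa using hθlim.integral_sq hθm (by simp)
    have hpr : Tendsto (fun n => ∫ x, Λ x * θ n x ∂m) atTop (𝓝 0) := by
      have hb : Tendsto (fun n => √(∫ x, Λ x ^ 2 ∂m) * √(∫ x, θ n x ^ 2 ∂m)) atTop (𝓝 0) := by
        simpa using ((Real.continuous_sqrt.tendsto 0).comp hsq).const_mul (√(∫ x, Λ x ^ 2 ∂m))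
      refine squeeze_zero_norm (fun n => ?_) hb
      exact (norm_integral_le_integral_norm _).trans (integral_mul_le_sqrt hΛm (hθm n))
    have e : ∀ n, ∫ x, R n x ∂m = 2 * K * ∫ x, Λ x * θ n x ∂m + 3 * K ^ 2 * ∫ x, θ n x ^ 2 ∂m := by
      intro n
      rw [← integral_const_mul, ← integral_const_mul]
      exact integral_add ((hΛm.integrable_mul (hθm n)).const_mul _)
        ((hθm n).integrable_sq.const_mul _)
    simp_rw [e]
    simpa using (hpr.const_mul (2 * (K : ℝ))).add (hsq.const_mul (3 * (K : ℝ) ^ 2))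
  -- comparison of the energies of `h * v` for functions `v` with values bounded by `θ n`
  have comp : ∀ n (v : X → ℝ), MemW12 m v → (∀ x, |v x| ≤ θ n x) →
      (∀ᵐ x ∂m, relaxedSlope m v x ≤ Λ x) →
      |dirichlet m (fun x => h x * v x) - ∫ x, h x ^ 2 * relaxedSlope m v x ^ 2 ∂m|
        ≤ ∫ x, R n x ∂m := by
    intro n v hv hvθ hvΛ
    obtain ⟨W1, hae⟩ := abs_relaxedSlope_mul_sq_sub_le hm hv hh h0 h1
    have ih : Integrable (fun x => h x ^ 2 * relaxedSlope m v x ^ 2) m := by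
      refine (memLp_relaxedSlope hm hv).integrable_sq.bdd_mul (c := 1)
        ((hh.continuous.pow 2).measurable.aestronglyMeasurable) (ae_of_all _ fun x => ?_)
      rw [Real.norm_of_nonneg (sq_nonneg _)]
      exact pow_le_one₀ (h0 x) (h1 x)
    rw [dirichlet_eq_integral hm W1, ← integral_sub (memLp_relaxedSlope hm W1).integrable_sq ih]
    refine (abs_integral_le_integral_abs).trans (integral_mono_ae
      ((memLp_relaxedSlope hm W1).integrable_sq.sub ih).abs (hRi n) ?_)
    filter_upwards [hae, hvΛ, relaxedSlope_nonneg hm hv] with x hx hx' hx0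
    refine hx.trans ?_
    have := hvθ x
    have hθx := hθ0 n x
    have hΛ0 : 0 ≤ Λ x := hx0.trans hx'
    have : (0 : ℝ) ≤ K := K.2
    simp only [hR]
    gcongr
  -- The constant is 1 + 1 + 2 + 2: one error for each of `p + q` and `p - q`, two for each of `p`
  -- and `q`.
  have final : ∀ n, |∫ x, h x ^ 2 * W x ∂m| ≤ 6 * ∫ x, R n x ∂m := by
    intro n
    set a : ℝ := 1 / ((n : ℝ) + 1) with ha
    have ha0 : 0 < a := by positivity
    have hS : ∀ u : X → ℝ, MemW12 m u → MemW12 m fun x => sawtooth a (u x) := fun u hu =>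
      ((isRelaxedSlope_relaxedSlope hm hu).comp_lipschitz (lipschitzWith_sawtooth a)
        (sawtooth_zero a)).memW12 hm
    set p : X → ℝ := fun x => sawtooth a (f x) with hp
    set q : X → ℝ := fun x => sawtooth a (g x) with hq
    have Wp := hS f hf
    have Wq := hS g hg
    have Wpq := memW12_add hm Wp Wq
    have Wpq' := memW12_sub hm Wp Wq
    have bp : ∀ x, |p x| ≤ a ∧ |p x| ≤ |f x| := fun x => by
      rw [abs_of_nonneg (sawtooth_nonneg a _)]
      exact ⟨sawtooth_le ha0 _, sawtooth_le_abs _ _⟩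
    have bq : ∀ x, |q x| ≤ a ∧ |q x| ≤ |g x| := fun x => by
      rw [abs_of_nonneg (sawtooth_nonneg a _)]
      exact ⟨sawtooth_le ha0 _, sawtooth_le_abs _ _⟩
    have sp := relaxedSlope_sawtooth_eq hm hf ha0
    have sq := relaxedSlope_sawtooth_eq hm hg ha0
    have nf := relaxedSlope_nonneg hm hf
    have ng := relaxedSlope_nonneg hm hg
    have c1 := comp n (p + q) Wpq (fun x => le_min
      (by have := abs_add_le (p x) (q x); have := bp x; have := bq x; simp only [Pi.add_apply]; linarith)
      (by have := abs_add_le (p x) (q x); have := bp x; have := bq x; simp only [Pi.add_apply]; linarith))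
      (by filter_upwards [relaxedSlope_add_le hm Wp Wq, sp, sq] with x h2 h3 h4
          rw [h3, h4] at h2; exact h2)
    have c2 := comp n (p - q) Wpq' (fun x => le_min
      (by have := abs_sub (p x) (q x); have := bp x; have := bq x; simp only [Pi.sub_apply]; linarith)
      (by have := abs_sub (p x) (q x); have := bp x; have := bq x; simp only [Pi.sub_apply]; linarith))
      (by
        have h5 := relaxedSlope_add_le hm Wp (memW12_neg hm Wq)
        rw [← sub_eq_add_neg] at h5
        filter_upwards [h5, sp, sq, relaxedSlope_neg hm Wq] with x h2 h3 h4 h6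
        rw [h6, h3, h4] at h2; exact h2)
    have c3 := comp n p Wp (fun x => le_min
      (by have := bp x; linarith) (by have := bp x; have := abs_nonneg (g x); linarith))
      (by filter_upwards [sp, ng] with x h2 h3
          rw [h2]; simp only [hΛ]; linarith)
    have c4 := comp n q Wq (fun x => le_min
      (by have := bq x; linarith) (by have := bq x; have := abs_nonneg (f x); linarith))
      (by filter_upwards [sq, nf] with x h2 h3
          rw [h2]; simp only [hΛ]; linarith)
    obtain ⟨Whp, -⟩ := abs_relaxedSlope_mul_sq_sub_le hm Wp hh h0 h1
    obtain ⟨Whq, -⟩ := abs_relaxedSlope_mul_sq_sub_le hm Wq hh h0 h1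
    have par := dirichlet_parallelogram hm hH Whp Whq
    have e1 : (fun x => h x * p x) + (fun x => h x * q x) = fun x => h x * (p + q) x := by
      ext x; simp only [Pi.add_apply]; ring
    have e2 : (fun x => h x * p x) - (fun x => h x * q x) = fun x => h x * (p - q) x := by
      ext x; simp only [Pi.sub_apply]; ring
    rw [e1, e2] at par
    have ih : ∀ v : X → ℝ, MemW12 m v →
        Integrable (fun x => h x ^ 2 * relaxedSlope m v x ^ 2) m := by
      intro v hv
      refine (memLp_relaxedSlope hm hv).integrable_sq.bdd_mul (c := 1)
        ((hh.continuous.pow 2).measurable.aestronglyMeasurable) (ae_of_all _ fun x => ?_)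
      rw [Real.norm_of_nonneg (sq_nonneg _)]
      exact pow_le_one₀ (h0 x) (h1 x)
    have eW : ∫ x, h x ^ 2 * W x ∂m
        = (∫ x, h x ^ 2 * relaxedSlope m (p + q) x ^ 2 ∂m
          + ∫ x, h x ^ 2 * relaxedSlope m (p - q) x ^ 2 ∂m)
          - (2 * ∫ x, h x ^ 2 * relaxedSlope m p x ^ 2 ∂m
            + 2 * ∫ x, h x ^ 2 * relaxedSlope m q x ^ 2 ∂m) := by
      have i1 : Integrable (fun x => h x ^ 2 * relaxedSlope m (p + q) x ^ 2
          + h x ^ 2 * relaxedSlope m (p - q) x ^ 2) m := (ih _ Wpq).add (ih _ Wpq')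
      have i2 : Integrable (fun x => 2 * (h x ^ 2 * relaxedSlope m p x ^ 2)
          + 2 * (h x ^ 2 * relaxedSlope m q x ^ 2)) m :=
        ((ih _ Wp).const_mul 2).add ((ih _ Wq).const_mul 2)
      rw [← integral_add (ih _ Wpq) (ih _ Wpq'), ← integral_const_mul, ← integral_const_mul,
        ← integral_add ((ih _ Wp).const_mul 2) ((ih _ Wq).const_mul 2), ← integral_sub i1 i2]
      refine integral_congr_ae ?_
      filter_upwards [relaxedSlope_sawtooth hm hf hg ha0, sp, sq] with x h2 h3 h4
      rw [h3, h4]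
      simp only [hW]
      linear_combination (-h x ^ 2) * h2
    rw [eW]
    rw [abs_le] at c1 c2 c3 c4 ⊢
    constructor <;> linarith [c1.1, c1.2, c2.1, c2.2, c3.1, c3.2, c4.1, c4.2]
  have hz : Tendsto (fun n => 6 * ∫ x, R n x ∂m) atTop (𝓝 0) := by
    simpa using hRlim.const_mul 6
  exact abs_nonpos_iff.1 (ge_of_tendsto' hz final)

/-- In an infinitesimally Hilbertian space the parallelogram identity holds pointwise. -/
theorem relaxedSlope_parallelogram (hm : BoundedlyFinite m) (hH : InfinitesimallyHilbertian m)
    {f g : X → ℝ} (hf : MemW12 m f) (hg : MemW12 m g) :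
    ∀ᵐ x ∂m, relaxedSlope m (f + g) x ^ 2 + relaxedSlope m (f - g) x ^ 2
      = 2 * relaxedSlope m f x ^ 2 + 2 * relaxedSlope m g x ^ 2 := by
  set W : X → ℝ := fun x => relaxedSlope m (f + g) x ^ 2 + relaxedSlope m (f - g) x ^ 2
      - 2 * relaxedSlope m f x ^ 2 - 2 * relaxedSlope m g x ^ 2 with hW
  have hi : Integrable W m :=
    (((memLp_relaxedSlope hm (memW12_add hm hf hg)).integrable_sq.add
      (memLp_relaxedSlope hm (memW12_sub hm hf hg)).integrable_sq).sub
      ((memLp_relaxedSlope hm hf).integrable_sq.const_mul 2)).sub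
      ((memLp_relaxedSlope hm hg).integrable_sq.const_mul 2)
  -- The defect `W` and its opposite are both tested with squares `h²`, because energies of `h v`
  -- produce the factor `h²`.
  have h1 := ae_nonneg_of_forall_lipschitz hi two_ne_zero fun h K hK h0 h1 =>
    (integral_sq_mul_parallelogram hm hH hf hg hK h0 h1).ge
  have h2 := ae_nonneg_of_forall_lipschitz hi.neg two_ne_zero fun h K hK h0 h1 => by
    simp only [Pi.neg_apply, mul_neg, integral_neg]
    rw [integral_sq_mul_parallelogram hm hH hf hg hK h0 h1, neg_zero]
  filter_upwards [h1, h2] with x hx1 hx2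
  simp only [Pi.zero_apply, Pi.neg_apply, hW] at hx1 hx2
  linarith

/-- The pointwise parallelogram identity says that polarising with g + f and with g - f gives the
same product. This will turn upper bounds for `-g` into lower bounds for `g`. -/
theorem gradInner_neg_left (hm : BoundedlyFinite m) (hH : InfinitesimallyHilbertian m)
    {f g : X → ℝ} (hf : MemW12 m f) (hg : MemW12 m g) :
    ∀ᵐ x ∂m, gradInner m (-g) f x = -gradInner m g f x := by
  have hn := relaxedSlope_neg hm (memW12_sub hm hg hf)
  rw [show -(g - f) = -g + f by ring] at hn
  filter_upwards [relaxedSlope_parallelogram hm hH hg hf, hn, relaxedSlope_neg hm hg]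
    with x h1 h2 h3
  simp only [gradInner]
  rw [h2, h3]
  linarith

/-- The expansion of |D(g + k f)|² for natural `k` follows by induction from the parallelogram
identity, and is then rescaled by 1/(n+1). Coefficients 1/(n+1) suffice, since the perturbation only
has to tend to 0. -/
theorem relaxedSlope_add_const_mul_sq (hm : BoundedlyFinite m) (hH : InfinitesimallyHilbertian m)
    {f g : X → ℝ} (hf : MemW12 m f) (hg : MemW12 m g) (n : ℕ) :
    ∀ᵐ x ∂m, relaxedSlope m (f + fun x => ((n : ℝ) + 1)⁻¹ * g x) x ^ 2
      = relaxedSlope m f x ^ 2 + 2 * ((n : ℝ) + 1)⁻¹ * gradInner m g f x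
        + ((n : ℝ) + 1)⁻¹ ^ 2 * relaxedSlope m g x ^ 2 := by
  have hw : ∀ k : ℕ, MemW12 m (g + fun x => (k : ℝ) * f x) := fun k =>
    memW12_add hm hg (memW12_const_mul hm hf k)
  -- The parallelogram identity gives step k + 2 from steps k and k + 1, so two consecutive cases
  -- are carried along.
  have key : ∀ k : ℕ, (∀ᵐ x ∂m, relaxedSlope m (g + fun x => (k : ℝ) * f x) x ^ 2
      = relaxedSlope m g x ^ 2 + 2 * k * gradInner m g f x + (k : ℝ) ^ 2 * relaxedSlope m f x ^ 2) ∧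
      (∀ᵐ x ∂m, relaxedSlope m (g + fun x => ((k + 1 : ℕ) : ℝ) * f x) x ^ 2
      = relaxedSlope m g x ^ 2 + 2 * (k + 1 : ℕ) * gradInner m g f x
        + ((k + 1 : ℕ) : ℝ) ^ 2 * relaxedSlope m f x ^ 2) := by
    intro k
    induction k with
    | zero =>
      constructor
      · have e : (g + fun x => ((0 : ℕ) : ℝ) * f x) = g := by ext x; simp
        rw [e]
        exact ae_of_all _ fun x => by simp
      · have e : (g + fun x => ((0 + 1 : ℕ) : ℝ) * f x) = g + f := by ext x; simp
        rw [e]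
        refine ae_of_all _ fun x => ?_
        simp only [gradInner]
        push_cast
        ring
    | succ k ih =>
      refine ⟨ih.2, ?_⟩
      have hp := relaxedSlope_parallelogram hm hH (hw (k + 1)) hf
      have e1 : (g + fun x => ((k + 1 : ℕ) : ℝ) * f x) + f
          = g + fun x => ((k + 1 + 1 : ℕ) : ℝ) * f x := by
        ext x; simp only [Pi.add_apply]; push_cast; ring
      have e2 : (g + fun x => ((k + 1 : ℕ) : ℝ) * f x) - f = g + fun x => (k : ℝ) * f x := by
        ext x; simp only [Pi.add_apply, Pi.sub_apply]; push_cast; ring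
      rw [e1, e2] at hp
      filter_upwards [hp, ih.1, ih.2] with x h1 h2 h3
      rw [h2, h3] at h1
      push_cast at h1 ⊢
      linear_combination h1
  have hn : ((n : ℝ) + 1) ≠ 0 := by positivity
  have hn0 : 0 < (n : ℝ) + 1 := by positivity
  have hs := relaxedSlope_const_mul hm (hw (n + 1)) (inv_ne_zero hn)
  have e : (fun x => ((n : ℝ) + 1)⁻¹ * (g + fun x => ((n + 1 : ℕ) : ℝ) * f x) x)
      = f + fun x => ((n : ℝ) + 1)⁻¹ * g x := by
    ext x
    simp only [Pi.add_apply]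
    push_cast
    field_simp
    ring
  rw [e] at hs
  filter_upwards [hs, (key n).2] with x h1 h2
  rw [h1, mul_pow, h2, abs_of_pos (by positivity)]
  push_cast
  field_simp
  ring

end Parallelogram

end MetricSobolev

namespace MetricSobolev

/-! ### Metric derivative of absolutely continuous curves parametrised by reals. -/

section MetricDerivative

variable {X : Type*} [MetricSpace X]

theorem intervalIntegrable_mono_unit {G : ℝ → ℝ} (hG : IntervalIntegrable G volume 0 1) {s t : ℝ}
    (hs : s ∈ Icc (0 : ℝ) 1) (ht : t ∈ Icc (0 : ℝ) 1) : IntervalIntegrable G volume s t :=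
  hG.mono_set (by
    rw [uIcc_of_le zero_le_one]
    exact uIcc_subset_Icc hs ht)

theorem absolutelyContinuousOnInterval_of_dist_le {Γ : ℝ → X} {G : ℝ → ℝ}
    (hG : IntervalIntegrable G volume 0 1)
    (h : ∀ s t, 0 ≤ s → s ≤ t → t ≤ 1 → dist (Γ s) (Γ t) ≤ ∫ r in s..t, G r) :
    AbsolutelyContinuousOnInterval Γ 0 1 := by
  have hAC := hG.absolutelyContinuousOnInterval_intervalIntegral (c := 0) (by simp)
  have hle : ∀ s ∈ Icc (0 : ℝ) 1, ∀ t ∈ Icc (0 : ℝ) 1,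
      dist (Γ s) (Γ t) ≤ dist (∫ v in (0 : ℝ)..s, G v) (∫ v in (0 : ℝ)..t, G v) := by
    have key : ∀ s ∈ Icc (0 : ℝ) 1, ∀ t ∈ Icc (0 : ℝ) 1, s ≤ t →
      dist (Γ s) (Γ t) ≤ dist (∫ v in (0 : ℝ)..s, G v) (∫ v in (0 : ℝ)..t, G v) := by
      intro s hs t ht hst
      refine (h s t hs.1 hst ht.2).trans ?_
      rw [dist_comm, Real.dist_eq, intervalIntegral.integral_interval_sub_left]
      · exact le_abs_self _
      · exact intervalIntegrable_mono_unit hG (by simp) ht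
      · exact intervalIntegrable_mono_unit hG (by simp) hs
    intro s hs t ht
    rcases le_total s t with hst | hst
    · exact key s hs t ht hst
    · rw [dist_comm, dist_comm (∫ v in (0 : ℝ)..s, G v)]
      exact key t ht s hs hst
  unfold AbsolutelyContinuousOnInterval at hAC ⊢
  refine squeeze_zero' (Eventually.of_forall fun E => Finset.sum_nonneg fun _ _ => dist_nonneg)
    ?_ hAC
  rw [eventually_inf_principal]
  filter_upwards with E hE
  refine Finset.sum_le_sum fun i hi => ?_
  have := hE.1 i hi
  rw [uIcc_of_le zero_le_one] at this
  exact hle _ this.1 _ this.2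

/-- The speed is the supremum over a dense sequence x_n of |d/dt d(Γ_t, x_n)|. Each of these real
functions is absolutely continuous. Choosing x_n near Γ_s bounds d(Γ_s, Γ_t) by the integral of the
speed. The difference quotients of Γ are then at least |φ_n'| in the limit for each `n`, and at most
the speed by Lebesgue differentiation. -/
theorem exists_metricDerivative [SecondCountableTopology X] {Γ : ℝ → X} {G : ℝ → ℝ}
    (hG : IntervalIntegrable G volume 0 1)
    (h : ∀ s t, 0 ≤ s → s ≤ t → t ≤ 1 → dist (Γ s) (Γ t) ≤ ∫ r in s..t, G r) :
    ∃ v : ℝ → ℝ, (∀ t, 0 ≤ v t) ∧ IntervalIntegrable v volume 0 1 ∧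
      (∀ᵐ t, t ∈ Ioo (0 : ℝ) 1 →
        Tendsto (fun s => dist (Γ s) (Γ t) / |s - t|) (𝓝[≠] t) (𝓝 (v t))) ∧
      ∀ s t, 0 ≤ s → s ≤ t → t ≤ 1 → dist (Γ s) (Γ t) ≤ ∫ r in s..t, v r := by
  have : Nonempty X := ⟨Γ 0⟩
  set x := TopologicalSpace.denseSeq X with hx
  set φ : ℕ → ℝ → ℝ := fun n t => dist (Γ t) (x n) with hφ
  have hφΓ : ∀ n s t, |φ n s - φ n t| ≤ dist (Γ s) (Γ t) := fun n s t =>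
    abs_dist_sub_le _ _ _
  have hφG : ∀ n s t, 0 ≤ s → s ≤ t → t ≤ 1 → dist (φ n s) (φ n t) ≤ ∫ r in s..t, G r :=
    fun n s t h0 h1 h2 => (hφΓ n s t).trans (h s t h0 h1 h2)
  have hAC := fun n => absolutelyContinuousOnInterval_of_dist_le hG (hφG n)
  set v : ℝ → ℝ := fun t => ⨆ n, |deriv (φ n) t| with hv
  have hv0 : ∀ t, 0 ≤ v t := fun t => Real.iSup_nonneg fun n => abs_nonneg _
  -- Removes the order of `s` and `t` for a symmetric `q`. It is used with q = |φ_n s - φ_n t| and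
  -- `G`, then with the distance and `v`.
  have hdist : ∀ (W : ℝ → ℝ), IntervalIntegrable W volume 0 1 →
      ∀ (q : ℝ → ℝ → ℝ), (∀ s t, q s t = q t s) →
      (∀ s t, 0 ≤ s → s ≤ t → t ≤ 1 → q s t ≤ ∫ r in s..t, W r) →
      ∀ s ∈ Ioo (0 : ℝ) 1, ∀ t ∈ Ioo (0 : ℝ) 1,
        q s t ≤ |(∫ r in (0 : ℝ)..s, W r) - ∫ r in (0 : ℝ)..t, W r| := by
    intro W hW q hq hle s hs t ht
    have key : ∀ s ∈ Ioo (0 : ℝ) 1, ∀ t ∈ Ioo (0 : ℝ) 1, s ≤ t →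
        q s t ≤ |(∫ r in (0 : ℝ)..s, W r) - ∫ r in (0 : ℝ)..t, W r| := by
      intro s hs t ht hst
      refine (hle s t hs.1.le hst ht.2.le).trans ?_
      rw [abs_sub_comm, intervalIntegral.integral_interval_sub_left]
      · exact le_abs_self _
      · exact intervalIntegrable_mono_unit hW (by simp) (Ioo_subset_Icc_self ht)
      · exact intervalIntegrable_mono_unit hW (by simp) (Ioo_subset_Icc_self hs)
    rcases le_total s t with hst | hst
    · exact key s hs t ht hst
    · rw [hq, abs_sub_comm]
      exact key t ht s hs hst
  have hquot : ∀ (ψ : ℝ → ℝ) (d t : ℝ), HasDerivAt ψ d t →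
      Tendsto (fun s => |ψ s - ψ t| / |s - t|) (𝓝[≠] t) (𝓝 |d|) := by
    intro ψ d t hd
    have := (hasDerivAt_iff_tendsto_slope.1 hd).abs
    refine this.congr fun s => ?_
    rw [slope_def_field, abs_div]
  have hdiff : ∀ᵐ t, t ∈ Ioo (0 : ℝ) 1 → ∀ n, DifferentiableAt ℝ (φ n) t := by
    filter_upwards [ae_all_iff.2 fun n => (hAC n).ae_differentiableAt] with t ht hmem n
    refine ht n ?_
    rw [uIcc_of_le zero_le_one]
    exact Ioo_subset_Icc_self hmem
  have hbound : ∀ᵐ t, t ∈ Ioo (0 : ℝ) 1 → ∀ n, |deriv (φ n) t| ≤ |G t| := by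
    filter_upwards [hdiff, hG.ae_hasDerivAt_integral] with t h1 h2 hmem n
    have h3 := h2 (by rw [uIcc_of_le zero_le_one]; exact Ioo_subset_Icc_self hmem) 0 (by simp)
    refine le_of_tendsto_of_tendsto (hquot _ _ _ (h1 hmem n).hasDerivAt) (hquot _ _ _ h3) ?_
    filter_upwards [mem_nhdsWithin_of_mem_nhds (isOpen_Ioo.mem_nhds hmem)] with s hs
    have := hdist G hG (fun s t => |φ n s - φ n t|) (fun s t => abs_sub_comm _ _) (hφG n) s hs t hmem
    gcongr
  have hbdd : ∀ᵐ t, t ∈ Ioo (0 : ℝ) 1 → BddAbove (range fun n => |deriv (φ n) t|) := by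
    filter_upwards [hbound] with t ht hmem
    exact ⟨|G t|, by rintro _ ⟨n, rfl⟩; exact ht hmem n⟩
  have hae : ∀ {p : ℝ → Prop}, (∀ᵐ t, t ∈ Ioo (0 : ℝ) 1 → p t) →
      ∀ᵐ t ∂(volume.restrict (Ioc (0 : ℝ) 1)), p t := by
    intro p hp
    rw [← restrict_Ioo_eq_restrict_Ioc, ae_restrict_iff' measurableSet_Ioo]
    exact hp
  have hvm : Measurable v := Measurable.iSup fun n => (measurable_deriv (φ n)).abs
  have hvi : IntervalIntegrable v volume 0 1 := by
    rw [intervalIntegrable_iff_integrableOn_Ioc_of_le zero_le_one] at hG ⊢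
    refine Integrable.mono' hG.abs hvm.aestronglyMeasurable ?_
    filter_upwards [hae hbound] with t ht
    rw [Real.norm_of_nonneg (hv0 t)]
    exact ciSup_le ht
  have hlen : ∀ s t, 0 ≤ s → s ≤ t → t ≤ 1 → dist (Γ s) (Γ t) ≤ ∫ r in s..t, v r := by
    intro s t h0 hst h1
    have hn : ∀ n, |φ n t - φ n s| ≤ ∫ r in s..t, v r := by
      intro n
      have hsub := (hAC n).mono (c := s) (d := t) (by
        rw [uIcc_of_le zero_le_one]
        exact uIcc_subset_Icc ⟨h0, hst.trans h1⟩ ⟨h0.trans hst, h1⟩)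
      rw [← hsub.integral_deriv_eq_sub]
      refine (intervalIntegral.abs_integral_le_integral_abs hst).trans ?_
      refine intervalIntegral.integral_mono_ae_restrict hst hsub.intervalIntegrable_deriv.abs
        (intervalIntegrable_mono_unit hvi ⟨h0, hst.trans h1⟩ ⟨h0.trans hst, h1⟩) ?_
      rw [← restrict_Ioo_eq_restrict_Icc, EventuallyLE, ae_restrict_iff' measurableSet_Ioo]
      filter_upwards [hbdd] with r hr hmem
      exact le_ciSup (hr ⟨h0.trans_lt hmem.1, hmem.2.trans_le h1⟩) n
    refine le_of_forall_pos_le_add fun ε hε => ?_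
    obtain ⟨n, hn'⟩ := (TopologicalSpace.denseRange_denseSeq X).exists_dist_lt (Γ s) (half_pos hε)
    have h2 := (le_abs_self _).trans (hn n)
    simp only [hφ] at h2
    have h3 := dist_triangle (Γ s) (x n) (Γ t)
    rw [dist_comm (x n)] at h3
    linarith
  refine ⟨v, hv0, hvi, ?_, hlen⟩
  filter_upwards [hdiff, hbdd, hvi.ae_hasDerivAt_integral] with t h1 h2 h3 hmem
  have hV := h3 (by rw [uIcc_of_le zero_le_one]; exact Ioo_subset_Icc_self hmem) 0 (by simp)
  have hup := hquot _ _ _ hV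
  rw [abs_of_nonneg (hv0 t)] at hup
  rw [tendsto_order]
  constructor
  · intro a ha
    obtain ⟨n, hn⟩ := exists_lt_of_lt_ciSup ha
    filter_upwards [(hquot _ _ _ (h1 hmem n).hasDerivAt).eventually_const_lt hn] with s hs
    refine hs.trans_le ?_
    gcongr
    exact hφΓ n s t
  · intro b hb
    filter_upwards [hup.eventually_lt_const hb,
      mem_nhdsWithin_of_mem_nhds (isOpen_Ioo.mem_nhds hmem)] with s hs hs'
    refine lt_of_le_of_lt ?_ hs
    have := hdist v hvi (fun s t => dist (Γ s) (Γ t)) (fun s t => dist_comm _ _) hlen s hs' t hmem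
    gcongr

/-- The derivative of a Lipschitz function along a curve is controlled by its slope and by the
metric speed. -/
theorem abs_deriv_comp_le {Γ : ℝ → X} {u : X → ℝ} {K : ℝ≥0} (hu : LipschitzWith K u) {t v d : ℝ}
    (hΓ : ContinuousAt Γ t)
    (hv : Tendsto (fun s => dist (Γ s) (Γ t) / |s - t|) (𝓝[≠] t) (𝓝 v))
    (hd : HasDerivAt (fun s => u (Γ s)) d t) : |d| ≤ rlip u (Γ t) * v := by
  have hquot : Tendsto (fun s => |u (Γ s) - u (Γ t)| / |s - t|) (𝓝[≠] t) (𝓝 |d|) := by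
    have := (hasDerivAt_iff_tendsto_slope.1 hd).abs
    refine this.congr fun s => ?_
    rw [slope_def_field, abs_div]
  have key : ∀ ε > 0, |d| ≤ (rlip u (Γ t) + ε) * v := by
    intro ε hε
    refine le_of_tendsto_of_tendsto hquot (hv.const_mul _) ?_
    have h1 := hΓ.eventually (eventually_abs_sub_le_rlip hu (Γ t) hε)
    filter_upwards [mem_nhdsWithin_of_mem_nhds h1] with s hs
    rw [← mul_div_assoc]
    gcongr
  have hlim : Tendsto (fun n : ℕ => (rlip u (Γ t) + 1 / ((n : ℝ) + 1)) * v) atTop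
      (𝓝 ((rlip u (Γ t) + 0) * v)) :=
    (tendsto_const_nhds.add tendsto_one_div_add_atTop_nhds_zero_nat).mul_const v
  rw [add_zero] at hlim
  exact ge_of_tendsto' hlim fun n => key _ (by positivity)

end MetricDerivative

end MetricSobolev

namespace MetricSobolev

/-! ### Transfer between the unit interval as a type and as a subset of the reals. -/

section UnitInterval

theorem measurePreserving_coe_unitInterval :
    MeasurePreserving ((↑) : I → ℝ) volume (volume.restrict (Icc 0 1)) :=
  measurePreserving_subtype_coe measurableSet_Icc

theorem setIntegral_unitInterval (F : ℝ → ℝ) {s t : I} (hst : s ≤ t) :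
    ∫ r in Icc s t, F r = ∫ r in (s : ℝ)..t, F r := by
  have h := measurePreserving_coe_unitInterval.setIntegral_preimage_emb
    (MeasurableEmbedding.subtype_coe measurableSet_Icc) F (Icc (s : ℝ) t)
  have e : ((↑) : I → ℝ) ⁻¹' Icc (s : ℝ) t = Icc s t := by ext r; simp
  rw [e, Measure.restrict_restrict measurableSet_Icc,
    inter_eq_left.2 (Icc_subset_Icc s.2.1 t.2.2)] at h
  rw [h, intervalIntegral.integral_of_le (by exact_mod_cast hst), integral_Icc_eq_integral_Ioc]

theorem ae_unitInterval_of_ae_Ioo {p : ℝ → Prop} (h : ∀ᵐ t : ℝ, t ∈ Ioo (0 : ℝ) 1 → p t) :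
    ∀ᵐ t : I, (t : ℝ) ∈ Ioo (0 : ℝ) 1 ∧ p t := by
  refine measurePreserving_coe_unitInterval.quasiMeasurePreserving.ae
    (p := fun t => t ∈ Ioo (0 : ℝ) 1 ∧ p t) ?_
  rw [← restrict_Ioo_eq_restrict_Icc, ae_restrict_iff' measurableSet_Ioo]
  filter_upwards [h] with t ht hmem using ⟨hmem, ht hmem⟩

theorem intervalIntegrable_of_integrable {g : I → ℝ} (hg : Integrable g) :
    IntervalIntegrable (fun t => g (projIcc 0 1 zero_le_one t)) volume 0 1 := by
  rw [intervalIntegrable_iff_integrableOn_Icc_of_le zero_le_one, IntegrableOn,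
    ← measurePreserving_coe_unitInterval.integrable_comp_emb
      (MeasurableEmbedding.subtype_coe measurableSet_Icc)]
  refine hg.congr (ae_of_all _ fun t => ?_)
  simp

theorem integrable_of_intervalIntegrable {v : ℝ → ℝ} (hv : IntervalIntegrable v volume 0 1) :
    Integrable (fun t : I => v t) := by
  rw [intervalIntegrable_iff_integrableOn_Icc_of_le zero_le_one, IntegrableOn,
    ← measurePreserving_coe_unitInterval.integrable_comp_emb
      (MeasurableEmbedding.subtype_coe measurableSet_Icc)] at hv
  exact hv

end UnitInterval

/-! ### Speed and energy of curves, and increments of Lipschitz functions along them. -/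

section Curves

variable {X : Type*} [MetricSpace X]

/-- The upper metric speed of a curve. -/
noncomputable def upperSpeed (γ : C(I, X)) (t : I) : ℝ≥0∞ :=
  limsup (fun s => edist (γ s) (γ t) / edist s t) (𝓝[≠] t)

theorem metricSpeed_eq_of_tendsto {γ : C(I, X)} {t : I} {v : ℝ}
    (h : Tendsto (fun s : I => dist (γ s) (γ t) / dist s t) (𝓝[≠] t) (𝓝 v)) :
    metricSpeed γ t = v := by
  have hex : ∃ v : ℝ, Tendsto (fun s : I => dist (γ s) (γ t) / dist s t) (𝓝[≠] t) (𝓝 v) := ⟨v, h⟩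
  rw [metricSpeed, dif_pos hex]
  exact tendsto_nhds_unique hex.choose_spec h

theorem upperSpeed_eq_of_tendsto {γ : C(I, X)} {t : I} {v : ℝ}
    (h : Tendsto (fun s : I => dist (γ s) (γ t) / dist s t) (𝓝[≠] t) (𝓝 v)) :
    upperSpeed γ t = ENNReal.ofReal v := by
  have h1 := ENNReal.tendsto_ofReal h
  rw [upperSpeed, ← h1.limsup_eq]
  refine limsup_congr ?_
  filter_upwards [self_mem_nhdsWithin] with s hs
  rw [edist_dist, edist_dist, ENNReal.ofReal_div_of_pos (dist_pos.2 hs)]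

/-- Existence of the metric derivative of absolutely continuous curves. -/
theorem IsAC.exists_speed [SecondCountableTopology X] {γ : C(I, X)} (h : IsAC γ) :
    ∃ v : ℝ → ℝ, (∀ t, 0 ≤ v t) ∧ IntervalIntegrable v volume 0 1 ∧
      (∀ᵐ t : ℝ, t ∈ Ioo (0 : ℝ) 1 →
        Tendsto (fun s => dist (γ (projIcc 0 1 zero_le_one s)) (γ (projIcc 0 1 zero_le_one t))
          / |s - t|) (𝓝[≠] t) (𝓝 (v t))) ∧
      (∀ s t : ℝ, 0 ≤ s → s ≤ t → t ≤ 1 → dist (γ (projIcc 0 1 zero_le_one s))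
        (γ (projIcc 0 1 zero_le_one t)) ≤ ∫ r in s..t, v r) ∧
      (∀ᵐ t : I, metricSpeed γ t = v t ∧ upperSpeed γ t = ENNReal.ofReal (v t)) := by
  obtain ⟨g, hg, hle⟩ := h
  have hG := intervalIntegrable_of_integrable hg
  obtain ⟨v, hv0, hvi, hvt, hvd⟩ := exists_metricDerivative
    (Γ := fun t => γ (projIcc 0 1 zero_le_one t)) hG (fun s t h0 hst h1 => by
      rcases hst.eq_or_lt with rfl | hlt
      · simp
      have hs : s ∈ Icc (0 : ℝ) 1 := ⟨h0, hst.trans h1⟩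
      have ht : t ∈ Icc (0 : ℝ) 1 := ⟨h0.trans hst, h1⟩
      have := hle ⟨s, hs⟩ ⟨t, ht⟩ hlt
      rw [dist_comm, projIcc_of_mem _ hs, projIcc_of_mem _ ht]
      refine this.trans (le_of_eq ?_)
      rw [← setIntegral_unitInterval (fun r => g (projIcc 0 1 zero_le_one r))
        (s := ⟨s, hs⟩) (t := ⟨t, ht⟩) hst]
      simp)
  refine ⟨v, hv0, hvi, hvt, hvd, ?_⟩
  filter_upwards [ae_unitInterval_of_ae_Ioo hvt] with t ht
  have hval : Tendsto ((↑) : I → ℝ) (𝓝[≠] t) (𝓝[≠] (t : ℝ)) :=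
    (continuous_subtype_val.tendsto t).inf (tendsto_principal_principal.2 fun s hs h =>
      hs (Subtype.ext h))
  have hT : Tendsto (fun s : I => dist (γ s) (γ t) / dist s t) (𝓝[≠] t) (𝓝 (v t)) := by
    refine (ht.2.comp hval).congr fun s => ?_
    simp [Function.comp, Subtype.dist_eq, Real.dist_eq]
  exact ⟨metricSpeed_eq_of_tendsto hT, upperSpeed_eq_of_tendsto hT⟩

theorem IsAC2.integrable_sq {γ : C(I, X)} (h : IsAC2 γ) :
    Integrable (fun s => metricSpeed γ s ^ 2) := h.2.integrable_sq

/-- E_{2,t}/t is the root mean square of the speed on [0, t]; on AC² curves all quantities are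
finite, so passing to real values loses nothing. -/
theorem energy_div_sq {γ : C(I, X)} (h : IsAC2 γ) [SecondCountableTopology X] {t : I}
    (ht : 0 < t) :
    ((energy t γ).toReal / (t : ℝ)) ^ 2 = (t : ℝ)⁻¹ * ∫ s in Icc 0 t, metricSpeed γ s ^ 2 := by
  have ht0 : (0 : ℝ) < t := ht
  obtain ⟨v, hv0, -, -, -, hae⟩ := h.1.exists_speed
  have hlin : ∫⁻ s in Icc 0 t, ENNReal.ofReal (metricSpeed γ s) ^ 2
      = ENNReal.ofReal (∫ s in Icc 0 t, metricSpeed γ s ^ 2) := by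
    rw [ofReal_integral_eq_lintegral_ofReal h.integrable_sq.integrableOn
      (ae_of_all _ fun x => sq_nonneg _)]
    refine lintegral_congr_ae (ae_restrict_of_ae ?_)
    filter_upwards [hae] with s hs
    rw [hs.1, ENNReal.ofReal_pow (hv0 s)]
  have hnn : 0 ≤ ∫ s in Icc 0 t, metricSpeed γ s ^ 2 := integral_nonneg fun s => sq_nonneg _
  rw [energy, if_pos h, setLAverage_eq, hlin, unitInterval.volume_Icc]
  simp only [Set.Icc.coe_zero, sub_zero]
  rw [← ENNReal.ofReal_div_of_pos ht0, ENNReal.toReal_mul, ENNReal.toReal_ofReal ht0.le,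
    ← ENNReal.toReal_rpow, ENNReal.toReal_ofReal (by positivity), ← Real.sqrt_eq_rpow,
    mul_div_cancel_left₀ _ ht0.ne', Real.sq_sqrt (by positivity), div_eq_inv_mul]

/-- Zero energy forces zero speed a.e. on [0, t]. This justifies the convention 0/0 = 0 in the
quotient by the energy. -/
theorem eq_of_energy_eq_zero {γ : C(I, X)} (h : IsAC2 γ) [SecondCountableTopology X] {t : I}
    (ht : 0 < t) (h0 : (energy t γ).toReal = 0) : γ t = γ 0 := by
  have ht0 : (0 : ℝ) < t := ht
  have h1 := energy_div_sq h ht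
  rw [h0] at h1
  obtain ⟨v, hv0, -, -, hd, hae⟩ := h.1.exists_speed
  have h2 : ∫ s in Icc 0 t, metricSpeed γ s ^ 2 = 0 := by
    have : (t : ℝ)⁻¹ ≠ 0 := by positivity
    simpa [this] using h1.symm
  rw [integral_eq_zero_iff_of_nonneg (fun s => sq_nonneg _) h.integrable_sq.integrableOn] at h2
  have h3 := hd 0 t le_rfl ht0.le t.2.2
  rw [projIcc_val, projIcc_left] at h3
  have h4 := setIntegral_unitInterval v ht.le
  rw [Set.Icc.coe_zero] at h4
  rw [← h4, integral_eq_zero_of_ae] at h3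
  · rw [dist_comm] at h3
    exact dist_le_zero.1 h3
  · filter_upwards [h2, ae_restrict_of_ae hae] with s hs hs'
    rw [← hs'.1]
    simpa using hs

/-- Integrates |d/ds u(γ_s)| ≤ lip u(γ_s) |γ'_s| ≤ ½ lip u(γ_s)² + ½ |γ'_s|² over [0, t]; the last
term of the statement is ½ ∫_0^t |γ'_s|² ds. -/
theorem abs_sub_le_of_isAC2 [SecondCountableTopology X] [MeasurableSpace X]
    [BorelSpace X] {γ : C(I, X)} (h : IsAC2 γ) {t : I} (ht : 0 < t) {u : X → ℝ} {K : ℝ≥0}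
    (hu : LipschitzWith K u) :
    |u (γ t) - u (γ 0)| ≤ 2⁻¹ * (∫ s in Icc 0 t, rlip u (γ s) ^ 2)
      + 2⁻¹ * t * ((energy t γ).toReal / (t : ℝ)) ^ 2 := by
  have ht0 : (0 : ℝ) < t := ht
  obtain ⟨v, hv0, hvi, hvt, hd, hae⟩ := h.1.exists_speed
  set Γ : ℝ → X := fun s => γ (projIcc 0 1 zero_le_one s) with hΓ
  have hΓc : Continuous Γ := γ.continuous.comp continuous_projIcc
  have hψ : AbsolutelyContinuousOnInterval (fun s => u (Γ s)) 0 1 :=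
    absolutelyContinuousOnInterval_of_dist_le (hvi.const_mul K) fun s r h0 hsr h1 => by
      rw [intervalIntegral.integral_const_mul]
      exact (hu.dist_le_mul _ _).trans (by gcongr; exact hd s r h0 hsr h1)
  have hψt := hψ.mono (c := 0) (d := t) (by
    rw [uIcc_of_le zero_le_one, uIcc_of_le ht0.le]
    exact Icc_subset_Icc le_rfl t.2.2)
  have hv2 : IntervalIntegrable (fun s => v s ^ 2) volume 0 1 := by
    have hi : Integrable (fun s : I => v s ^ 2) := h.integrable_sq.congr (by
      filter_upwards [hae] with s hs
      rw [hs.1])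
    rw [intervalIntegrable_iff_integrableOn_Icc_of_le zero_le_one, IntegrableOn,
      ← measurePreserving_coe_unitInterval.integrable_comp_emb
        (MeasurableEmbedding.subtype_coe measurableSet_Icc)]
    exact hi
  have hr2 : IntervalIntegrable (fun s => rlip u (Γ s) ^ 2) volume 0 1 := by
    rw [intervalIntegrable_iff_integrableOn_Icc_of_le zero_le_one]
    refine Measure.integrableOn_of_bounded (M := (K : ℝ) ^ 2) (by simp)
      (((measurable_rlip hu.continuous).comp hΓc.measurable).pow_const 2).aestronglyMeasurable
      (ae_of_all _ fun s => ?_)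
    rw [Real.norm_of_nonneg (sq_nonneg _)]
    exact pow_le_pow_left₀ (rlip_nonneg _ _) (rlip_le_of_lipschitzWith hu _) 2
  have hmem : (t : ℝ) ∈ Icc (0 : ℝ) 1 := t.2
  have hv2t := intervalIntegrable_mono_unit hv2 (s := 0) (by simp) hmem
  have hr2t := intervalIntegrable_mono_unit hr2 (s := 0) (by simp) hmem
  have e1 : ∫ s in Icc 0 t, rlip u (γ s) ^ 2 = ∫ s in (0 : ℝ)..t, rlip u (Γ s) ^ 2 := by
    have := setIntegral_unitInterval (fun s => rlip u (Γ s) ^ 2) ht.le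
    simp only [hΓ, projIcc_val, Set.Icc.coe_zero] at this
    exact this
  have e2 : ∫ s in Icc 0 t, metricSpeed γ s ^ 2 = ∫ s in (0 : ℝ)..t, v s ^ 2 := by
    have := setIntegral_unitInterval (fun s => v s ^ 2) ht.le
    rw [Set.Icc.coe_zero] at this
    rw [← this]
    refine integral_congr_ae (ae_restrict_of_ae ?_)
    filter_upwards [hae] with s hs
    rw [hs.1]
  rw [energy_div_sq h ht, mul_assoc, mul_inv_cancel_left₀ ht0.ne', e1, e2,
    ← intervalIntegral.integral_const_mul, ← intervalIntegral.integral_const_mul,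
    ← intervalIntegral.integral_add (hr2t.const_mul _) (hv2t.const_mul _)]
  have e3 : u (γ t) - u (γ 0) = ∫ s in (0 : ℝ)..t, deriv (fun s => u (Γ s)) s := by
    rw [hψt.integral_deriv_eq_sub]
    simp only [hΓ, projIcc_val, projIcc_left]
    rfl
  rw [e3]
  refine (intervalIntegral.abs_integral_le_integral_abs ht0.le).trans ?_
  refine intervalIntegral.integral_mono_ae_restrict ht0.le hψt.intervalIntegrable_deriv.abs
    ((hr2t.const_mul _).add (hv2t.const_mul _)) ?_
  rw [← restrict_Ioo_eq_restrict_Icc, EventuallyLE, ae_restrict_iff' measurableSet_Ioo]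
  filter_upwards [hvt, hψ.ae_differentiableAt] with s h1 h2 hs
  have hs' : s ∈ Ioo (0 : ℝ) 1 := ⟨hs.1, hs.2.trans_le t.2.2⟩
  have h3 := abs_deriv_comp_le hu hΓc.continuousAt (h1 hs')
    (h2 (by rw [uIcc_of_le zero_le_one]; exact Ioo_subset_Icc_self hs')).hasDerivAt
  refine h3.trans ?_
  nlinarith [sq_nonneg (rlip u (Γ s) - v s)]

end Curves

/-! ### Measurability of the energy on the space of curves. -/

section Measurability

variable {X : Type*} [MetricSpace X] [SecondCountableTopology X] [MeasurableSpace C(I, X)]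
  [BorelSpace C(I, X)]

/-- The upper speed replaces the metric speed because, as a limsup, it is visibly measurable in
curve and time together; the two agree a.e. in time on absolutely continuous curves. -/
theorem measurable_upperSpeed : Measurable fun p : C(I, X) × I => upperSpeed p.1 p.2 := by
  refine measurable_limsup_nhdsNE (P := C(I, X) × I) (Y := I) (a := Prod.snd) continuous_snd
    (k := fun p s => edist (p.1 s) (p.1 p.2) / edist s p.2) fun p y hne => ?_
  have h1 : ContinuousAt (fun p : C(I, X) × I => edist (p.1 y) (p.1 p.2)) p := by fun_prop
  have h2 : ContinuousAt (fun p : C(I, X) × I => edist y p.2) p := by fun_prop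
  exact ENNReal.Tendsto.div h1 (Or.inr (by simpa using hne)) h2 (Or.inr (edist_ne_top _ _))

theorem IsAC.ofReal_metricSpeed {γ : C(I, X)} (h : IsAC γ) :
    ∀ᵐ s : I, ENNReal.ofReal (metricSpeed γ s) = upperSpeed γ s ∧ 0 ≤ metricSpeed γ s := by
  obtain ⟨v, hv0, -, -, -, hae⟩ := h.exists_speed
  filter_upwards [hae] with s hs
  rw [hs.1, hs.2]
  exact ⟨rfl, hv0 s⟩

/-- Being AC² becomes countably many measurable conditions on `γ`: the upper speed itself can serve
as the bounding function, and it is enough to test a dense sequence of times. -/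
theorem isAC2_iff {γ : C(I, X)} : IsAC2 γ ↔ ∫⁻ s, upperSpeed γ s ^ 2 < ∞ ∧
    ∀ n k : ℕ, edist (γ (TopologicalSpace.denseSeq I n)) (γ (TopologicalSpace.denseSeq I k)) ≤
      ∫⁻ r in uIcc (TopologicalSpace.denseSeq I n) (TopologicalSpace.denseSeq I k),
        upperSpeed γ r := by
  have hm : Measurable (upperSpeed γ) :=
    Measurable.comp (f := fun s : I => (γ, s)) (g := fun p : C(I, X) × I => upperSpeed p.1 p.2)
      measurable_upperSpeed measurable_prodMk_left
  constructor
  · intro h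
    obtain ⟨v, hv0, hvi, -, hd, hae⟩ := h.1.exists_speed
    constructor
    · have h1 : ∫⁻ s, upperSpeed γ s ^ 2 = ∫⁻ s, ‖metricSpeed γ s‖ₑ ^ 2 := by
        refine lintegral_congr_ae ?_
        filter_upwards [h.1.ofReal_metricSpeed] with s hs
        rw [← hs.1, Real.enorm_eq_ofReal hs.2]
      rw [h1, lintegral_enorm_sq_eq h.2]
      exact ENNReal.ofReal_lt_top
    · have key : ∀ s t : I, s ≤ t → edist (γ s) (γ t) ≤ ∫⁻ r in Icc s t, upperSpeed γ r := by
        intro s t hst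
        have h2 := hd s t s.2.1 hst t.2.2
        rw [projIcc_val, projIcc_val, ← setIntegral_unitInterval v hst] at h2
        rw [edist_dist]
        refine (ENNReal.ofReal_le_ofReal h2).trans (le_of_eq ?_)
        rw [ofReal_integral_eq_lintegral_ofReal (integrable_of_intervalIntegrable hvi).integrableOn
          (ae_of_all _ fun s => hv0 s)]
        refine lintegral_congr_ae (ae_restrict_of_ae ?_)
        filter_upwards [hae] with r hr using hr.2.symm
      intro n k
      rcases le_total (TopologicalSpace.denseSeq I n) (TopologicalSpace.denseSeq I k) with hle | hle
      · rw [uIcc_of_le hle]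
        exact key _ _ hle
      · rw [uIcc_of_ge hle, edist_comm]
        exact key _ _ hle
  · rintro ⟨hfin, hle⟩
    have hfin1 : ∫⁻ s, upperSpeed γ s < ∞ := by
      have : ∫⁻ s, upperSpeed γ s ≤ ∫⁻ s : I, (1 + upperSpeed γ s ^ 2) := by
        refine lintegral_mono fun s => ?_
        rcases le_total (upperSpeed γ s) 1 with h | h
        · exact h.trans le_self_add
        · exact (le_self_pow₀ h two_ne_zero).trans le_add_self
      refine this.trans_lt ?_
      rw [lintegral_add_left measurable_const]
      simpa using hfin
    have hlt := ae_lt_top hm hfin1.ne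
    have hint : Integrable fun s => (upperSpeed γ s).toReal :=
      integrable_toReal_of_lintegral_ne_top hm.aemeasurable hfin1.ne
    have hAC : IsAC γ := by
      refine ⟨fun s => (upperSpeed γ s).toReal, hint, fun s t hst => ?_⟩
      have hC : ∫⁻ r in Icc s t, upperSpeed γ r ≠ ∞ :=
        ((setLIntegral_le_lintegral _ _).trans_lt hfin1).ne
      rw [integral_toReal hm.aemeasurable (ae_restrict_of_ae hlt), dist_comm, dist_edist]
      refine ENNReal.toReal_mono hC ?_
      -- Keeping the interval [s, t] fixed on the right makes the condition closed, so it passes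
      -- from dense times inside (s, t) to the endpoints.
      set S : Set (I × I) := {p | edist (γ p.1) (γ p.2) ≤ ∫⁻ r in Icc s t, upperSpeed γ r} with hS
      have hSc : IsClosed S := isClosed_le (by fun_prop) continuous_const
      set D : Set I := Ioo s t ∩ range (TopologicalSpace.denseSeq I) with hD
      have hsub : D ×ˢ D ⊆ S := by
        rintro ⟨_, _⟩ ⟨⟨h1, n, rfl⟩, ⟨h2, k, rfl⟩⟩
        refine (hle n k).trans (lintegral_mono_set ?_)
        exact uIcc_subset_Icc (Ioo_subset_Icc_self h1) (Ioo_subset_Icc_self h2)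
      have hcl : Icc s t ⊆ closure D := by
        rw [← closure_Ioo hst.ne]
        exact closure_minimal ((TopologicalSpace.denseRange_denseSeq I).open_subset_closure_inter
          isOpen_Ioo) isClosed_closure
      have h3 : closure (D ×ˢ D) ⊆ S := closure_minimal hsub hSc
      rw [closure_prod_eq] at h3
      exact h3 (show (s, t) ∈ closure D ×ˢ closure D from
        ⟨hcl (left_mem_Icc.2 hst.le), hcl (right_mem_Icc.2 hst.le)⟩)
    refine ⟨hAC, ?_, ?_⟩
    · refine hm.ennreal_toReal.aestronglyMeasurable.congr ?_
      filter_upwards [hAC.ofReal_metricSpeed] with s hs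
      rw [← hs.1, ENNReal.toReal_ofReal hs.2]
    · have h1 : eLpNorm (metricSpeed γ) 2 volume ^ 2 < ∞ := by
        rw [eLpNorm_two_sq]
        refine lt_of_eq_of_lt (lintegral_congr_ae ?_) hfin
        filter_upwards [hAC.ofReal_metricSpeed] with s hs
        rw [← hs.1, Real.enorm_eq_ofReal hs.2]
      by_contra hc
      rw [not_lt, top_le_iff] at hc
      simp [hc] at h1

theorem measurableSet_isAC2 : MeasurableSet {γ : C(I, X) | IsAC2 γ} := by
  have hset : {γ : C(I, X) | IsAC2 γ} = {γ | ∫⁻ s, upperSpeed γ s ^ 2 < ∞} ∩ ⋂ n : ℕ, ⋂ k : ℕ,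
      {γ | edist (γ (TopologicalSpace.denseSeq I n)) (γ (TopologicalSpace.denseSeq I k)) ≤
      ∫⁻ r in uIcc (TopologicalSpace.denseSeq I n) (TopologicalSpace.denseSeq I k),
        upperSpeed γ r} := by
    ext γ
    simp [isAC2_iff]
  rw [hset]
  refine MeasurableSet.inter ?_ (MeasurableSet.iInter fun n => MeasurableSet.iInter fun k => ?_)
  · exact measurableSet_lt (measurable_upperSpeed.pow_const 2).lintegral_prod_right' measurable_const
  · refine measurableSet_le (Continuous.measurable (by fun_prop)) ?_
    exact measurable_upperSpeed.lintegral_prod_right'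

theorem measurable_energy (t : I) : Measurable (energy t : C(I, X) → ℝ≥0∞) := by
  classical
  have h : (energy t : C(I, X) → ℝ≥0∞) = fun γ => if IsAC2 γ then
      ENNReal.ofReal t * (⨍⁻ s in Icc 0 t, upperSpeed γ s ^ 2 ∂volume) ^ (1 / 2 : ℝ) else ∞ := by
    ext γ
    by_cases hγ : IsAC2 γ
    · simp only [energy, if_pos hγ, setLAverage_eq]
      congr 3
      refine lintegral_congr_ae (ae_restrict_of_ae ?_)
      filter_upwards [hγ.1.ofReal_metricSpeed] with s hs
      rw [hs.1]
    · simp [energy, if_neg hγ]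
  rw [h]
  refine Measurable.ite measurableSet_isAC2 ?_ measurable_const
  simp only [setLAverage_eq]
  refine ((Measurable.div_const ?_ _).pow_const _).const_mul _
  exact (measurable_upperSpeed.pow_const 2).lintegral_prod_right'

end Measurability

end MetricSobolev

namespace MetricSobolev

/-! ### Strong convergence in L¹ and products. -/

section L1

variable {α ι : Type*} [MeasurableSpace α] {μ : Measure α}

/-- Strong convergence in `L¹(μ)` along a filter. -/
def TendstoL1 (μ : Measure α) (u : ι → α → ℝ) (l : Filter ι) (f : α → ℝ) : Prop :=
  Tendsto (fun i => eLpNorm (fun x => u i x - f x) 1 μ) l (𝓝 0)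

theorem eLpNorm_mul_le (a b : α → ℝ) (ha : AEStronglyMeasurable a μ)
    (hb : AEStronglyMeasurable b μ) :
    eLpNorm (fun x => a x * b x) 1 μ ≤ eLpNorm a 2 μ * eLpNorm b 2 μ := by
  have h : eLpNorm (a • b) 1 μ ≤ eLpNorm a 2 μ * eLpNorm b 2 μ :=
    eLpNorm_smul_le_mul_eLpNorm hb ha
  exact h

theorem TendstoL2.mul {a b : ι → α → ℝ} {l : Filter ι} {A B : α → ℝ}
    (ha : TendstoL2 μ a l A) (hb : TendstoL2 μ b l B)
    (ham : ∀ i, AEStronglyMeasurable (a i) μ) (hbm : ∀ i, AEStronglyMeasurable (b i) μ)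
    (hA : MemLp A 2 μ) (hB : MemLp B 2 μ) :
    TendstoL1 μ (fun i x => a i x * b i x) l (fun x => A x * B x) := by
  have hlim : Tendsto (fun i => eLpNorm (fun x => a i x - A x) 2 μ * eLpNorm (fun x => b i x - B x) 2 μ
      + eLpNorm A 2 μ * eLpNorm (fun x => b i x - B x) 2 μ
      + eLpNorm (fun x => a i x - A x) 2 μ * eLpNorm B 2 μ) l (𝓝 (0 * 0 + eLpNorm A 2 μ * 0
      + 0 * eLpNorm B 2 μ)) :=
    ((ENNReal.Tendsto.mul ha (Or.inr ENNReal.zero_ne_top) hb (Or.inr ENNReal.zero_ne_top)).add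
      (ENNReal.Tendsto.const_mul hb (Or.inr hA.2.ne))).add
      (ENNReal.Tendsto.mul_const ha (Or.inr hB.2.ne))
  simp only [mul_zero, zero_mul, add_zero] at hlim
  refine tendsto_of_tendsto_of_tendsto_of_le_of_le tendsto_const_nhds hlim (fun i => zero_le)
    fun i => ?_
  have hda := (ham i).sub hA.1
  have hdb := (hbm i).sub hB.1
  have e : (fun x => a i x * b i x - A x * B x) = (fun x => (a i x - A x) * (b i x - B x))
      + (fun x => A x * (b i x - B x)) + (fun x => (a i x - A x) * B x) := by
    ext x
    simp only [Pi.add_apply]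
    ring
  simp only [e]
  refine (eLpNorm_add_le ((hda.mul hdb).add (hA.1.mul hdb)) (hda.mul hB.1) le_rfl).trans ?_
  gcongr
  · refine (eLpNorm_add_le (hda.mul hdb) (hA.1.mul hdb) le_rfl).trans ?_
    gcongr
    · exact eLpNorm_mul_le _ _ hda hdb
    · exact eLpNorm_mul_le _ _ hA.1 hdb
  · exact eLpNorm_mul_le _ _ hda hB.1

/-- Integration against a bounded function is continuous for strong `L¹`-convergence. -/
theorem TendstoL1.integral_mul {u : ι → α → ℝ} {l : Filter ι} {f h : α → ℝ}
    (hu : TendstoL1 μ u l f) (hum : ∀ i, AEStronglyMeasurable (u i) μ) (hf : Integrable f μ)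
    (hh : AEStronglyMeasurable h μ) {M : ℝ} (hM : ∀ᵐ x ∂μ, |h x| ≤ M) :
    Tendsto (fun i => ∫ x, h x * u i x ∂μ) l (𝓝 (∫ x, h x * f x ∂μ)) := by
  have hu' : Tendsto _ _ _ := hu
  refine tendsto_integral_of_L1' _ (hh.mul hf.1) ?_ ?_
  · filter_upwards [hu'.eventually_lt_const ENNReal.zero_lt_top] with i hi
    have h1 : Integrable (fun x => u i x - f x) μ :=
      memLp_one_iff_integrable.1 ⟨(hum i).sub hf.1, hi⟩
    have h2 : Integrable (u i) μ := by
      refine (h1.add hf).congr (ae_of_all _ fun x => ?_)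
      simp
    exact h2.bdd_mul (c := M) hh (by simpa using hM)
  · have h3 := ENNReal.Tendsto.const_mul (a := ENNReal.ofReal M) hu (Or.inr ENNReal.ofReal_ne_top)
    rw [mul_zero] at h3
    refine tendsto_of_tendsto_of_tendsto_of_le_of_le tendsto_const_nhds h3 (fun i => zero_le)
      fun i => ?_
    refine eLpNorm_le_mul_eLpNorm_of_ae_le_mul (c := M) ?_ 1
    filter_upwards [hM] with x hx
    simp only [Pi.sub_apply, Pi.mul_apply]
    rw [← mul_sub, norm_mul]
    gcongr
    exact hx

theorem TendstoL2.tendstoL1 [IsProbabilityMeasure μ] {u : ι → α → ℝ} {l : Filter ι} {f : α → ℝ}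
    (hu : TendstoL2 μ u l f) (hum : ∀ i, AEStronglyMeasurable (u i) μ)
    (hf : AEStronglyMeasurable f μ) : TendstoL1 μ u l f :=
  tendsto_of_tendsto_of_tendsto_of_le_of_le tendsto_const_nhds hu (fun i => zero_le) fun i =>
    eLpNorm_le_eLpNorm_of_exponent_le (by norm_num) ((hum i).sub hf)

end L1

/-! ### Pulling back along maps of bounded compression. -/

section Compression

variable {X Ω : Type*} [MeasurableSpace X] [MeasurableSpace Ω] {m : Measure X} {μ : Measure Ω}
  {e : Ω → X} {C : ℝ≥0}

theorem ae_comp_of_map_le (he : Measurable e) (hle : μ.map e ≤ C • m) {p : X → Prop}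
    (hp : ∀ᵐ x ∂m, p x) : ∀ᵐ ω ∂μ, p (e ω) := by
  have h1 : μ.map e ≪ m :=
    (Measure.absolutelyContinuous_of_le hle).trans Measure.smul_absolutelyContinuous
  exact ae_of_ae_map he.aemeasurable (h1.ae_le hp)

theorem aestronglyMeasurable_comp_of_map_le (he : Measurable e) (hle : μ.map e ≤ C • m)
    {w : X → ℝ} (hw : AEStronglyMeasurable w m) : AEStronglyMeasurable (fun ω => w (e ω)) μ := by
  have h1 : μ.map e ≪ m :=
    (Measure.absolutelyContinuous_of_le hle).trans Measure.smul_absolutelyContinuous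
  exact (hw.mono_ac h1).comp_aemeasurable he.aemeasurable

theorem eLpNorm_comp_le_of_map_le (he : Measurable e) (hle : μ.map e ≤ C • m)
    {w : X → ℝ} (hw : AEStronglyMeasurable w m) {p : ℝ≥0∞} (hp : p ≠ ∞) :
    eLpNorm (fun ω => w (e ω)) p μ ≤ ((C ^ p.toReal⁻¹ : ℝ≥0) : ℝ≥0∞) * eLpNorm w p m := by
  have h1 : μ.map e ≪ m :=
    (Measure.absolutelyContinuous_of_le hle).trans Measure.smul_absolutelyContinuous
  have h2 := eLpNorm_map_measure (p := p) (hw.mono_ac h1) he.aemeasurable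
  change eLpNorm (w ∘ e) p μ ≤ _
  rw [← h2]
  refine (eLpNorm_mono_measure w hle).trans (le_of_eq ?_)
  rw [eLpNorm_smul_measure_of_ne_top' hp]
  rfl

theorem memLp_comp_of_map_le (he : Measurable e) (hle : μ.map e ≤ C • m)
    {w : X → ℝ} {p : ℝ≥0∞} (hp : p ≠ ∞) (hw : MemLp w p m) : MemLp (fun ω => w (e ω)) p μ :=
  ⟨aestronglyMeasurable_comp_of_map_le he hle hw.1,
    (eLpNorm_comp_le_of_map_le he hle hw.1 hp).trans_lt
      (ENNReal.mul_lt_top ENNReal.coe_lt_top hw.2)⟩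

theorem integrable_comp_of_map_le (he : Measurable e) (hle : μ.map e ≤ C • m)
    {w : X → ℝ} (hw : Integrable w m) : Integrable (fun ω => w (e ω)) μ :=
  memLp_one_iff_integrable.1
    (memLp_comp_of_map_le he hle ENNReal.one_ne_top (memLp_one_iff_integrable.2 hw))

theorem tendsto_eLpNorm_comp_of_map_le (he : Measurable e) (hle : μ.map e ≤ C • m)
    {ι : Type*} {l : Filter ι} {u : ι → X → ℝ} {f : X → ℝ} {p : ℝ≥0∞} (hp : p ≠ ∞)
    (hu : ∀ i, AEStronglyMeasurable (u i) m) (hf : AEStronglyMeasurable f m)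
    (h : Tendsto (fun i => eLpNorm (fun x => u i x - f x) p m) l (𝓝 0)) :
    Tendsto (fun i => eLpNorm (fun ω => u i (e ω) - f (e ω)) p μ) l (𝓝 0) := by
  have h3 := ENNReal.Tendsto.const_mul (a := ((C ^ p.toReal⁻¹ : ℝ≥0) : ℝ≥0∞)) h
    (Or.inr ENNReal.coe_ne_top)
  rw [mul_zero] at h3
  exact tendsto_of_tendsto_of_tendsto_of_le_of_le tendsto_const_nhds h3 (fun i => zero_le)
    fun i => eLpNorm_comp_le_of_map_le he hle ((hu i).sub hf) hp

end Compression

/-! ### Evaluation along test plans and short-time averages. -/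

section Plans

variable {X : Type*} [MetricSpace X] [SecondCountableTopology X] [MeasurableSpace X] [BorelSpace X]
  [MeasurableSpace C(I, X)] [BorelSpace C(I, X)] {m : Measure X} {π : Measure C(I, X)}

theorem measurable_eval_at (t : I) : Measurable fun γ : C(I, X) => γ t :=
  Continuous.measurable (by fun_prop)

theorem measurable_eval : Measurable fun p : C(I, X) × I => p.1 p.2 :=
  Continuous.measurable (by fun_prop)

/-- The compression bound integrated in time; the constant survives because |A| ≤ 1. -/
theorem map_eval_prod_le [IsProbabilityMeasure π] {C : ℝ≥0}
    (hC : ∀ t : I, π.map (fun γ => γ t) ≤ C • m) (A : Set I) :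
    (π.prod (volume.restrict A)).map (fun p : C(I, X) × I => p.1 p.2) ≤ C • m := by
  rw [Measure.le_iff]
  intro s hs
  rw [Measure.map_apply measurable_eval hs, Measure.prod_apply_symm (measurable_eval hs)]
  calc ∫⁻ t, π ((fun γ => (γ, t)) ⁻¹' ((fun p : C(I, X) × I => p.1 p.2) ⁻¹' s)) ∂volume.restrict A
      ≤ ∫⁻ t, (C • m) s ∂volume.restrict A := by
        refine lintegral_mono fun t => ?_
        have := Measure.le_iff.1 (hC t) s hs
        rwa [Measure.map_apply (measurable_eval_at t) hs] at this
    _ = (C • m) s * volume A := by simp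
    _ ≤ (C • m) s * 1 := by gcongr; exact prob_le_one
    _ = (C • m) s := mul_one _

/-- Approximate `w` in L¹(m) by a bounded continuous function. Compression makes the error uniform
in `s`, and for the approximation dominated convergence applies because curves are continuous. -/
theorem tendstoL1_eval [IsProbabilityMeasure π] (hm : BoundedlyFinite m) {C : ℝ≥0}
    (hC : ∀ t : I, π.map (fun γ => γ t) ≤ C • m) {w : X → ℝ} (hw : Integrable w m) :
    TendstoL1 π (fun (s : I) γ => w (γ s)) (𝓝 0) (fun γ => w (γ 0)) := by
  have : IsLocallyFiniteMeasure m := ⟨fun x => ⟨Metric.ball x 1, Metric.ball_mem_nhds x one_pos,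
    hm _ Metric.isBounded_ball⟩⟩
  rw [TendstoL1, ENNReal.tendsto_nhds_zero]
  intro ε hε
  rcases eq_or_ne ε ∞ with rfl | hεt
  · exact Eventually.of_forall fun _ => le_top
  -- Chosen so that `C * δ ≤ ε / 3`; the `+ 1` covers `C = 0`.
  set δ : ℝ≥0∞ := ε / 3 / ((C : ℝ≥0∞) + 1) with hδ
  have hδ0 : δ ≠ 0 := by
    simp only [hδ, ne_eq, ENNReal.div_eq_zero_iff, not_or]
    exact ⟨⟨hε.ne', by norm_num⟩, by simp⟩
  obtain ⟨φ, hφ, hφm⟩ := (memLp_one_iff_integrable.2 hw).exists_boundedContinuous_eLpNorm_sub_le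
    ENNReal.one_ne_top hδ0
  have hφi := memLp_one_iff_integrable.1 hφm
  have hbound : ∀ s : I, eLpNorm (fun γ : C(I, X) => w (γ s) - φ (γ s)) 1 π ≤ ε / 3 := by
    intro s
    refine (eLpNorm_comp_le_of_map_le (measurable_eval_at s) (hC s) (w := fun x => w x - φ x)
      (hw.1.sub hφi.1) ENNReal.one_ne_top).trans ?_
    calc ((C ^ (1 : ℝ≥0∞).toReal⁻¹ : ℝ≥0) : ℝ≥0∞) * eLpNorm (fun x => w x - φ x) 1 m
        ≤ ((C : ℝ≥0∞) + 1) * δ := by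
          gcongr
          · simp
          · exact hφ
      _ = ε / 3 := ENNReal.mul_div_cancel (by simp) (by simp)
  have hcont : Tendsto (fun s : I => eLpNorm (fun γ : C(I, X) => φ (γ s) - φ (γ 0)) 1 π) (𝓝 0)
      (𝓝 0) := by
    simp_rw [eLpNorm_one_eq_lintegral_enorm]
    have h1 : Tendsto (fun s : I => ∫⁻ γ : C(I, X), ‖φ (γ s) - φ (γ 0)‖ₑ ∂π) (𝓝 0)
        (𝓝 (∫⁻ γ : C(I, X), 0 ∂π)) := by
      refine tendsto_lintegral_filter_of_dominated_convergence
        (fun _ => ENNReal.ofReal (2 * ‖φ‖)) ?_ ?_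
        (by rw [lintegral_const, measure_univ, mul_one]; exact ENNReal.ofReal_ne_top) (ae_of_all _ fun γ => ?_)
      · exact Eventually.of_forall fun s => Continuous.measurable (by fun_prop)
      · refine Eventually.of_forall fun s => ae_of_all _ fun γ => ?_
        rw [← ofReal_norm]
        refine ENNReal.ofReal_le_ofReal ((norm_sub_le _ _).trans ?_)
        linarith [φ.norm_coe_le_norm (γ s), φ.norm_coe_le_norm (γ 0)]
      · have : Continuous fun s : I => ‖φ (γ s) - φ (γ 0)‖ₑ := by fun_prop
        simpa using this.tendsto 0
    simpa using h1
  have hε3 : 0 < ε / 3 := ENNReal.div_pos hε.ne' (by norm_num)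
  filter_upwards [hcont.eventually_le_const hε3] with s hs
  have hm1 : ∀ s : I, AEStronglyMeasurable (fun γ : C(I, X) => w (γ s)) π := fun s =>
    aestronglyMeasurable_comp_of_map_le (measurable_eval_at s) (hC s) hw.1
  have hm2 : ∀ s : I, AEStronglyMeasurable (fun γ : C(I, X) => φ (γ s)) π := fun s =>
    (Continuous.measurable (by fun_prop)).aestronglyMeasurable
  have e : (fun γ : C(I, X) => w (γ s) - w (γ 0)) = (fun γ => w (γ s) - φ (γ s))
      + (fun γ => φ (γ s) - φ (γ 0)) + (fun γ => φ (γ 0) - w (γ 0)) := by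
    ext γ
    simp
  rw [e]
  have h3 : eLpNorm (fun γ : C(I, X) => φ (γ 0) - w (γ 0)) 1 π ≤ ε / 3 := by
    have := hbound 0
    rwa [← eLpNorm_neg, show -(fun γ : C(I, X) => w (γ 0) - φ (γ 0))
      = fun γ : C(I, X) => φ (γ 0) - w (γ 0) by ext γ; simp] at this
  calc _ ≤ _ := eLpNorm_add_le (((hm1 s).sub (hm2 s)).add ((hm2 s).sub (hm2 0)))
        ((hm2 0).sub (hm1 0)) le_rfl
    _ ≤ (ε / 3 + ε / 3) + ε / 3 := by
      refine add_le_add ?_ h3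
      refine (eLpNorm_add_le ((hm1 s).sub (hm2 s)) ((hm2 s).sub (hm2 0)) le_rfl).trans ?_
      exact add_le_add (hbound s) hs
    _ = ε := ENNReal.add_thirds ε

theorem tendsto_average_Icc {Ψ : I → ℝ} (hΨ : Integrable Ψ) (h0 : Tendsto Ψ (𝓝 0) (𝓝 (Ψ 0))) :
    Tendsto (fun t : I => (t : ℝ)⁻¹ * ∫ s in Icc 0 t, Ψ s) (𝓝[>] 0) (𝓝 (Ψ 0)) := by
  rw [Metric.tendsto_nhds]
  intro ε hε
  have h1 := (Metric.tendsto_nhds.1 h0) (ε / 2) (half_pos hε)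
  obtain ⟨δ, hδ, hball⟩ := Metric.eventually_nhds_iff.1 h1
  have h2 : ∀ᶠ t : I in 𝓝[>] 0, dist t 0 < δ :=
    mem_nhdsWithin_of_mem_nhds (Metric.ball_mem_nhds 0 hδ)
  filter_upwards [h2, self_mem_nhdsWithin] with t ht htpos
  have ht0 : (0 : ℝ) < t := htpos
  have hvol : volume.real (Icc 0 t) = t := by
    rw [Measure.real, unitInterval.volume_Icc]
    simp [ht0.le]
  have e : (t : ℝ)⁻¹ * (∫ s in Icc 0 t, Ψ s) - Ψ 0 = (t : ℝ)⁻¹ * ∫ s in Icc 0 t, (Ψ s - Ψ 0) := by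
    rw [integral_sub hΨ.integrableOn (integrable_const _), setIntegral_const, hvol, smul_eq_mul]
    field_simp
  rw [Real.dist_eq, e, abs_mul, abs_inv, abs_of_pos ht0]
  have h3 : ‖∫ s in Icc 0 t, (Ψ s - Ψ 0)‖ ≤ ε / 2 * volume.real (Icc 0 t) := by
    refine norm_setIntegral_le_of_norm_le_const (measure_lt_top _ _) fun s hs => ?_
    have hs1 : dist s 0 < δ := by
      refine lt_of_le_of_lt ?_ ht
      simp only [Subtype.dist_eq, Real.dist_eq, Set.Icc.coe_zero, sub_zero]
      rw [abs_of_nonneg s.2.1, abs_of_nonneg t.2.1]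
      exact hs.2
    exact (hball hs1).le
  rw [hvol, Real.norm_eq_abs] at h3
  calc (t : ℝ)⁻¹ * |∫ s in Icc 0 t, (Ψ s - Ψ 0)| ≤ (t : ℝ)⁻¹ * (ε / 2 * t) := by gcongr
    _ = ε / 2 := by field_simp
    _ < ε := half_lt_self hε

/-- The integral of `h(γ) w(γ_s)` over `π ⊗ ds` on `[0, t]`. -/
noncomputable def averagedIntegral (π : Measure C(I, X)) (h : C(I, X) → ℝ) (w : X → ℝ) (t : I) : ℝ :=
  ∫ p : C(I, X) × I, h p.1 * w (p.1 p.2) ∂(π.prod (volume.restrict (Icc 0 t)))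

theorem integrable_mul_eval_prod [IsProbabilityMeasure π] {C : ℝ≥0}
    (hC : ∀ t : I, π.map (fun γ => γ t) ≤ C • m) {h : C(I, X) → ℝ}
    (hh : AEStronglyMeasurable h π) {M : ℝ} (hM : ∀ᵐ γ ∂π, |h γ| ≤ M) {w : X → ℝ}
    (hw : Integrable w m) (A : Set I) :
    Integrable (fun p : C(I, X) × I => h p.1 * w (p.1 p.2)) (π.prod (volume.restrict A)) :=
  (integrable_comp_of_map_le measurable_eval (map_eval_prod_le hC A) hw).bdd_mul (c := M)
    hh.comp_fst (Measure.quasiMeasurePreserving_fst.ae (by simpa using hM))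

/-- By Fubini this is the mean over [0, t] of s ↦ ∫ h w(γ_s) dπ, which is continuous at 0. -/
theorem tendsto_averagedIntegral [IsProbabilityMeasure π] (hm : BoundedlyFinite m) {C : ℝ≥0}
    (hC : ∀ t : I, π.map (fun γ => γ t) ≤ C • m) {h : C(I, X) → ℝ}
    (hh : AEStronglyMeasurable h π) {M : ℝ} (hM : ∀ᵐ γ ∂π, |h γ| ≤ M) {w : X → ℝ}
    (hw : Integrable w m) :
    Tendsto (fun t : I => (t : ℝ)⁻¹ * averagedIntegral π h w t) (𝓝[>] 0)
      (𝓝 (∫ γ, h γ * w (γ 0) ∂π)) := by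
  have hi := integrable_mul_eval_prod hC hh hM hw univ
  rw [Measure.restrict_univ] at hi
  refine (tendsto_average_Icc (Ψ := fun s => ∫ γ, h γ * w (γ s) ∂π) hi.integral_prod_right ?_).congr
    fun t => ?_
  · exact (tendstoL1_eval hm hC hw).integral_mul
      (fun s => aestronglyMeasurable_comp_of_map_le (measurable_eval_at s) (hC s) hw.1)
      (integrable_comp_of_map_le (measurable_eval_at 0) (hC 0) hw) hh hM
  · rw [averagedIntegral, integral_prod_symm _ (integrable_mul_eval_prod hC hh hM hw _)]

theorem ae_isAC2 (hk : ∫⁻ γ, energy 1 γ ^ 2 ∂π < ∞) : ∀ᵐ γ ∂π, IsAC2 γ := by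
  have h1 := ae_lt_top ((measurable_energy (X := X) 1).pow_const 2) hk.ne
  filter_upwards [h1] with γ hγ
  by_contra hc
  simp [energy, hc] at hγ

theorem memLp_energy [IsProbabilityMeasure π] (hk : ∫⁻ γ, energy 1 γ ^ 2 ∂π < ∞) {t : I}
    (ht : 0 < t) : MemLp (fun γ : C(I, X) => (energy t γ).toReal / (t : ℝ)) 2 π := by
  have ht0 : (0 : ℝ) < t := ht
  have hmeas : ∀ t : I, Measurable fun γ : C(I, X) => (energy t γ).toReal / (t : ℝ) := fun t =>
    (measurable_energy t).ennreal_toReal.div_const _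
  have h1 : MemLp (fun γ : C(I, X) => (energy 1 γ).toReal) 2 π := by
    refine ⟨(measurable_energy 1).ennreal_toReal.aestronglyMeasurable, ?_⟩
    have h2 : eLpNorm (fun γ : C(I, X) => (energy 1 γ).toReal) 2 π ^ 2 < ∞ := by
      rw [eLpNorm_two_sq]
      refine lt_of_le_of_lt (lintegral_mono fun γ => ?_) hk
      gcongr
      rw [Real.enorm_eq_ofReal ENNReal.toReal_nonneg]
      exact ENNReal.ofReal_toReal_le
    by_contra hc
    rw [not_lt, top_le_iff] at hc
    simp [hc] at h2
  -- From (E_{2,t}/t)² = t⁻¹ ∫_0^t |γ'|² ≤ t⁻¹ E_{2,1}².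
  refine (h1.const_mul (√(t : ℝ)⁻¹)).of_le (hmeas t).aestronglyMeasurable ?_
  filter_upwards [ae_isAC2 hk] with γ hγ
  rw [Real.norm_of_nonneg (by positivity), Real.norm_of_nonneg (by positivity)]
  refine le_of_sq_le_sq ?_ (by positivity)
  have h3 := energy_div_sq hγ (t := 1) one_pos
  simp only [Set.Icc.coe_one, div_one, inv_one, one_mul] at h3
  rw [energy_div_sq hγ ht, mul_pow, Real.sq_sqrt (by positivity), h3]
  refine mul_le_mul_of_nonneg_left (setIntegral_mono_set hγ.integrable_sq.integrableOn
    (ae_of_all _ fun s => sq_nonneg _) (LE.le.eventuallyLE ?_)) (by positivity)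
  exact Icc_subset_Icc_right unitInterval.le_one'

end Plans

end MetricSobolev

namespace MetricSobolev

/-! ### Derivatives of Sobolev functions along the plan. -/

section Derivation

variable {X : Type*} [MetricSpace X] [SecondCountableTopology X] [MeasurableSpace X] [BorelSpace X]
  [MeasurableSpace C(I, X)] [BorelSpace C(I, X)] {m : Measure X} {π : Measure C(I, X)}
  [IsProbabilityMeasure π]

theorem integral_mul_quotient_le_of_isLipBs (hm : BoundedlyFinite m) {C : ℝ≥0}
    (hC : ∀ t : I, π.map (fun γ => γ t) ≤ C • m) (hk : ∫⁻ γ, energy 1 γ ^ 2 ∂π < ∞)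
    {h : C(I, X) → ℝ} (hh : AEStronglyMeasurable h π) {M : ℝ}
    (hM : ∀ᵐ γ ∂π, 0 ≤ h γ ∧ h γ ≤ M) {t : I} (ht : 0 < t) {u : X → ℝ} (hu : IsLipBs u) :
    ∫ γ, h γ * ((u (γ t) - u (γ 0)) / (t : ℝ)) ∂π ≤
      2⁻¹ * ((t : ℝ)⁻¹ * averagedIntegral π h (fun x => rlip u x * rlip u x) t)
      + 2⁻¹ * ∫ γ, h γ * ((energy t γ).toReal / (t : ℝ)) ^ 2 ∂π := by
  have ht0 : (0 : ℝ) < t := ht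
  have hM' : ∀ᵐ γ ∂π, |h γ| ≤ M := by
    filter_upwards [hM] with γ hγ
    rw [abs_of_nonneg hγ.1]
    exact hγ.2
  have hw : Integrable (fun x => rlip u x * rlip u x) m := by
    simpa [sq] using (hu.memLp_rlip hm).integrable_sq
  have hprod := integrable_mul_eval_prod hC hh hM' hw (Icc 0 t)
  have hE : Integrable (fun γ => h γ * ((energy t γ).toReal / (t : ℝ)) ^ 2) π :=
    (memLp_energy hk ht).integrable_sq.bdd_mul (c := M) hh (by simpa using hM')
  have hu2 : ∀ s : I, Integrable (fun γ : C(I, X) => u (γ s)) π := fun s =>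
    (memLp_comp_of_map_le (measurable_eval_at s) (hC s) (by norm_num) (hu.memLp hm)).integrable
      (by norm_num)
  have hq : Integrable (fun γ => h γ * ((u (γ t) - u (γ 0)) / (t : ℝ))) π :=
    (((hu2 t).sub (hu2 0)).div_const _).bdd_mul (c := M) hh (by simpa using hM')
  have hA := hprod.integral_prod_left
  rw [averagedIntegral, integral_prod _ hprod, ← integral_const_mul, ← integral_const_mul,
    ← integral_const_mul, ← integral_add ((hA.const_mul _).const_mul _) (hE.const_mul _)]
  refine integral_mono_ae hq (((hA.const_mul _).const_mul _).add (hE.const_mul _)) ?_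
  obtain ⟨⟨K, hK⟩, -⟩ := hu
  filter_upwards [hM, ae_isAC2 hk] with γ hγ hAC
  have h1 := (le_abs_self _).trans (abs_sub_le_of_isAC2 hAC ht hK)
  simp only [integral_const_mul, ← sq]
  have h2 : (u (γ t) - u (γ 0)) / (t : ℝ) ≤ 2⁻¹ * ((t : ℝ)⁻¹ * ∫ s in Icc 0 t, rlip u (γ s) ^ 2)
      + 2⁻¹ * ((energy t γ).toReal / (t : ℝ)) ^ 2 := by
    rw [div_le_iff₀ ht0]
    refine h1.trans (le_of_eq ?_)
    generalize (∫ s in Icc 0 t, rlip u (γ s) ^ 2) = a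
    field_simp
  have h3 := mul_le_mul_of_nonneg_left h2 hγ.1
  refine h3.trans (le_of_eq ?_)
  ring

/-- Limit of the Lipschitz case along functions converging to `g` whose slopes converge strongly to
|Dg|. At fixed `t`, bounded compression carries both convergences to `π` and to π ⊗ ds. -/
theorem integral_mul_quotient_le (hm : BoundedlyFinite m) {C : ℝ≥0}
    (hC : ∀ t : I, π.map (fun γ => γ t) ≤ C • m) (hk : ∫⁻ γ, energy 1 γ ^ 2 ∂π < ∞)
    {h : C(I, X) → ℝ} (hh : AEStronglyMeasurable h π) {M : ℝ}
    (hM : ∀ᵐ γ ∂π, 0 ≤ h γ ∧ h γ ≤ M) {t : I} (ht : 0 < t) {g : X → ℝ} (hg : MemW12 m g) :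
    ∫ γ, h γ * ((g (γ t) - g (γ 0)) / (t : ℝ)) ∂π ≤
      2⁻¹ * ((t : ℝ)⁻¹ * averagedIntegral π h (fun x => relaxedSlope m g x * relaxedSlope m g x) t)
      + 2⁻¹ * ∫ γ, h γ * ((energy t γ).toReal / (t : ℝ)) ^ 2 ∂π := by
  have hM' : ∀ᵐ γ ∂π, |h γ| ≤ M := by
    filter_upwards [hM] with γ hγ
    rw [abs_of_nonneg hγ.1]
    exact hγ.2
  obtain ⟨hD, ⟨u, hu, hlim⟩, -⟩ := isMinimalRelaxedSlope_relaxedSlope hm hg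
  have hum : ∀ n, MemLp (u n) 2 m := fun n => (hu.1 n).memLp hm
  have hrm : ∀ n, MemLp (rlip (u n)) 2 m := fun n => (hu.1 n).memLp_rlip hm
  have htwo : (2 : ℝ≥0∞) ≠ ∞ := by norm_num
  have hcomp : ∀ (s : I) (v : X → ℝ), MemLp v 2 m → MemLp (fun γ : C(I, X) => v (γ s)) 2 π :=
    fun s v hv => memLp_comp_of_map_le (measurable_eval_at s) (hC s) htwo hv
  have hev : ∀ s : I, TendstoL2 π (fun n γ => u n (γ s)) atTop (fun γ => g (γ s)) := fun s =>
    tendsto_eLpNorm_comp_of_map_le (measurable_eval_at s) (hC s) htwo (fun n => (hum n).1) hg.1.1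
      hu.2
  have hquot : TendstoL1 π (fun n γ => (t : ℝ)⁻¹ * (u n (γ t) - u n (γ 0))) atTop
      (fun γ => (t : ℝ)⁻¹ * (g (γ t) - g (γ 0))) :=
    (((hev t).sub (hev 0) (fun n => hcomp t _ (hum n)) (hcomp t _ hg.1)
      (fun n => hcomp 0 _ (hum n)) (hcomp 0 _ hg.1)).const_mul _).tendstoL1
      (fun n => (((hcomp t _ (hum n)).sub (hcomp 0 _ (hum n))).const_mul _).1)
      (((hcomp t _ hg.1).sub (hcomp 0 _ hg.1)).const_mul _).1
  have hlhs := hquot.integral_mul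
    (fun n => (((hcomp t _ (hum n)).sub (hcomp 0 _ (hum n))).const_mul _).1)
    ((((hcomp t _ hg.1).sub (hcomp 0 _ hg.1)).const_mul _).integrable (by norm_num)) hh hM'
  have hsq : TendstoL1 m (fun n x => rlip (u n) x * rlip (u n) x) atTop
      (fun x => relaxedSlope m g x * relaxedSlope m g x) :=
    TendstoL2.mul (l := atTop) hlim hlim (fun n => (hrm n).1) (fun n => (hrm n).1) hD hD
  have hsq' : TendstoL1 (π.prod (volume.restrict (Icc 0 t)))
      (fun n (p : C(I, X) × I) => rlip (u n) (p.1 p.2) * rlip (u n) (p.1 p.2)) atTop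
      (fun p => relaxedSlope m g (p.1 p.2) * relaxedSlope m g (p.1 p.2)) :=
    tendsto_eLpNorm_comp_of_map_le (f := fun x => relaxedSlope m g x * relaxedSlope m g x)
      (u := fun n x => rlip (u n) x * rlip (u n) x) measurable_eval
      (map_eval_prod_le hC (Icc 0 t)) ENNReal.one_ne_top
      (fun n => (hrm n).1.mul (hrm n).1) (hD.1.mul hD.1) hsq
  have hDD : Integrable (fun x => relaxedSlope m g x * relaxedSlope m g x) m := by
    simpa [sq] using hD.integrable_sq
  have hrhs : Tendsto (fun n => averagedIntegral π h (fun x => rlip (u n) x * rlip (u n) x) t) atTop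
      (𝓝 (averagedIntegral π h (fun x => relaxedSlope m g x * relaxedSlope m g x) t)) :=
    hsq'.integral_mul (h := fun p : C(I, X) × I => h p.1) (M := M)
      (fun n => aestronglyMeasurable_comp_of_map_le (w := fun x => rlip (u n) x * rlip (u n) x)
        measurable_eval (map_eval_prod_le hC (Icc 0 t)) ((hrm n).1.mul (hrm n).1))
      (integrable_comp_of_map_le measurable_eval (map_eval_prod_le hC (Icc 0 t)) hDD) hh.comp_fst
      (Measure.quasiMeasurePreserving_fst.ae hM')
  simp_rw [← div_eq_inv_mul] at hlhs
  exact le_of_tendsto_of_tendsto' hlhs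
    (((hrhs.const_mul _).const_mul _).add_const _) fun n =>
    integral_mul_quotient_le_of_isLipBs hm hC hk hh hM ht (hu.1 n)

/-- Strong convergence of the difference quotients of the function whose gradient is represented. -/
theorem RepresentsGradient.tendstoL1_quotient (hm : BoundedlyFinite m) {C : ℝ≥0}
    (hC : ∀ t : I, π.map (fun γ => γ t) ≤ C • m) (hk : ∫⁻ γ, energy 1 γ ^ 2 ∂π < ∞)
    {f : X → ℝ} (hf : MemW12 m f) (hπf : RepresentsGradient m π f) :
    TendstoL1 π (fun (t : I) γ => (f (γ t) - f (γ 0)) / (t : ℝ)) (𝓝[>] 0)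
      (fun γ => relaxedSlope m f (γ 0) * relaxedSlope m f (γ 0)) := by
  have hD : MemLp (fun γ : C(I, X) => relaxedSlope m f (γ 0)) 2 π :=
    memLp_comp_of_map_le (measurable_eval_at 0) (hC 0) (by norm_num) (memLp_relaxedSlope hm hf)
  have hfm : ∀ s : I, AEStronglyMeasurable (fun γ : C(I, X) => f (γ s)) π := fun s =>
    aestronglyMeasurable_comp_of_map_le (measurable_eval_at s) (hC s) hf.1.1
  have hEm : ∀ s : I, AEStronglyMeasurable (fun γ : C(I, X) => (energy s γ).toReal) π := fun s =>
    (measurable_energy s).ennreal_toReal.aestronglyMeasurable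
  have h1 := TendstoL2.mul (l := 𝓝[>] 0) hπf.quotient hπf.speed
    (fun t => (((hfm t).sub (hfm 0)).aemeasurable.div (hEm t).aemeasurable).aestronglyMeasurable)
    (fun t => ((hEm t).aemeasurable.div_const _).aestronglyMeasurable) hD hD
  refine Tendsto.congr' ?_ h1
  filter_upwards [self_mem_nhdsWithin] with t ht
  have ht0 : (0 : ℝ) < t := ht
  refine eLpNorm_congr_ae ?_
  filter_upwards [ae_isAC2 hk] with γ hγ
  congr 1
  -- The quotient by `t` is the product of the quotient by the energy and of energy/t. When the
  -- energy vanishes, γ_t = γ_0 and both sides are 0.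
  by_cases hE : (energy t γ).toReal = 0
  · rw [eq_of_energy_eq_zero hγ ht hE]
    simp
  · field_simp

theorem tendsto_integral_mul_sq_energy (hm : BoundedlyFinite m) {C : ℝ≥0}
    (hC : ∀ t : I, π.map (fun γ => γ t) ≤ C • m)
    {f : X → ℝ} (hf : MemW12 m f) (hπf : RepresentsGradient m π f)
    {h : C(I, X) → ℝ} (hh : AEStronglyMeasurable h π) {M : ℝ} (hM : ∀ᵐ γ ∂π, |h γ| ≤ M) :
    Tendsto (fun t : I => ∫ γ, h γ * ((energy t γ).toReal / (t : ℝ)) ^ 2 ∂π) (𝓝[>] 0)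
      (𝓝 (∫ γ, h γ * relaxedSlope m f (γ 0) ^ 2 ∂π)) := by
  have hD : MemLp (fun γ : C(I, X) => relaxedSlope m f (γ 0)) 2 π :=
    memLp_comp_of_map_le (measurable_eval_at 0) (hC 0) (by norm_num) (memLp_relaxedSlope hm hf)
  have hEm : ∀ s : I, AEStronglyMeasurable
      (fun γ : C(I, X) => (energy s γ).toReal / (s : ℝ)) π := fun s =>
    ((measurable_energy s).ennreal_toReal.div_const _).aestronglyMeasurable
  have h1 := TendstoL2.mul (l := 𝓝[>] 0) hπf.speed hπf.speed hEm hEm hD hD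
  simp_rw [sq]
  exact h1.integral_mul (fun t => (hEm t).mul (hEm t)) (by simpa [sq] using hD.integrable_sq) hh hM

/-- Upper bound for the derivative along a plan representing the gradient of `f`. -/
theorem eventually_integral_mul_quotient_le (hm : BoundedlyFinite m)
    (hH : InfinitesimallyHilbertian m) {C : ℝ≥0}
    (hC : ∀ t : I, π.map (fun γ => γ t) ≤ C • m) (hk : ∫⁻ γ, energy 1 γ ^ 2 ∂π < ∞)
    {f g : X → ℝ} (hf : MemW12 m f) (hg : MemW12 m g) (hπf : RepresentsGradient m π f)
    {h : C(I, X) → ℝ} (hh : AEStronglyMeasurable h π) {M : ℝ}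
    (hM : ∀ᵐ γ ∂π, 0 ≤ h γ ∧ h γ ≤ M) {b : ℝ} (hb : ∫ γ, h γ * gradInner m g f (γ 0) ∂π < b) :
    ∀ᶠ t : I in 𝓝[>] 0, ∫ γ, h γ * ((g (γ t) - g (γ 0)) / (t : ℝ)) ∂π < b := by
  have hM' : ∀ᵐ γ ∂π, |h γ| ≤ M := by
    filter_upwards [hM] with γ hγ
    rw [abs_of_nonneg hγ.1]
    exact hγ.2
  have hsqi : ∀ {v : X → ℝ}, MemW12 m v → Integrable (fun x => relaxedSlope m v x ^ 2) m :=
    fun hv => (memLp_relaxedSlope hm hv).integrable_sq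
  have hgi : Integrable (fun x => gradInner m g f x) m :=
    (((hsqi (memW12_add hm hg hf)).sub (hsqi hg)).sub (hsqi hf)).div_const 2
  have hint : ∀ {w : X → ℝ}, Integrable w m → Integrable (fun γ : C(I, X) => h γ * w (γ 0)) π :=
    fun hw => (integrable_comp_of_map_le (measurable_eval_at 0) (hC 0) hw).bdd_mul (c := M) hh
      (by simpa using hM')
  set A := ∫ γ, h γ * gradInner m g f (γ 0) ∂π with hA
  set B := ∫ γ, h γ * relaxedSlope m g (γ 0) ^ 2 ∂π with hB
  -- choose the size of the perturbation
  have hlim : Tendsto (fun n : ℕ => A + 2⁻¹ * (1 / ((n : ℝ) + 1)) * B) atTop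
      (𝓝 (A + 2⁻¹ * 0 * B)) :=
    tendsto_const_nhds.add ((tendsto_one_div_add_atTop_nhds_zero_nat.const_mul _).mul_const _)
  rw [mul_zero, zero_mul, add_zero] at hlim
  obtain ⟨n, hn⟩ := (hlim.eventually_lt_const hb).exists
  set c : ℝ := ((n : ℝ) + 1)⁻¹ with hc
  have hc0 : 0 < c := by positivity
  rw [one_div, ← hc] at hn
  set G : X → ℝ := f + fun x => c * g x with hG
  have hGW : MemW12 m G := memW12_add hm hf (memW12_const_mul hm hg c)
  have hexp := relaxedSlope_add_const_mul_sq hm hH hf hg n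
  have hGi : Integrable (fun x => relaxedSlope m G x * relaxedSlope m G x) m := by
    simpa [sq] using hsqi hGW
  have l1 := tendsto_averagedIntegral hm hC hh hM' hGi
  have l2 := tendsto_integral_mul_sq_energy hm hC hf hπf hh hM'
  have hfs : ∀ (v : X → ℝ), MemW12 m v → ∀ s : I, Integrable (fun γ : C(I, X) => v (γ s)) π :=
    fun v hv s => (memLp_comp_of_map_le (measurable_eval_at s) (hC s) (by norm_num)
      hv.1).integrable (by norm_num)
  have l3 := (hπf.tendstoL1_quotient hm hC hk hf).integral_mul
    (fun t => (((hfs f hf t).sub (hfs f hf 0)).div_const _).1)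
    (by
      have := integrable_comp_of_map_le (measurable_eval_at 0) (hC 0) (hsqi hf)
      simpa [sq] using this) hh hM'
  have hr := ((l1.const_mul 2⁻¹).add (l2.const_mul 2⁻¹)).sub l3
  -- Inserting |DG|² = |Df|² + 2c⟨∇g, ∇f⟩ + c²|Dg|², all terms in |Df|² cancel: this uses that the
  -- limit for `f` itself is |Df|², the equality case of Young.
  have hval : 2⁻¹ * (∫ γ, h γ * (relaxedSlope m G (γ 0) * relaxedSlope m G (γ 0)) ∂π)
      + 2⁻¹ * (∫ γ, h γ * relaxedSlope m f (γ 0) ^ 2 ∂π)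
      - ∫ γ, h γ * (relaxedSlope m f (γ 0) * relaxedSlope m f (γ 0)) ∂π
      = c * (A + 2⁻¹ * c * B) := by
    have e1 : ∫ γ, h γ * (relaxedSlope m G (γ 0) * relaxedSlope m G (γ 0)) ∂π
        = (∫ γ, h γ * relaxedSlope m f (γ 0) ^ 2 ∂π) + (2 * c * A + c ^ 2 * B) := by
      have i1 : Integrable (fun γ : C(I, X) => 2 * c * (h γ * gradInner m g f (γ 0))
          + c ^ 2 * (h γ * relaxedSlope m g (γ 0) ^ 2)) π :=
        ((hint hgi).const_mul _).add ((hint (hsqi hg)).const_mul _)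
      rw [hA, hB, ← integral_const_mul, ← integral_const_mul,
        ← integral_add ((hint hgi).const_mul _) ((hint (hsqi hg)).const_mul _),
        ← integral_add (hint (hsqi hf)) i1]
      refine integral_congr_ae ?_
      filter_upwards [ae_comp_of_map_le (measurable_eval_at 0) (hC 0) hexp] with γ hγ
      rw [← sq]
      simp only [hG]
      rw [hγ]
      ring
    rw [e1]
    simp_rw [← sq]
    ring
  rw [hval] at hr
  have hlt : c * (A + 2⁻¹ * c * B) < c * b := mul_lt_mul_of_pos_left hn hc0
  filter_upwards [hr.eventually_lt_const hlt, self_mem_nhdsWithin] with t h1 ht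
  -- The quotient of `G` is that of `f` plus `c` times that of `g`; removing the part of `f` leaves
  -- a bound by `c * b`, and `c` is then cancelled.
  have h2 := integral_mul_quotient_le hm hC hk hh hM ht hGW
  have hquot : ∀ (v : X → ℝ), MemW12 m v →
      Integrable (fun γ : C(I, X) => h γ * ((v (γ t) - v (γ 0)) / (t : ℝ))) π := fun v hv =>
    (((hfs v hv t).sub (hfs v hv 0)).div_const _).bdd_mul (c := M) hh (by simpa using hM')
  have e2 : ∫ γ, h γ * ((G (γ t) - G (γ 0)) / (t : ℝ)) ∂π
      = ∫ γ, h γ * ((f (γ t) - f (γ 0)) / (t : ℝ)) ∂π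
        + c * ∫ γ, h γ * ((g (γ t) - g (γ 0)) / (t : ℝ)) ∂π := by
    rw [← integral_const_mul, ← integral_add (hquot f hf) ((hquot g hg).const_mul _)]
    refine integral_congr_ae (ae_of_all _ fun γ => ?_)
    simp only [hG, Pi.add_apply]
    ring
  rw [e2] at h2
  refine lt_of_mul_lt_mul_left ?_ hc0.le
  linarith

/-- The lower bound is the upper bound for `-g`, by antisymmetry of both sides in `g`. -/
theorem tendsto_integral_mul_quotient_of_nonneg (hm : BoundedlyFinite m)
    (hH : InfinitesimallyHilbertian m) {C : ℝ≥0}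
    (hC : ∀ t : I, π.map (fun γ => γ t) ≤ C • m) (hk : ∫⁻ γ, energy 1 γ ^ 2 ∂π < ∞)
    {f g : X → ℝ} (hf : MemW12 m f) (hg : MemW12 m g) (hπf : RepresentsGradient m π f)
    {h : C(I, X) → ℝ} (hh : AEStronglyMeasurable h π) {M : ℝ}
    (hM : ∀ᵐ γ ∂π, 0 ≤ h γ ∧ h γ ≤ M) :
    Tendsto (fun t : I => ∫ γ, h γ * ((g (γ t) - g (γ 0)) / (t : ℝ)) ∂π) (𝓝[>] 0)
      (𝓝 (∫ γ, h γ * gradInner m g f (γ 0) ∂π)) := by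
  rw [tendsto_order]
  refine ⟨fun a ha => ?_, fun b hb =>
    eventually_integral_mul_quotient_le hm hH hC hk hf hg hπf hh hM hb⟩
  have hneg : ∫ γ, h γ * gradInner m (-g) f (γ 0) ∂π = -∫ γ, h γ * gradInner m g f (γ 0) ∂π := by
    rw [← integral_neg]
    refine integral_congr_ae ?_
    filter_upwards [ae_comp_of_map_le (measurable_eval_at 0) (hC 0)
      (gradInner_neg_left hm hH hf hg)] with γ hγ
    rw [hγ, mul_neg]
  filter_upwards [eventually_integral_mul_quotient_le hm hH hC hk hf (memW12_neg hm hg) hπf hh hM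
    (b := -a) (by rw [hneg]; linarith)] with t ht
  have e : ∫ γ, h γ * (((-g) (γ t) - (-g) (γ 0)) / (t : ℝ)) ∂π
      = -∫ γ, h γ * ((g (γ t) - g (γ 0)) / (t : ℝ)) ∂π := by
    rw [← integral_neg]
    refine integral_congr_ae (ae_of_all _ fun γ => ?_)
    simp only [Pi.neg_apply]
    ring
  rw [e] at ht
  linarith

end Derivation

end MetricSobolev

theorem mainTheorem4 {X : Type*} [MetricSpace X] [CompleteSpace X]
    [TopologicalSpace.SeparableSpace X] [MeasurableSpace X] [BorelSpace X]
    [MeasurableSpace C(unitInterval, X)] [BorelSpace C(unitInterval, X)]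
    (m : MeasureTheory.Measure X) (hm : MetricSobolev.BoundedlyFinite m)
    (hH : MetricSobolev.InfinitesimallyHilbertian m)
    (f : X → ℝ) (hf : MetricSobolev.MemW12 m f)
    (π : MeasureTheory.Measure C(unitInterval, X)) (hπ : MetricSobolev.IsTestPlan m π)
    (hπf : MetricSobolev.RepresentsGradient m π f)
    (g : X → ℝ) (hg : MetricSobolev.MemW12 m g) :
    MetricSobolev.WeakTendstoL1 π
      (fun (t : unitInterval) (γ : C(unitInterval, X)) => (g (γ t) - g (γ 0)) / (t : ℝ))
      (nhdsWithin 0 (Set.Ioi 0))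
      (fun γ => MetricSobolev.gradInner m g f (γ 0)) := by
  have : SecondCountableTopology X := UniformSpace.secondCountable_of_separable X
  have := hπ.isProbabilityMeasure
  obtain ⟨C, hC⟩ := hπ.compression
  have hk := hπ.kineticEnergy
  have hsqi : ∀ {v : X → ℝ}, MetricSobolev.MemW12 m v →
      Integrable (fun x => MetricSobolev.relaxedSlope m v x ^ 2) m :=
    fun hv => (MetricSobolev.memLp_relaxedSlope hm hv).integrable_sq
  have hgi : Integrable (fun x => MetricSobolev.gradInner m g f x) m :=
    (((hsqi (MetricSobolev.memW12_add hm hg hf)).sub (hsqi hg)).sub (hsqi hf)).div_const 2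
  have hgs : ∀ s : unitInterval, Integrable (fun γ : C(unitInterval, X) => g (γ s)) π :=
    fun s => (MetricSobolev.memLp_comp_of_map_le (MetricSobolev.measurable_eval_at s) (hC s)
      (by norm_num) hg.1).integrable (by norm_num)
  have hquot : ∀ t : unitInterval,
      Integrable (fun γ : C(unitInterval, X) => (g (γ t) - g (γ 0)) / (t : ℝ)) π :=
    fun t => ((hgs t).sub (hgs 0)).div_const _
  have hgrad : Integrable (fun γ : C(unitInterval, X) => MetricSobolev.gradInner m g f (γ 0)) π :=
    MetricSobolev.integrable_comp_of_map_le (MetricSobolev.measurable_eval_at 0) (hC 0) hgi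
  refine ⟨hquot, hgrad, fun h hh => ?_⟩
  obtain ⟨M, hM0, hM⟩ : ∃ M : ℝ, 0 ≤ M ∧ ∀ᵐ γ ∂π, |h γ| ≤ M := by
    refine ⟨(eLpNorm h ∞ π).toReal, ENNReal.toReal_nonneg, ?_⟩
    filter_upwards [ae_le_eLpNormEssSup (f := h) (μ := π)] with γ hγ
    have h1 := ENNReal.toReal_mono hh.2.ne (hγ.trans (le_of_eq eLpNorm_exponent_top.symm))
    simpa using h1
  -- Writing h = (h + M) - M, with M bounding |h|, reduces to bounded nonnegative weights.
  have hsplit : ∀ {F : C(unitInterval, X) → ℝ}, Integrable F π →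
      ∫ γ, h γ * F γ ∂π = ∫ γ, (h γ + M) * F γ ∂π - ∫ γ, M * F γ ∂π := by
    intro F hF
    have i1 : Integrable (fun γ => (h γ + M) * F γ) π := by
      refine hF.bdd_mul (c := M + M) (hh.1.add aestronglyMeasurable_const) ?_
      filter_upwards [hM] with γ hγ
      rw [Real.norm_eq_abs]
      refine (abs_add_le _ _).trans ?_
      rw [abs_of_nonneg hM0]
      linarith
    rw [← integral_sub i1 (hF.const_mul M)]
    refine integral_congr_ae (ae_of_all _ fun γ => ?_)
    simp only
    ring
  rw [hsplit hgrad]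
  simp_rw [fun t => hsplit (hquot t)]
  refine Tendsto.sub ?_ ?_
  · refine MetricSobolev.tendsto_integral_mul_quotient_of_nonneg hm hH hC hk hf hg hπf
      (h := fun γ => h γ + M) (hh.1.add aestronglyMeasurable_const) (M := M + M) ?_
    filter_upwards [hM] with γ hγ
    rw [abs_le] at hγ
    constructor <;> linarith [hγ.1, hγ.2]
  · exact MetricSobolev.tendsto_integral_mul_quotient_of_nonneg hm hH hC hk hf hg hπf
      (h := fun _ => M) aestronglyMeasurable_const (M := M) (ae_of_all _ fun _ => ⟨hM0, le_rfl⟩)
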